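/- Let $W(y|x_1,x_2)$ be a two-user discrete memoryless multiple-access channel with finite alphabets $\mathcal X_1,\mathcal X_2,\mathcal Y$. A variable-length code $(M_1,M_2,N_1,N_2)$ consists of two encoders, which map each message $w_j\in\{1,\dots,M_j\}$ to an infinite input sequence $(x_{ji}(w_j))_{i\ge1}$, two stopping times $N_1,N_2$ with respect to the received letters $Y_1,Y_2,\dots$, and two decoders $g_1,g_2$, where $g_j$ maps $Y^{N_j}$ to a message in $\{1,\dots,M_j\}$. The messages $W_1,W_2$ are independent and uniform, $P_e=\Pr\{g_1(Y^{N_1})\ne W_1\text{ or }g_2(Y^{N_2})\ne W_2\}$, the rates are $\frac{\log M_1}{E[N_1]}$ and $\frac{\log M_2}{E[N_2]}$ (with $0<E[N_j]<\infty$), and $N=\min(N_1,N_2)$. Let $0\le r_1,r_2\le1$ and $s\ge0$ with $r_2=s\,r_1$. Let $\mathcal C_{r_1,r_2}$ be the set of pairs $(R_1,R_2)$ such that for every $\epsilon>0$ there is a variable-length code with $\frac{\log M_j}{E[N_j]}\ge R_j$ and $\frac{E[N]}{E[N_j]}\ge r_j$ for $j=1,2$, and $P_e<\epsilon$. Let $\mathcal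 C^{\infty}_{r_1,r_2}\subseteq\mathcal C_{r_1,r_2}$ be the set of pairs for which, for every $\epsilon>0$ and every $L$, such a code exists that also has $E[N_1]\ge L$ and $E[N_2]\ge L$. Let $C_1=\max_{p(x_1)p(x_2)}I(X_1;Y|X_2)$ and $C_2=\max_{p(x_1)p(x_2)}I(X_2;Y|X_1)$. Say that the channel has zero-error capacity zero if every variable-length code with $E[N_1],E[N_2]<\infty$ and $P_e=0$ has $M_1=M_2=1$. **Theorem (outer bound).** Suppose that $(R_1,R_2)\in\mathcal C^{\infty}_{r_1,r_2}$, or that the channel has zero-error capacity zero and $(R_1,R_2)\in\mathcal C_{r_1,r_2}$. Then there is a joint distribution $p(q)p(x_1|q)p(x_2|q)W(y|x_1,x_2)$ with $|\mathcal Q|\le2$ such that $$R_1\le r_1I(X_1;Y|X_2,Q)+(1-r_1)C_1,$$ $$R_2\le r_2I(X_2;Y|X_1,Q)+(1-r_2)C_2,$$ $$sR_1+R_2\le r_2I(X_1,X_2;Y|Q)+s(1-r_1)C_1+(1-r_2)C_2.$$ Moreover, if $r_1,r_2>0$, the set of all $(R_1,R_2)\in\mathbb R^2$ that satisfy these three inequalities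 for some such distribution is the image of the block-code region $\mathcal R_{MAC}$ under $(a_1,a_2)\mapsto(r_1a_1+(1-r_1)C_1,\;r_2a_2+(1-r_2)C_2)$. Here $\mathcal R_{MAC}$ is the set of all $(a_1,a_2)\in\mathbb R^2$ with $a_1\le I(X_1;Y|X_2,Q)$, $a_2\le I(X_2;Y|X_1,Q)$ and $a_1+a_2\le I(X_1,X_2;Y|Q)$ for some such distribution. -/

import Mathlib

open MeasureTheory
open scoped ENNReal

noncomputable section

namespace MAC

/-! ### Entropy and mutual information on a finite sample space (natural logarithms) -/

open Classical in
/-- The law of the random variable `f` on the finite sample space `Ω` with mass function `P`. -/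
def law {Ω A : Type*} [Fintype Ω] (P : Ω → ℝ) (f : Ω → A) (a : A) : ℝ :=
  ∑ ω, if f ω = a then P ω else 0

/-- Shannon entropy `H(f)`, in nats. -/
def entropy {Ω A : Type*} [Fintype Ω] [Fintype A] (P : Ω → ℝ) (f : Ω → A) : ℝ :=
  ∑ a, Real.negMulLog (law P f a)

/-- Conditional mutual information
`I(f; g | h) = H(f, h) + H(g, h) - H(f, g, h) - H(h)`, in nats. -/
def condMutualInfo {Ω A B C : Type*} [Fintype Ω] [Fintype A] [Fintype B] [Fintype C]
    (P : Ω → ℝ) (f : Ω → A) (g : Ω → B) (h : Ω → C) : ℝ :=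
  entropy P (fun ω => (f ω, h ω)) + entropy P (fun ω => (g ω, h ω))
    - entropy P (fun ω => (f ω, g ω, h ω)) - entropy P h

section Channel

variable {X₁ X₂ Y : Type*}

/-! ### Single-letter quantities

A discrete memoryless multiple-access channel is a transition function
`W : X₁ → X₂ → PMF Y` between finite alphabets. -/

section SingleLetter

/-- The joint mass function `p(q) p(x₁|q) p(x₂|q) p(y|x₁,x₂)` on `Q × X₁ × X₂ × Y`. -/
def joint {Q : Type*} [Fintype Q] [Fintype X₁] [Fintype X₂] (W : X₁ → X₂ → PMF Y)
    (pQ : stdSimplex ℝ Q) (p₁ : Q → stdSimplex ℝ X₁) (p₂ : Q → stdSimplex ℝ X₂) :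
    Q × X₁ × X₂ × Y → ℝ :=
  fun ⟨q, x₁, x₂, y⟩ => pQ q * p₁ q x₁ * p₂ q x₂ * (W x₁ x₂ y).toReal

variable {Q : Type*} [Fintype Q] [Fintype X₁] [Fintype X₂] [Fintype Y]

/-- `I(X₁; Y | X₂, Q)`. -/
def info₁ (W : X₁ → X₂ → PMF Y) (pQ : stdSimplex ℝ Q)
    (p₁ : Q → stdSimplex ℝ X₁) (p₂ : Q → stdSimplex ℝ X₂) : ℝ :=
  condMutualInfo (joint W pQ p₁ p₂)
    (fun ⟨_, x₁, _, _⟩ => x₁) (fun ⟨_, _, _, y⟩ => y) (fun ⟨q, _, x₂, _⟩ => (x₂, q))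

/-- `I(X₂; Y | X₁, Q)`. -/
def info₂ (W : X₁ → X₂ → PMF Y) (pQ : stdSimplex ℝ Q)
    (p₁ : Q → stdSimplex ℝ X₁) (p₂ : Q → stdSimplex ℝ X₂) : ℝ :=
  condMutualInfo (joint W pQ p₁ p₂)
    (fun ⟨_, _, x₂, _⟩ => x₂) (fun ⟨_, _, _, y⟩ => y) (fun ⟨q, x₁, _, _⟩ => (x₁, q))

/-- `I(X₁, X₂; Y | Q)`. -/
def info₁₂ (W : X₁ → X₂ → PMF Y) (pQ : stdSimplex ℝ Q)
    (p₁ : Q → stdSimplex ℝ X₁) (p₂ : Q → stdSimplex ℝ X₂) : ℝ :=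
  condMutualInfo (joint W pQ p₁ p₂)
    (fun ⟨_, x₁, x₂, _⟩ => (x₁, x₂)) (fun ⟨_, _, _, y⟩ => y) (fun ⟨q, _, _, _⟩ => q)

/-- The one-point distribution (used for a trivial variable `Q`). -/
def trivialQ : stdSimplex ℝ Unit := ⟨fun _ => 1, by simp [stdSimplex]⟩

/-- `C₁`, the maximum of `I(X₁; Y | X₂)` over `p(x₁) p(x₂)`. -/
def cap₁ (W : X₁ → X₂ → PMF Y) : ℝ :=
  ⨆ p : stdSimplex ℝ X₁ × stdSimplex ℝ X₂, info₁ W trivialQ (fun _ => p.1) (fun _ => p.2)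

/-- `C₂`, the maximum of `I(X₂; Y | X₁)` over `p(x₁) p(x₂)`. -/
def cap₂ (W : X₁ → X₂ → PMF Y) : ℝ :=
  ⨆ p : stdSimplex ℝ X₁ × stdSimplex ℝ X₂, info₂ W trivialQ (fun _ => p.1) (fun _ => p.2)

/-- The block-code region: all pairs satisfying the three standard inequalities for some
`p(q) p(x₁|q) p(x₂|q)` with `|Q| ≤ 2`. -/
def blockRegion (W : X₁ → X₂ → PMF Y) : Set (ℝ × ℝ) :=
  {R | ∃ (pQ : stdSimplex ℝ (Fin 2)) (p₁ : Fin 2 → stdSimplex ℝ X₁)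
      (p₂ : Fin 2 → stdSimplex ℝ X₂),
      R.1 ≤ info₁ W pQ p₁ p₂ ∧
      R.2 ≤ info₂ W pQ p₁ p₂ ∧
      R.1 + R.2 ≤ info₁₂ W pQ p₁ p₂}

/-- The outer region with parameters `r₁`, `r₂` and `s`. -/
def outerRegion (W : X₁ → X₂ → PMF Y) (r₁ r₂ s : ℝ) : Set (ℝ × ℝ) :=
  {R | ∃ (pQ : stdSimplex ℝ (Fin 2)) (p₁ : Fin 2 → stdSimplex ℝ X₁)
      (p₂ : Fin 2 → stdSimplex ℝ X₂),
      R.1 ≤ r₁ * info₁ W pQ p₁ p₂ + (1 - r₁) * cap₁ W ∧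
      R.2 ≤ r₂ * info₂ W pQ p₁ p₂ + (1 - r₂) * cap₂ W ∧
      s * R.1 + R.2 ≤
        r₂ * info₁₂ W pQ p₁ p₂ + s * (1 - r₁) * cap₁ W + (1 - r₂) * cap₂ W}

end SingleLetter

/-! ### Variable-length codes

An output sequence is a function `y : ℕ → Y`; its letters are numbered from `0`, so the first
`n` received letters are `y 0, …, y (n - 1)`. -/

variable [MeasurableSpace Y]

variable (Y) in
/-- The filtration whose `n`-th σ-algebra is generated by the first `n` received letters. -/
def outputFiltration : Filtration ℕ (MeasurableSpace.pi : MeasurableSpace (ℕ → Y)) where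
  seq n := ⨆ i ∈ Finset.range n, MeasurableSpace.comap (fun y : ℕ → Y => y i) inferInstance
  mono' := fun _ _ hmn => biSup_mono fun _ hi =>
    Finset.mem_range.2 ((Finset.mem_range.1 hi).trans_le hmn)
  le' := fun _ => iSup₂_le fun i _ => (measurable_pi_apply i).comap_le

variable (X₁ X₂ Y) in
/-- A variable-length code `(M₁, M₂, N₁, N₂)`: two encoders, which map a message to an infinite
sequence of input letters, two stopping times with respect to the received letters, and two
decoders, which map the finite received sequence to a message. -/
structure VLCode where
  M₁ : ℕ
  M₂ : ℕ
  M₁_pos : 0 < M₁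
  M₂_pos : 0 < M₂
  enc₁ : Fin M₁ → ℕ → X₁
  enc₂ : Fin M₂ → ℕ → X₂
  N₁ : (ℕ → Y) → ℕ∞
  N₂ : (ℕ → Y) → ℕ∞
  stop₁ : IsStoppingTime (outputFiltration Y) N₁
  stop₂ : IsStoppingTime (outputFiltration Y) N₂
  dec₁ : List Y → Fin M₁
  dec₂ : List Y → Fin M₂

/-- The message `w` is correctly decoded by the decoder `g` at the time `N`: the time is finite
and `g`, applied to the letters received up to then, gives `w`. -/
def DecodesTo {M : ℕ} (N : (ℕ → Y) → ℕ∞) (g : List Y → Fin M) (w : Fin M) (y : ℕ → Y) : Prop :=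
  ∃ n : ℕ, N y = n ∧ g (List.ofFn fun i : Fin n => y i) = w

namespace VLCode

/-- The law of the received sequence when the message pair `(w₁, w₂)` is sent. -/
def outputLaw (c : VLCode X₁ X₂ Y) (W : X₁ → X₂ → PMF Y) (w₁ : Fin c.M₁) (w₂ : Fin c.M₂) :
    Measure (ℕ → Y) :=
  Measure.infinitePi fun i => (W (c.enc₁ w₁ i) (c.enc₂ w₂ i)).toMeasure

/-- The expectation of a nonnegative function of the received sequence, when the message pair is
uniformly distributed. -/
def expect (c : VLCode X₁ X₂ Y) (W : X₁ → X₂ → PMF Y) (f : (ℕ → Y) → ℝ≥0∞) : ℝ≥0∞ :=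
  (∑ w₁, ∑ w₂, ∫⁻ y, f y ∂(c.outputLaw W w₁ w₂)) / (c.M₁ * c.M₂)

/-- `E[N₁]`. -/
def meanN₁ (c : VLCode X₁ X₂ Y) (W : X₁ → X₂ → PMF Y) : ℝ≥0∞ :=
  c.expect W fun y => (c.N₁ y : ℝ≥0∞)

/-- `E[N₂]`. -/
def meanN₂ (c : VLCode X₁ X₂ Y) (W : X₁ → X₂ → PMF Y) : ℝ≥0∞ :=
  c.expect W fun y => (c.N₂ y : ℝ≥0∞)

/-- `E[N]`, where `N = min(N₁, N₂)`. -/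
def meanN (c : VLCode X₁ X₂ Y) (W : X₁ → X₂ → PMF Y) : ℝ≥0∞ :=
  c.expect W fun y => (min (c.N₁ y) (c.N₂ y) : ℕ∞)

/-- The average probability that at least one of the two messages is not correctly decoded, when
the message pair is uniformly distributed. -/
def errorProb (c : VLCode X₁ X₂ Y) (W : X₁ → X₂ → PMF Y) : ℝ≥0∞ :=
  (∑ w₁, ∑ w₂, c.outputLaw W w₁ w₂
    {y | ¬ (DecodesTo c.N₁ c.dec₁ w₁ y ∧ DecodesTo c.N₂ c.dec₂ w₂ y)}) / (c.M₁ * c.M₂)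

/-- The mean decoding times are finite. -/
def FiniteMean (c : VLCode X₁ X₂ Y) (W : X₁ → X₂ → PMF Y) : Prop :=
  c.meanN₁ W ≠ ∞ ∧ c.meanN₂ W ≠ ∞

/-- The code has positive finite mean decoding times, rates `log M₁ / E[N₁] ≥ R₁` and
`log M₂ / E[N₂] ≥ R₂`, and ratios `E[N] / E[N₁] ≥ r₁` and `E[N] / E[N₂] ≥ r₂`. -/
def Meets (c : VLCode X₁ X₂ Y) (W : X₁ → X₂ → PMF Y) (r₁ r₂ R₁ R₂ : ℝ) : Prop :=
  c.FiniteMean W ∧ 0 < c.meanN₁ W ∧ 0 < c.meanN₂ W ∧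
  R₁ ≤ Real.log c.M₁ / (c.meanN₁ W).toReal ∧
  R₂ ≤ Real.log c.M₂ / (c.meanN₂ W).toReal ∧
  r₁ ≤ (c.meanN W).toReal / (c.meanN₁ W).toReal ∧
  r₂ ≤ (c.meanN W).toReal / (c.meanN₂ W).toReal

end VLCode

/-- The set of rate pairs that are achieved, with arbitrarily small error probability, by
variable-length codes with `E[N] / E[N₁] ≥ r₁` and `E[N] / E[N₂] ≥ r₂`. -/
def rateRegion (W : X₁ → X₂ → PMF Y) (r₁ r₂ : ℝ) : Set (ℝ × ℝ) :=
  {R | ∀ ε : ℝ≥0∞, 0 < ε → ∃ c : VLCode X₁ X₂ Y, c.Meets W r₁ r₂ R.1 R.2 ∧ c.errorProb W < ε}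

/-- The set of rate pairs that are achieved in the same way by codes whose mean decoding times
`E[N₁]` and `E[N₂]` grow without bound as the error probability tends to zero. -/
def growingRateRegion (W : X₁ → X₂ → PMF Y) (r₁ r₂ : ℝ) : Set (ℝ × ℝ) :=
  {R | ∀ ε : ℝ≥0∞, 0 < ε → ∀ L : ℕ, ∃ c : VLCode X₁ X₂ Y, c.Meets W r₁ r₂ R.1 R.2 ∧
    c.errorProb W < ε ∧ L ≤ c.meanN₁ W ∧ L ≤ c.meanN₂ W}

/-- The zero-error capacity of the channel is zero: a variable-length code with finite mean
decoding times and no error transmits no information. -/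
def ZeroErrorCapacityZero (W : X₁ → X₂ → PMF Y) : Prop :=
  ∀ c : VLCode X₁ X₂ Y, c.FiniteMean W → c.errorProb W = 0 → c.M₁ = 1 ∧ c.M₂ = 1

end Channel

end MAC

end

/-! The proof is a converse by change of measure. Up to `N = min(N₁, N₂)` neither message need be
known. Between `N` and `N_j` one may treat the other user's input as known, so each letter conveys
at most `C_j` nats. Thus `log M_j` is at most, up to small terms, the information gathered before
`N` plus `C_j (E[N_j] - E[N])`, and `log M₁ + log M₂` has a similar bound with both excess terms.
Dividing by `E[N]` and using `E[N] ≥ r_j E[N_j]` shows that the pair with coordinates `C_j + (R_j -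
C_j) / r_j`, the preimage of the rate pair under the affine map, lies arbitrarily close to the block
region. A compactness argument puts it inside, and the inequalities of the block region rescale to
the three of the theorem.

The difficulty lies in the information before `N`. Given `N > i` the two messages are no longer
independent, so the two input letters need not have a product law. Wringing (`exists_wringing_set`)
reveals the input letters at a set of times of total surviving mass at most `1/δ`, such that at
every other time the letters have dependence at most `δ` per unit of mass given the revealed ones.
The divergence of the law of the revealed letters on `N > i` from a product of uniform-message laws
serves as a potential. It starts at zero, is never positive, drops by at most the mass lost through
stopping, and rises by more than `δ` times the mass whenever a time is revealed. Revealing costs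
`log |X₁ × X₂| / δ`, a constant, which is negligible when `E[N]` is large. By compactness
(`exists_cmi_le`) nearly independent letters can be replaced by the product of their marginals. Time
together with the revealed letters then plays the role of `Q`, and `mem_blockRegion_of_average`
reduces it to two values.

The change of measure is `fano`. It compares the channel with a causal reference law under which the
messages can only be guessed. Its reference `refKernel`, used in `converse`, predicts the output
before the end of `A`, and for codes it continues with the capacity-achieving output laws of
`exists_output_law`.

Long decoding times are assumed for the growing region. If the zero-error capacity is zero, then the
possible outputs do not depend on a user's letter, for otherwise `alternatingCode` would send a bit
without error. Hence a code with two messages and bounded mean time has error probability bounded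
below (`errorProb_ge`), and small error forces long times. -/

noncomputable section

set_option linter.unusedSectionVars false

namespace MAC

/-! ### Laws and entropies on a finite space. -/

section Law

variable {Ω A B C : Type*} [Fintype Ω]

lemma law_nonneg {P : Ω → ℝ} (hP : ∀ ω, 0 ≤ P ω) (f : Ω → A) (a : A) : 0 ≤ law P f a :=
  Finset.sum_nonneg fun ω _ => by split_ifs <;> simp [hP]

lemma le_law {P : Ω → ℝ} (hP : ∀ ω, 0 ≤ P ω) (f : Ω → A) (ω : Ω) : P ω ≤ law P f (f ω) := by
  classical
  unfold law
  have h := Finset.single_le_sum (f := fun ω' => if f ω' = f ω then P ω' else 0)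
    (fun ω' _ => by split_ifs <;> simp [hP]) (Finset.mem_univ ω)
  simpa using h

lemma law_congr {P : Ω → ℝ} {f : Ω → A} {g : Ω → B} {a : A} {b : B}
    (h : ∀ ω, f ω = a ↔ g ω = b) : law P f a = law P g b := by
  classical
  unfold law
  exact Finset.sum_congr rfl fun ω _ => if_congr (h ω) rfl rfl

lemma sum_law_mul [Fintype A] (P : Ω → ℝ) (f : Ω → A) (φ : A → ℝ) :
    ∑ a, law P f a * φ a = ∑ ω, P ω * φ (f ω) := by
  classical
  simp only [law, Finset.sum_mul]
  rw [Finset.sum_comm]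
  refine Finset.sum_congr rfl fun ω _ => ?_
  rw [Finset.sum_eq_single (f ω)]
  · simp
  · intro b _ hb
    simp [hb.symm]
  · simp

lemma sum_law [Fintype A] (P : Ω → ℝ) (f : Ω → A) : ∑ a, law P f a = ∑ ω, P ω := by
  simpa using sum_law_mul P f fun _ => 1

lemma sum_law_pair [Fintype B] (P : Ω → ℝ) (f : Ω → A) (g : Ω → B) (a : A) :
    ∑ b, law P (fun ω => (f ω, g ω)) (a, b) = law P f a := by
  classical
  simp only [law]
  rw [Finset.sum_comm]
  refine Finset.sum_congr rfl fun ω _ => ?_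
  by_cases h : f ω = a
  · simp [h]
  · simp [h]

lemma entropy_eq [Fintype A] (P : Ω → ℝ) (f : Ω → A) :
    entropy P f = -∑ ω, P ω * Real.log (law P f (f ω)) := by
  rw [← sum_law_mul P f fun a => Real.log (law P f a), entropy, ← Finset.sum_neg_distrib]
  exact Finset.sum_congr rfl fun a _ => by rw [Real.negMulLog]; ring

/-- Gibbs' inequality for a conditional law. -/
lemma cond_gibbs [Fintype A] [Fintype B] {P : Ω → ℝ} (hP : ∀ ω, 0 ≤ P ω) (f : Ω → A) (g : Ω → B)
    (k : A → B → ℝ) (hk : ∀ a b, 0 ≤ k a b) (hk1 : ∀ a, ∑ b, k a b ≤ 1)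
    (hpos : ∀ ω, 0 < P ω → 0 < k (f ω) (g ω)) :
    0 ≤ ∑ ω, P ω * (Real.log (law P (fun ω => (f ω, g ω)) (f ω, g ω))
      - Real.log (law P f (f ω)) - Real.log (k (f ω) (g ω))) := by
  have hle : ∀ ω, P ω - P ω * (law P f (f ω) * k (f ω) (g ω) /
      law P (fun ω => (f ω, g ω)) (f ω, g ω)) ≤
      P ω * (Real.log (law P (fun ω => (f ω, g ω)) (f ω, g ω))
      - Real.log (law P f (f ω)) - Real.log (k (f ω) (g ω))) := by
    intro ω
    rcases (hP ω).eq_or_lt with h0 | h0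
    · simp [← h0]
    · have h1 : 0 < law P (fun ω => (f ω, g ω)) (f ω, g ω) :=
        h0.trans_le (le_law hP (fun ω => (f ω, g ω)) ω)
      have h2 : 0 < law P f (f ω) := h0.trans_le (le_law hP f ω)
      have h3 := hpos ω h0
      have h4 := Real.log_le_sub_one_of_pos (div_pos (mul_pos h2 h3) h1)
      rw [Real.log_div (mul_pos h2 h3).ne' h1.ne', Real.log_mul h2.ne' h3.ne'] at h4
      nlinarith
  refine le_trans ?_ (Finset.sum_le_sum fun ω _ => hle ω)
  rw [Finset.sum_sub_distrib, sub_nonneg, ← sum_law_mul P (fun ω => (f ω, g ω))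
    (fun p => law P f p.1 * k p.1 p.2 / law P (fun ω => (f ω, g ω)) p), ← sum_law P f,
    Fintype.sum_prod_type]
  refine Finset.sum_le_sum fun a _ => ?_
  calc _ ≤ ∑ b, law P f a * k a b := by
        refine Finset.sum_le_sum fun b _ => ?_
        rcases eq_or_ne (law P (fun ω => (f ω, g ω)) (a, b)) 0 with h | h
        · rw [h, zero_mul]
          exact mul_nonneg (law_nonneg hP _ _) (hk _ _)
        · rw [mul_div_cancel₀ _ h]
    _ ≤ law P f a := by
        rw [← Finset.mul_sum]
        exact mul_le_of_le_one_right (law_nonneg hP _ _) (hk1 a)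

lemma condMutualInfo_eq_sum [Fintype A] [Fintype B] [Fintype C] (P : Ω → ℝ)
    (f : Ω → A) (g : Ω → B) (h : Ω → C) :
    condMutualInfo P f g h = ∑ ω, P ω * (Real.log (law P (fun ω => (f ω, g ω, h ω)) (f ω, g ω, h ω))
      + Real.log (law P h (h ω)) - Real.log (law P (fun ω => (f ω, h ω)) (f ω, h ω))
      - Real.log (law P (fun ω => (g ω, h ω)) (g ω, h ω))) := by
  simp only [condMutualInfo, entropy_eq, mul_sub, mul_add, Finset.sum_sub_distrib,
    Finset.sum_add_distrib]
  ring

/-- This is `cond_gibbs` for the conditional law of `f` given `(g, h)`, with the conditional law of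
`f` given `h` as the reference. -/
lemma condMutualInfo_nonneg [Fintype A] [Fintype B] [Fintype C] {P : Ω → ℝ} (hP : ∀ ω, 0 ≤ P ω)
    (f : Ω → A) (g : Ω → B) (h : Ω → C) : 0 ≤ condMutualInfo P f g h := by
  rw [condMutualInfo_eq_sum]
  have key := cond_gibbs hP (fun ω => (g ω, h ω)) f
    (fun c a => law P (fun ω => (f ω, h ω)) (a, c.2) / law P h c.2)
    (fun c a => div_nonneg (law_nonneg hP _ _) (law_nonneg hP _ _))
    (fun c => by
      rw [← Finset.sum_div]
      refine div_le_one_of_le₀ (le_of_eq ?_) (law_nonneg hP _ _)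
      rw [← sum_law_pair P h f]
      exact Finset.sum_congr rfl fun a _ => law_congr fun ω => by simp [and_comm])
    (fun ω h0 => div_pos (h0.trans_le (le_law hP (fun ω => (f ω, h ω)) ω))
      (h0.trans_le (le_law hP h ω)))
  refine key.trans (le_of_eq (Finset.sum_congr rfl fun ω _ => ?_))
  rcases (hP ω).eq_or_lt with h0 | h0
  · simp [← h0]
  · rw [Real.log_div (h0.trans_le (le_law hP (fun ω => (f ω, h ω)) ω)).ne'
      (h0.trans_le (le_law hP h ω)).ne']
    have : law P (fun ω => ((g ω, h ω), f ω)) ((g ω, h ω), f ω)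
        = law P (fun ω => (f ω, g ω, h ω)) (f ω, g ω, h ω) :=
      law_congr fun ω' => by simp only [Prod.mk.injEq]; tauto
    rw [this]
    ring

end Law

/-! ### Homogeneous mutual information of unnormalized input masses. -/

section MutualInfo

variable {X Y S : Type*} [Fintype X] [Fintype Y]

/-- A real-valued transition matrix with nonnegative entries and rows of sum one. -/
structure IsStochastic (W : X → Y → ℝ) : Prop where
  nonneg : ∀ x y, 0 ≤ W x y
  sum_eq_one : ∀ x, ∑ y, W x y = 1

/-- The entropy of the output letter when the input letter is `x`. -/
def rowEntropy (W : X → Y → ℝ) (x : X) : ℝ := ∑ y, Real.negMulLog (W x y)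

/-- The mutual information between input and output for the (unnormalized) input mass `a`;
it is homogeneous of degree one in `a`. -/
def mi (W : X → Y → ℝ) (a : X → ℝ) : ℝ :=
  ∑ y, Real.negMulLog (∑ x, a x * W x y) - Real.negMulLog (∑ x, a x)
    - ∑ x, a x * rowEntropy W x

open Classical in
/-- The restriction of the mass `a` to the inputs with side information `t`. -/
def restrictTo (s : X → S) (a : X → ℝ) (t : S) (x : X) : ℝ := if s x = t then a x else 0

/-- The mutual information between input and output given the side information `s` about the
input, for the (unnormalized) input mass `a`. -/
def cmi [Fintype S] (W : X → Y → ℝ) (s : X → S) (a : X → ℝ) : ℝ :=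
  ∑ t, mi W (restrictTo s a t)

lemma restrictTo_nonneg {a : X → ℝ} (ha : ∀ x, 0 ≤ a x) (s : X → S) (t : S) (x : X) :
    0 ≤ restrictTo s a t x := by
  unfold restrictTo
  split_ifs <;> simp [ha]

lemma sum_restrictTo [Fintype S] (s : X → S) (a : X → ℝ) (x : X) :
    ∑ t, restrictTo s a t x = a x := by
  classical
  simp [restrictTo]

lemma continuous_mi (W : X → Y → ℝ) : Continuous (mi W) := by
  unfold mi
  have := Real.continuous_negMulLog
  fun_prop

lemma continuous_cmi [Fintype S] (W : X → Y → ℝ) (s : X → S) : Continuous (cmi W s) := by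
  classical
  unfold cmi
  refine continuous_finsetSum _ fun t _ => (continuous_mi W).comp ?_
  refine continuous_pi fun x => ?_
  unfold restrictTo
  split_ifs
  · exact continuous_apply x
  · exact continuous_const

lemma sum_mul_row {W : X → Y → ℝ} (hW : IsStochastic W) (a : X → ℝ) :
    ∑ y, ∑ x, a x * W x y = ∑ x, a x := by
  rw [Finset.sum_comm]
  simp [← Finset.mul_sum, hW.sum_eq_one]

/-- The term with the total mass in `mi` is there for this: since rows sum to one, the two
contributions of `negMulLog c` cancel. -/
lemma mi_smul {W : X → Y → ℝ} (hW : IsStochastic W) (c : ℝ) (a : X → ℝ) :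
    mi W (fun x => c * a x) = c * mi W a := by
  simp only [mi, mul_assoc, ← Finset.mul_sum, Real.negMulLog_mul, Finset.sum_add_distrib]
  rw [← Finset.sum_mul, sum_mul_row hW]
  ring

lemma restrictTo_smul (s : X → S) (c : ℝ) (a : X → ℝ) (t : S) :
    restrictTo s (fun x => c * a x) t = fun x => c * restrictTo s a t x := by
  funext x
  simp only [restrictTo]
  split_ifs <;> simp

lemma cmi_smul [Fintype S] {W : X → Y → ℝ} (hW : IsStochastic W) (s : X → S) (c : ℝ)
    (a : X → ℝ) : cmi W s (fun x => c * a x) = c * cmi W s a := by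
  simp only [cmi, Finset.mul_sum, restrictTo_smul, mi_smul hW]

/-- Mutual information as an average log-likelihood ratio against the output law `q`. -/
lemma mi_eq_sum_log {W : X → Y → ℝ} (hW : IsStochastic W) {a : X → ℝ} (ha : ∀ x, 0 ≤ a x) :
    mi W a = ∑ x, a x * ∑ y, W x y *
      (Real.log (W x y) - Real.log ((∑ x', a x' * W x' y) / ∑ x', a x')) := by
  have h1 : ∀ x y, a x * (W x y * (Real.log (W x y)
      - Real.log ((∑ x', a x' * W x' y) / ∑ x', a x'))) =
      -(a x * Real.negMulLog (W x y)) - a x * W x y * Real.log (∑ x', a x' * W x' y)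
        + a x * W x y * Real.log (∑ x', a x') := by
    intro x y
    rcases (mul_nonneg (ha x) (hW.nonneg x y)).eq_or_lt with h | h
    · rcases mul_eq_zero.1 h.symm with h | h <;> simp [h]
    · have hx : 0 < a x := lt_of_le_of_ne (ha x) fun h' => by simp [← h'] at h
      have h2 : 0 < ∑ x', a x' * W x' y := h.trans_le
        (Finset.single_le_sum (f := fun x' => a x' * W x' y)
          (fun x' _ => mul_nonneg (ha x') (hW.nonneg x' y)) (Finset.mem_univ x))
      have h3 : 0 < ∑ x', a x' := hx.trans_le
        (Finset.single_le_sum (f := fun x' => a x') (fun x' _ => ha x') (Finset.mem_univ x))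
      rw [Real.log_div h2.ne' h3.ne', Real.negMulLog]
      ring
  simp only [Finset.mul_sum, h1]
  simp only [Finset.sum_add_distrib, Finset.sum_sub_distrib, mi, rowEntropy, Finset.mul_sum]
  have h4 : ∑ x, ∑ y, a x * W x y * Real.log (∑ x', a x' * W x' y)
      = - ∑ y, Real.negMulLog (∑ x, a x * W x y) := by
    rw [Finset.sum_comm, ← Finset.sum_neg_distrib]
    refine Finset.sum_congr rfl fun y _ => ?_
    rw [Real.negMulLog, ← Finset.sum_mul]
    ring
  have h5 : ∑ x, ∑ y, a x * W x y * Real.log (∑ x', a x')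
      = - Real.negMulLog (∑ x, a x) := by
    rw [Real.negMulLog, ← sum_mul_row hW a, Finset.sum_comm]
    simp only [← Finset.sum_mul]
    ring
  rw [h4, h5]
  simp only [Finset.sum_neg_distrib]
  ring

/-- Gibbs' inequality for nonnegative masses. -/
lemma sum_mul_log_div_nonneg {ι : Type*} [Fintype ι] {p q : ι → ℝ} (hp : ∀ i, 0 ≤ p i)
    (hq : ∀ i, 0 ≤ q i) (hpq : ∀ i, 0 < p i → 0 < q i) (hsum : ∑ i, q i ≤ ∑ i, p i) :
    0 ≤ ∑ i, p i * (Real.log (p i) - Real.log (q i)) := by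
  have : ∀ i, p i - q i ≤ p i * (Real.log (p i) - Real.log (q i)) := by
    intro i
    rcases (hp i).eq_or_lt with h | h
    · simp [← h, hq i]
    · have h2 := hpq i h
      have h3 := Real.log_le_sub_one_of_pos (div_pos h2 h)
      rw [Real.log_div h2.ne' h.ne'] at h3
      have h4 : p i * (Real.log (q i) - Real.log (p i)) ≤ p i * (q i / p i - 1) :=
        mul_le_mul_of_nonneg_left h3 h.le
      have h5 : p i * (q i / p i - 1) = q i - p i := by field_simp
      linarith
  calc (0 : ℝ) ≤ ∑ i, (p i - q i) := by rw [Finset.sum_sub_distrib]; linarith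
    _ ≤ _ := Finset.sum_le_sum fun i _ => this i

lemma mi_nonneg {W : X → Y → ℝ} (hW : IsStochastic W) {a : X → ℝ} (ha : ∀ x, 0 ≤ a x) :
    0 ≤ mi W a := by
  rw [mi_eq_sum_log hW ha]
  refine Finset.sum_nonneg fun x _ => ?_
  rcases (ha x).eq_or_lt with h | h
  · simp [← h]
  have h3 : 0 < ∑ x', a x' := h.trans_le
        (Finset.single_le_sum (f := fun x' => a x') (fun x' _ => ha x') (Finset.mem_univ x))
  refine mul_nonneg h.le (sum_mul_log_div_nonneg (hW.nonneg x) (fun y => ?_) (fun y hy => ?_) ?_)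
  · exact div_nonneg (Finset.sum_nonneg fun x' _ => mul_nonneg (ha x') (hW.nonneg x' y)) h3.le
  · exact div_pos ((mul_pos h hy).trans_le (Finset.single_le_sum (f := fun x' => a x' * W x' y)
          (fun x' _ => mul_nonneg (ha x') (hW.nonneg x' y)) (Finset.mem_univ x))) h3
  · rw [← Finset.sum_div, sum_mul_row hW, div_self h3.ne', hW.sum_eq_one]

lemma cmi_nonneg [Fintype S] {W : X → Y → ℝ} (hW : IsStochastic W) (s : X → S) {a : X → ℝ}
    (ha : ∀ x, 0 ≤ a x) : 0 ≤ cmi W s a :=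
  Finset.sum_nonneg fun t _ => mi_nonneg hW (restrictTo_nonneg ha s t)

lemma cmi_eq [Fintype S] (W : X → Y → ℝ) (s : X → S) (a : X → ℝ) :
    cmi W s a = ∑ t, ∑ y, Real.negMulLog (∑ x, restrictTo s a t x * W x y)
      - ∑ t, Real.negMulLog (∑ x, restrictTo s a t x) - ∑ x, a x * rowEntropy W x := by
  simp only [cmi, mi, Finset.sum_sub_distrib]
  congr 1
  rw [Finset.sum_comm]
  simp only [← Finset.sum_mul, sum_restrictTo]

end MutualInfo

/-! ### The entropic definitions in terms of `cmi` and `mi`. -/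

section Bridge

variable {X₁ X₂ Y : Type*} [Fintype X₁] [Fintype X₂] [Fintype Y]

/-- The channel as a real transition matrix on the product input alphabet. -/
def chan (W : X₁ → X₂ → PMF Y) (x : X₁ × X₂) (y : Y) : ℝ := (W x.1 x.2 y).toReal

lemma PMF.sum_toReal (p : PMF Y) : ∑ y, (p y).toReal = 1 := by
  rw [← ENNReal.toReal_sum fun y _ => p.apply_ne_top y, ← tsum_fintype (L := .unconditional _), p.tsum_coe]
  rfl

lemma isStochastic_chan (W : X₁ → X₂ → PMF Y) : IsStochastic (chan W) where
  nonneg _ _ := ENNReal.toReal_nonneg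
  sum_eq_one _ := PMF.sum_toReal _

/-- The product of two masses. -/
def prodMass (p₁ : X₁ → ℝ) (p₂ : X₂ → ℝ) (x : X₁ × X₂) : ℝ := p₁ x.1 * p₂ x.2

variable {Q : Type*} [Fintype Q] (W : X₁ → X₂ → PMF Y) (pQ : stdSimplex ℝ Q)
    (p₁ : Q → stdSimplex ℝ X₁) (p₂ : Q → stdSimplex ℝ X₂)

lemma sum_negMulLog_row {W : X₁ → Y → ℝ} (hW : IsStochastic W) (c : ℝ) (x : X₁) :
    ∑ y, Real.negMulLog (c * W x y) = Real.negMulLog c + c * rowEntropy W x := by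
  simp only [Real.negMulLog_mul, Finset.sum_add_distrib, ← Finset.sum_mul, ← Finset.mul_sum,
    hW.sum_eq_one, rowEntropy, one_mul]

lemma sum_restrictTo_snd (a : X₁ × X₂ → ℝ) (t : X₂) (g : X₁ × X₂ → ℝ) :
    ∑ x, restrictTo Prod.snd a t x * g x = ∑ x₁, a (x₁, t) * g (x₁, t) := by
  classical
  simp [restrictTo, Fintype.sum_prod_type, ite_mul]

lemma sum_restrictTo_fst (a : X₁ × X₂ → ℝ) (t : X₁) (g : X₁ × X₂ → ℝ) :
    ∑ x, restrictTo Prod.fst a t x * g x = ∑ x₂, a (t, x₂) * g (t, x₂) := by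
  classical
  rw [Fintype.sum_prod_type, Finset.sum_comm]
  simp [restrictTo, ite_mul]

lemma cmi_snd (V : X₁ × X₂ → Y → ℝ) (a : X₁ × X₂ → ℝ) :
    cmi V Prod.snd a = ∑ x₂, ∑ y, Real.negMulLog (∑ x₁, a (x₁, x₂) * V (x₁, x₂) y)
      - ∑ x₂, Real.negMulLog (∑ x₁, a (x₁, x₂)) - ∑ x₁, ∑ x₂, a (x₁, x₂) * rowEntropy V (x₁, x₂) := by
  have h := fun t => sum_restrictTo_snd a t fun _ => 1
  simp only [mul_one] at h
  simp only [cmi_eq, h, sum_restrictTo_snd a _ fun x => V x _]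
  rw [Fintype.sum_prod_type]

lemma cmi_fst (V : X₁ × X₂ → Y → ℝ) (a : X₁ × X₂ → ℝ) :
    cmi V Prod.fst a = ∑ x₁, ∑ y, Real.negMulLog (∑ x₂, a (x₁, x₂) * V (x₁, x₂) y)
      - ∑ x₁, Real.negMulLog (∑ x₂, a (x₁, x₂)) - ∑ x₁, ∑ x₂, a (x₁, x₂) * rowEntropy V (x₁, x₂) := by
  have h := fun t => sum_restrictTo_fst a t fun _ => 1
  simp only [mul_one] at h
  simp only [cmi_eq, h, sum_restrictTo_fst a _ fun x => V x _]
  rw [Fintype.sum_prod_type]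

/-- No side information. -/
def noInfo (_ : X₁ × X₂) : Unit := ()

lemma cmi_noInfo (V : X₁ × X₂ → Y → ℝ) (a : X₁ × X₂ → ℝ) : cmi V noInfo a = mi V a := by
  classical
  have : restrictTo noInfo a () = a := by funext x; simp [restrictTo]
  simp [cmi, this]

/-- The twelve lemmas from here on list the marginals of `joint` that occur in the three
informations. They are stated with the pattern-matching functions of the definitions, so that they
rewrite inside the unfolded entropies. -/
lemma law_joint_x₁_x₂q (x₁ x₂ q) : law (joint W pQ p₁ p₂)
    (fun ω => ((fun ⟨_, x₁, _, _⟩ => x₁ : Q × X₁ × X₂ × Y → X₁) ω,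
      (fun ⟨q, _, x₂, _⟩ => (x₂, q) : Q × X₁ × X₂ × Y → X₂ × Q) ω)) (x₁, (x₂, q)) =
    pQ q * p₁ q x₁ * p₂ q x₂ := by
  classical
  simp only [law, joint, Fintype.sum_prod_type, Prod.mk.injEq, ite_and, Finset.sum_ite_eq',
    Finset.mem_univ, if_true, Finset.sum_ite_irrel, Finset.sum_const_zero, ← Finset.mul_sum,
    PMF.sum_toReal, mul_one]

lemma law_joint_y_x₂q (y x₂ q) : law (joint W pQ p₁ p₂)
    (fun ω => ((fun ⟨_, _, _, y⟩ => y : Q × X₁ × X₂ × Y → Y) ω,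
      (fun ⟨q, _, x₂, _⟩ => (x₂, q) : Q × X₁ × X₂ × Y → X₂ × Q) ω)) (y, (x₂, q)) =
    ∑ x₁, pQ q * p₁ q x₁ * p₂ q x₂ * (W x₁ x₂ y).toReal := by
  classical
  simp only [law, joint, Fintype.sum_prod_type, Prod.mk.injEq, ite_and, Finset.sum_ite_eq',
    Finset.mem_univ, if_true, Finset.sum_ite_irrel, Finset.sum_const_zero]

lemma law_joint_x₁_y_x₂q (x₁ y x₂ q) : law (joint W pQ p₁ p₂)
    (fun ω => ((fun ⟨_, x₁, _, _⟩ => x₁ : Q × X₁ × X₂ × Y → X₁) ω,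
      (fun ⟨_, _, _, y⟩ => y : Q × X₁ × X₂ × Y → Y) ω,
      (fun ⟨q, _, x₂, _⟩ => (x₂, q) : Q × X₁ × X₂ × Y → X₂ × Q) ω)) (x₁, y, (x₂, q)) =
    pQ q * p₁ q x₁ * p₂ q x₂ * (W x₁ x₂ y).toReal := by
  classical
  simp only [law, joint, Fintype.sum_prod_type, Prod.mk.injEq, ite_and, Finset.sum_ite_eq',
    Finset.mem_univ, if_true, Finset.sum_ite_irrel, Finset.sum_const_zero]

lemma law_joint_x₂q (x₂ q) : law (joint W pQ p₁ p₂)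
    ((fun ⟨q, _, x₂, _⟩ => (x₂, q) : Q × X₁ × X₂ × Y → X₂ × Q)) (x₂, q) =
    ∑ x₁, pQ q * p₁ q x₁ * p₂ q x₂ := by
  classical
  simp only [law, joint, Fintype.sum_prod_type, Prod.mk.injEq, ite_and, Finset.sum_ite_eq',
    Finset.mem_univ, if_true, Finset.sum_ite_irrel, Finset.sum_const_zero, ← Finset.mul_sum,
    PMF.sum_toReal, mul_one]

lemma law_joint_x₂_x₁q (x₁ x₂ q) : law (joint W pQ p₁ p₂)
    (fun ω => ((fun ⟨_, _, x₂, _⟩ => x₂ : Q × X₁ × X₂ × Y → X₂) ω,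
      (fun ⟨q, x₁, _, _⟩ => (x₁, q) : Q × X₁ × X₂ × Y → X₁ × Q) ω)) (x₂, (x₁, q)) =
    pQ q * p₁ q x₁ * p₂ q x₂ := by
  classical
  simp only [law, joint, Fintype.sum_prod_type, Prod.mk.injEq, ite_and, Finset.sum_ite_eq',
    Finset.mem_univ, if_true, Finset.sum_ite_irrel, Finset.sum_const_zero, ← Finset.mul_sum,
    PMF.sum_toReal, mul_one]

lemma law_joint_y_x₁q (y x₁ q) : law (joint W pQ p₁ p₂)
    (fun ω => ((fun ⟨_, _, _, y⟩ => y : Q × X₁ × X₂ × Y → Y) ω,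
      (fun ⟨q, x₁, _, _⟩ => (x₁, q) : Q × X₁ × X₂ × Y → X₁ × Q) ω)) (y, (x₁, q)) =
    ∑ x₂, pQ q * p₁ q x₁ * p₂ q x₂ * (W x₁ x₂ y).toReal := by
  classical
  simp only [law, joint, Fintype.sum_prod_type, Prod.mk.injEq, ite_and, Finset.sum_ite_eq',
    Finset.mem_univ, if_true, Finset.sum_ite_irrel, Finset.sum_const_zero]

lemma law_joint_x₂_y_x₁q (x₁ y x₂ q) : law (joint W pQ p₁ p₂)
    (fun ω => ((fun ⟨_, _, x₂, _⟩ => x₂ : Q × X₁ × X₂ × Y → X₂) ω,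
      (fun ⟨_, _, _, y⟩ => y : Q × X₁ × X₂ × Y → Y) ω,
      (fun ⟨q, x₁, _, _⟩ => (x₁, q) : Q × X₁ × X₂ × Y → X₁ × Q) ω)) (x₂, y, (x₁, q)) =
    pQ q * p₁ q x₁ * p₂ q x₂ * (W x₁ x₂ y).toReal := by
  classical
  simp only [law, joint, Fintype.sum_prod_type, Prod.mk.injEq, ite_and, Finset.sum_ite_eq',
    Finset.mem_univ, if_true, Finset.sum_ite_irrel, Finset.sum_const_zero]

lemma law_joint_x₁q (x₁ q) : law (joint W pQ p₁ p₂)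
    ((fun ⟨q, x₁, _, _⟩ => (x₁, q) : Q × X₁ × X₂ × Y → X₁ × Q)) (x₁, q) =
    ∑ x₂, pQ q * p₁ q x₁ * p₂ q x₂ := by
  classical
  simp only [law, joint, Fintype.sum_prod_type, Prod.mk.injEq, ite_and, Finset.sum_ite_eq',
    Finset.mem_univ, if_true, Finset.sum_ite_irrel, Finset.sum_const_zero, ← Finset.mul_sum,
    PMF.sum_toReal, mul_one]

lemma law_joint_x₁x₂_q (x₁ x₂ q) : law (joint W pQ p₁ p₂)
    (fun ω => ((fun ⟨_, x₁, x₂, _⟩ => (x₁, x₂) : Q × X₁ × X₂ × Y → X₁ × X₂) ω,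
      (fun ⟨q, _, _, _⟩ => q : Q × X₁ × X₂ × Y → Q) ω)) ((x₁, x₂), q) =
    pQ q * p₁ q x₁ * p₂ q x₂ := by
  classical
  simp only [law, joint, Fintype.sum_prod_type, Prod.mk.injEq, ite_and, Finset.sum_ite_eq',
    Finset.mem_univ, if_true, Finset.sum_ite_irrel, Finset.sum_const_zero, ← Finset.mul_sum,
    PMF.sum_toReal, mul_one]

lemma law_joint_y_q (y q) : law (joint W pQ p₁ p₂)
    (fun ω => ((fun ⟨_, _, _, y⟩ => y : Q × X₁ × X₂ × Y → Y) ω,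
      (fun ⟨q, _, _, _⟩ => q : Q × X₁ × X₂ × Y → Q) ω)) (y, q) =
    ∑ x₁, ∑ x₂, pQ q * p₁ q x₁ * p₂ q x₂ * (W x₁ x₂ y).toReal := by
  classical
  simp only [law, joint, Fintype.sum_prod_type, Prod.mk.injEq, ite_and, Finset.sum_ite_eq',
    Finset.mem_univ, if_true, Finset.sum_ite_irrel, Finset.sum_const_zero]

lemma law_joint_x₁x₂_y_q (x₁ y x₂ q) : law (joint W pQ p₁ p₂)
    (fun ω => ((fun ⟨_, x₁, x₂, _⟩ => (x₁, x₂) : Q × X₁ × X₂ × Y → X₁ × X₂) ω,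
      (fun ⟨_, _, _, y⟩ => y : Q × X₁ × X₂ × Y → Y) ω,
      (fun ⟨q, _, _, _⟩ => q : Q × X₁ × X₂ × Y → Q) ω)) ((x₁, x₂), y, q) =
    pQ q * p₁ q x₁ * p₂ q x₂ * (W x₁ x₂ y).toReal := by
  classical
  simp only [law, joint, Fintype.sum_prod_type, Prod.mk.injEq, ite_and, Finset.sum_ite_eq',
    Finset.mem_univ, if_true, Finset.sum_ite_irrel, Finset.sum_const_zero]

lemma law_joint_q (q) : law (joint W pQ p₁ p₂)
    ((fun ⟨q, _, _, _⟩ => q : Q × X₁ × X₂ × Y → Q)) q =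
    ∑ x₁, ∑ x₂, pQ q * p₁ q x₁ * p₂ q x₂ := by
  classical
  simp only [law, joint, Fintype.sum_prod_type, Finset.sum_ite_eq',
    Finset.mem_univ, if_true, Finset.sum_ite_irrel, Finset.sum_const_zero, ← Finset.mul_sum,
    PMF.sum_toReal, mul_one]

lemma smul_prodMass (q : Q) : (fun x => pQ q * prodMass (p₁ q) (p₂ q) x) =
    fun x : X₁ × X₂ => pQ q * p₁ q x.1 * p₂ q x.2 := by
  funext x
  simp only [prodMass, mul_assoc]

lemma sum_joint_row (c : Q → X₁ → X₂ → ℝ) (q : Q) (x₁ : X₁) (x₂ : X₂) :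
    ∑ y, Real.negMulLog (c q x₁ x₂ * (W x₁ x₂ y).toReal) =
      Real.negMulLog (c q x₁ x₂) + c q x₁ x₂ * rowEntropy (chan W) (x₁, x₂) :=
  sum_negMulLog_row (isStochastic_chan W) _ (x₁, x₂)

lemma sum_comm₃ {A B C : Type*} [Fintype A] [Fintype B] [Fintype C] (f : A → B → C → ℝ) :
    ∑ a, ∑ b, ∑ c, f a b c = ∑ c, ∑ a, ∑ b, f a b c := by
  rw [Finset.sum_comm' (t' := Finset.univ) (s' := fun _ => Finset.univ) (by simp)]
  simp only [Finset.sum_comm (s := (Finset.univ : Finset A))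
    (t := (Finset.univ : Finset C))]
  rw [Finset.sum_comm]
  exact Finset.sum_congr rfl fun c _ => Finset.sum_comm

lemma sum_comm₃' {A B C : Type*} [Fintype A] [Fintype B] [Fintype C] (f : A → B → C → ℝ) :
    ∑ a, ∑ b, ∑ c, f a b c = ∑ c, ∑ b, ∑ a, f a b c := by
  rw [sum_comm₃]
  exact Finset.sum_congr rfl fun c _ => Finset.sum_comm

lemma sum_comm₄ {A B C D : Type*} [Fintype A] [Fintype B] [Fintype C] [Fintype D]
    (f : A → B → C → D → ℝ) :
    ∑ a, ∑ b, ∑ c, ∑ d, f a b c d = ∑ d, ∑ a, ∑ c, ∑ b, f a b c d := by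
  simp only [sum_comm₃ (A := B)]
  rw [Finset.sum_comm]
  exact Finset.sum_congr rfl fun d _ => Finset.sum_congr rfl fun a _ => Finset.sum_comm

/-- By homogeneity the weight `pQ q` is absorbed into the mass. Both sides are then the same sums of
`negMulLog`, up to their order, once the sum over `y` of the full joint entropy has split off the
row entropies. -/
lemma info₁_eq : info₁ W pQ p₁ p₂ =
    ∑ q, pQ q * cmi (chan W) Prod.snd (prodMass (p₁ q) (p₂ q)) := by
  have hr := sum_joint_row W fun q x₁ x₂ => pQ q * p₁ q x₁ * p₂ q x₂
  have hq : ∀ q, pQ q * cmi (chan W) Prod.snd (prodMass (p₁ q) (p₂ q)) = _ := fun q => by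
    rw [← cmi_smul (isStochastic_chan W), smul_prodMass, cmi_snd]
  simp only [hq]
  simp only [info₁, condMutualInfo, entropy, Fintype.sum_prod_type, law_joint_x₁_x₂q,
    law_joint_y_x₂q, law_joint_x₁_y_x₂q, law_joint_x₂q]
  rw [sum_comm₄, sum_comm₃ (A := X₁), sum_comm₃' (A := Y), Finset.sum_comm (s := (Finset.univ : Finset X₂))]
  simp only [hr, Finset.sum_add_distrib, Finset.sum_sub_distrib, chan]
  ring
lemma info₂_eq : info₂ W pQ p₁ p₂ =
    ∑ q, pQ q * cmi (chan W) Prod.fst (prodMass (p₁ q) (p₂ q)) := by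
  have hr := sum_joint_row W fun q x₁ x₂ => pQ q * p₁ q x₁ * p₂ q x₂
  have hq : ∀ q, pQ q * cmi (chan W) Prod.fst (prodMass (p₁ q) (p₂ q)) = _ := fun q => by
    rw [← cmi_smul (isStochastic_chan W), smul_prodMass, cmi_fst]
  simp only [hq]
  simp only [info₂, condMutualInfo, entropy, Fintype.sum_prod_type, law_joint_x₂_x₁q,
    law_joint_y_x₁q, law_joint_x₂_y_x₁q, law_joint_x₁q]
  rw [sum_comm₄, sum_comm₃ (A := X₂), sum_comm₃' (A := Y), Finset.sum_comm (s := (Finset.univ : Finset X₁))]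
  simp only [hr, Finset.sum_add_distrib, Finset.sum_sub_distrib, chan,
    Finset.sum_comm (s := (Finset.univ : Finset X₂)) (t := (Finset.univ : Finset X₁))]
  ring
lemma info₁₂_eq : info₁₂ W pQ p₁ p₂ =
    ∑ q, pQ q * mi (chan W) (prodMass (p₁ q) (p₂ q)) := by
  have hr := sum_joint_row W fun q x₁ x₂ => pQ q * p₁ q x₁ * p₂ q x₂
  have hq : ∀ q, pQ q * mi (chan W) (prodMass (p₁ q) (p₂ q)) = _ := fun q => by
    rw [← mi_smul (isStochastic_chan W), smul_prodMass, mi]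
  simp only [hq]
  simp only [info₁₂, condMutualInfo, entropy, Fintype.sum_prod_type, law_joint_x₁x₂_q,
    law_joint_y_q, law_joint_x₁x₂_y_q, law_joint_q]
  rw [Finset.sum_comm (s := (Finset.univ : Finset Y))]
  simp only [Finset.sum_comm (s := (Finset.univ : Finset Y)), sum_comm₃ (A := X₁) (B := X₂) (C := Q)]
  simp only [hr, Finset.sum_add_distrib, Finset.sum_sub_distrib, chan]
  ring
end Bridge

/-! ### Nearly independent inputs. -/

section Dependence

variable {X₁ X₂ Y : Type*} [Fintype X₁] [Fintype X₂] [Fintype Y]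

lemma sum_prodMass {p₁ : X₁ → ℝ} {p₂ : X₂ → ℝ} :
    ∑ x, prodMass p₁ p₂ x = (∑ x₁, p₁ x₁) * ∑ x₂, p₂ x₂ := by
  simp only [prodMass, Fintype.sum_prod_type, Finset.sum_mul_sum]

/-- For independent inputs, `I(X₁, X₂; Y) ≤ I(X₁; Y | X₂) + I(X₂; Y | X₁)`. -/
lemma mi_prodMass_le {V : X₁ × X₂ → Y → ℝ} (hV : IsStochastic V) (p₁ : stdSimplex ℝ X₁)
    (p₂ : stdSimplex ℝ X₂) :
    mi V (prodMass p₁ p₂) ≤ cmi V Prod.snd (prodMass p₁ p₂) + cmi V Prod.fst (prodMass p₁ p₂) := by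
  classical
  -- For independent inputs the difference of the two sides is `I(X₁; X₂ | Y)`.
  have h := condMutualInfo_nonneg (P := fun ω : X₁ × X₂ × Y => p₁ ω.1 * p₂ ω.2.1 * V (ω.1, ω.2.1) ω.2.2)
    (fun ω => mul_nonneg (mul_nonneg (p₁.2.1 _) (p₂.2.1 _)) (hV.nonneg _ _))
    (fun ω => ω.1) (fun ω => ω.2.1) (fun ω => ω.2.2)
  simp only [condMutualInfo, entropy, law, Fintype.sum_prod_type, Prod.mk.injEq, ite_and,
    Finset.sum_ite_eq', Finset.mem_univ, if_true, Finset.sum_ite_irrel, Finset.sum_const_zero] at h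
  have hr : ∀ x₁ x₂, ∑ y, Real.negMulLog (p₁ x₁ * p₂ x₂ * V (x₁, x₂) y) =
      Real.negMulLog (p₁ x₁ * p₂ x₂) + p₁ x₁ * p₂ x₂ * rowEntropy V (x₁, x₂) :=
    fun x₁ x₂ => sum_negMulLog_row hV _ (x₁, x₂)
  have h1 : ∑ x₁, p₁ x₁ = 1 := p₁.2.2
  have h2 : ∑ x₂, p₂ x₂ = 1 := p₂.2.2
  have hp : ∑ x₁, ∑ x₂, Real.negMulLog (p₁ x₁ * p₂ x₂) =
      ∑ x₁, Real.negMulLog (p₁ x₁) + ∑ x₂, Real.negMulLog (p₂ x₂) := by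
    simp only [Real.negMulLog_mul, Finset.sum_add_distrib, ← Finset.sum_mul, ← Finset.mul_sum, h1, h2,
      one_mul]
  rw [cmi_snd, cmi_fst, mi]
  simp only [sum_prodMass, h1, h2, mul_one, Real.negMulLog_one]
  simp only [prodMass, Fintype.sum_prod_type, ← Finset.sum_mul, ← Finset.mul_sum, h1, h2, one_mul,
    mul_one, hr, Finset.sum_add_distrib, hp] at h ⊢
  linarith

/-- The total dependence between the coordinates under the mass `a`; it is homogeneous. -/
def dependence (a : X₁ × X₂ → ℝ) : ℝ :=
  ∑ x₁, Real.negMulLog (∑ x₂, a (x₁, x₂)) + ∑ x₂, Real.negMulLog (∑ x₁, a (x₁, x₂))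
    - ∑ x, Real.negMulLog (a x) - Real.negMulLog (∑ x, a x)

lemma continuous_dependence : Continuous (dependence : (X₁ × X₂ → ℝ) → ℝ) := by
  unfold dependence
  have := Real.continuous_negMulLog
  fun_prop

lemma dependence_smul (c : ℝ) (a : X₁ × X₂ → ℝ) :
    dependence (fun x => c * a x) = c * dependence a := by
  have h1 : ∑ x, a x = ∑ x₁, ∑ x₂, a (x₁, x₂) := Fintype.sum_prod_type a
  have h2 : ∑ x, a x = ∑ x₂, ∑ x₁, a (x₁, x₂) := h1.trans Finset.sum_comm
  simp only [dependence, ← Finset.mul_sum, Real.negMulLog_mul, Finset.sum_add_distrib,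
    ← Finset.sum_mul]
  rw [← h1, ← h2]
  ring

lemma dependence_eq {a : X₁ × X₂ → ℝ} (h1 : ∑ x, a x = 1) : dependence a =
    ∑ x : X₁ × X₂, a x * (Real.log (a x) -
      (Real.log (∑ x₂, a (x.1, x₂)) + Real.log (∑ x₁, a (x₁, x.2)))) := by
  have e1 : ∑ x : X₁ × X₂, a x * Real.log (∑ x₂, a (x.1, x₂)) =
      -∑ x₁, Real.negMulLog (∑ x₂, a (x₁, x₂)) := by
    simp only [Fintype.sum_prod_type, ← Finset.sum_mul, Real.negMulLog, neg_mul,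
      Finset.sum_neg_distrib, neg_neg]
  have e2 : ∑ x : X₁ × X₂, a x * Real.log (∑ x₁, a (x₁, x.2)) =
      -∑ x₂, Real.negMulLog (∑ x₁, a (x₁, x₂)) := by
    rw [Fintype.sum_prod_type, Finset.sum_comm]
    simp only [← Finset.sum_mul, Real.negMulLog, neg_mul,
      Finset.sum_neg_distrib, neg_neg]
  have e3 : ∑ x : X₁ × X₂, a x * Real.log (a x) = -∑ x, Real.negMulLog (a x) := by
    simp only [Real.negMulLog, neg_mul, Finset.sum_neg_distrib, neg_neg]
  simp only [mul_sub, mul_add, Finset.sum_sub_distrib, Finset.sum_add_distrib, e1, e2, e3,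
    dependence, h1, Real.negMulLog_one]
  ring

/-- The equality case of Gibbs' inequality: each term `p log (p / q) - p + q` is nonnegative and
vanishes only for `p = q`. -/
lemma eq_of_sum_mul_log_div_eq_zero {ι : Type*} [Fintype ι] {p q : ι → ℝ} (hp : ∀ i, 0 ≤ p i)
    (hq : ∀ i, 0 ≤ q i) (hpq : ∀ i, 0 < p i → 0 < q i) (hsum : ∑ i, q i = ∑ i, p i)
    (h0 : ∑ i, p i * (Real.log (p i) - Real.log (q i)) ≤ 0) : p = q := by
  have key : ∀ i, 0 ≤ p i * (Real.log (p i) - Real.log (q i)) - p i + q i ∧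
      (p i * (Real.log (p i) - Real.log (q i)) - p i + q i = 0 → p i = q i) := by
    intro i
    rcases (hp i).eq_or_lt with h | h
    · simp [← h, hq i, eq_comm]
    · have h2 := hpq i h
      by_cases hne : q i / p i = 1
      · have : p i = q i := by field_simp at hne; linarith
        simp [this]
      · have h3 := Real.log_lt_sub_one_of_pos (div_pos h2 h) hne
        rw [Real.log_div h2.ne' h.ne'] at h3
        have h4 : p i * (Real.log (q i) - Real.log (p i)) < p i * (q i / p i - 1) :=
          mul_lt_mul_of_pos_left h3 h
        have h5 : p i * (q i / p i - 1) = q i - p i := by field_simp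
        constructor
        · linarith
        · intro h6; linarith
  have hs : ∑ i, (p i * (Real.log (p i) - Real.log (q i)) - p i + q i) = 0 := by
    refine le_antisymm ?_ (Finset.sum_nonneg fun i _ => (key i).1)
    simp only [Finset.sum_add_distrib, Finset.sum_sub_distrib]
    linarith
  funext i
  exact (key i).2 ((Finset.sum_eq_zero_iff_of_nonneg fun i _ => (key i).1).1 hs i (Finset.mem_univ i))

section
variable {a : X₁ × X₂ → ℝ} (ha : ∀ x, 0 ≤ a x)
include ha

lemma le_marginal (x : X₁ × X₂) : a x ≤ ∑ x₂, a (x.1, x₂) ∧ a x ≤ ∑ x₁, a (x₁, x.2) :=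
  ⟨Finset.single_le_sum (f := fun x₂ => a (x.1, x₂)) (fun _ _ => ha _) (Finset.mem_univ x.2),
    Finset.single_le_sum (f := fun x₁ => a (x₁, x.2)) (fun _ _ => ha _) (Finset.mem_univ x.1)⟩

/-- The dependence is the divergence of `a` from the product of its marginals. -/
lemma dependence_nonneg_of_sum_one (h1 : ∑ x, a x = 1) : 0 ≤ dependence a ∧
    (dependence a = 0 → a = prodMass (fun x₁ => ∑ x₂, a (x₁, x₂)) fun x₂ => ∑ x₁, a (x₁, x₂)) := by
  have h1' : ∑ x₁, ∑ x₂, a (x₁, x₂) = 1 := by rw [← h1, Fintype.sum_prod_type]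
  have h1'' : ∑ x₂, ∑ x₁, a (x₁, x₂) = 1 := by rw [← h1', Finset.sum_comm]
  have hq : ∀ x, 0 ≤ prodMass (fun x₁ => ∑ x₂, a (x₁, x₂)) (fun x₂ => ∑ x₁, a (x₁, x₂)) x :=
    fun x => mul_nonneg (Finset.sum_nonneg fun _ _ => ha _) (Finset.sum_nonneg fun _ _ => ha _)
  have hpq : ∀ x, 0 < a x →
      0 < prodMass (fun x₁ => ∑ x₂, a (x₁, x₂)) (fun x₂ => ∑ x₁, a (x₁, x₂)) x :=
    fun x hx => mul_pos (hx.trans_le (le_marginal ha x).1) (hx.trans_le (le_marginal ha x).2)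
  have hs : ∑ x, prodMass (fun x₁ => ∑ x₂, a (x₁, x₂)) (fun x₂ => ∑ x₁, a (x₁, x₂)) x = ∑ x, a x := by
    rw [sum_prodMass, h1', h1'', h1, one_mul]
  have he : dependence a = ∑ x, a x * (Real.log (a x) - Real.log
      (prodMass (fun x₁ => ∑ x₂, a (x₁, x₂)) (fun x₂ => ∑ x₁, a (x₁, x₂)) x)) := by
    rw [dependence_eq h1]
    refine Finset.sum_congr rfl fun x _ => ?_
    rcases (ha x).eq_or_lt with h | h
    · simp [← h]
    · rw [prodMass, Real.log_mul (h.trans_le (le_marginal ha x).1).ne'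
        (h.trans_le (le_marginal ha x).2).ne']
  exact ⟨he ▸ sum_mul_log_div_nonneg ha hq hpq hs.le, fun h0 =>
    eq_of_sum_mul_log_div_eq_zero ha hq hpq hs (he ▸ h0.le)⟩

end

open Classical in
/-- The probability distribution proportional to the mass `p` (a point mass if `p` vanishes). -/
def normalize {X : Type*} [Fintype X] [Nonempty X] (p : X → ℝ) : stdSimplex ℝ X :=
  if h : (∀ x, 0 ≤ p x) ∧ 0 < ∑ x, p x then
    ⟨fun x => p x / ∑ x, p x, fun x => div_nonneg (h.1 x) h.2.le, by
      rw [← Finset.sum_div, div_self h.2.ne']⟩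
  else ⟨Pi.single (Classical.arbitrary X) 1, single_mem_stdSimplex ℝ _⟩

lemma normalize_apply {X : Type*} [Fintype X] [Nonempty X] {p : X → ℝ} (h0 : ∀ x, 0 ≤ p x)
    (h1 : 0 < ∑ x, p x) (x : X) : normalize p x = p x / ∑ x, p x := by
  rw [normalize, dif_pos ⟨h0, h1⟩]
  rfl

variable [Nonempty X₁] [Nonempty X₂]

/-- The product of the normalized marginals of the mass `a`. -/
def prodMarginals (a : X₁ × X₂ → ℝ) : X₁ × X₂ → ℝ :=
  prodMass (normalize fun x₁ => ∑ x₂, a (x₁, x₂)) (normalize fun x₂ => ∑ x₁, a (x₁, x₂))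

/-- On the compact set where the excess `F` is at least `η` the dependence is bounded away from
zero, since zero dependence makes `a` a product and hence `F a = 0`. So `K` can be the maximum of
`F` there divided by the minimum of the dependence. -/
lemma exists_cmi_le_on_simplex {S : Type*} [Fintype S] (V : X₁ × X₂ → Y → ℝ) (s : X₁ × X₂ → S)
    {η : ℝ} (hη : 0 < η) : ∃ K, 0 ≤ K ∧ ∀ a ∈ stdSimplex ℝ (X₁ × X₂), cmi V s a ≤
      cmi V s (prodMass (fun x₁ => ∑ x₂, a (x₁, x₂)) fun x₂ => ∑ x₁, a (x₁, x₂)) + η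
        + K * dependence a := by
  set F : (X₁ × X₂ → ℝ) → ℝ := fun a => cmi V s a -
    cmi V s (prodMass (fun x₁ => ∑ x₂, a (x₁, x₂)) fun x₂ => ∑ x₁, a (x₁, x₂)) with hF
  have hFc : Continuous F := by
    refine (continuous_cmi V s).sub ((continuous_cmi V s).comp ?_)
    unfold prodMass
    fun_prop
  set T : Set (X₁ × X₂ → ℝ) := stdSimplex ℝ (X₁ × X₂) ∩ {a | η ≤ F a} with hT
  have hTc : IsCompact T :=
    (isCompact_stdSimplex ℝ (X₁ × X₂)).inter_right (isClosed_le continuous_const hFc)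
  rcases T.eq_empty_or_nonempty with hTe | hTn
  · refine ⟨0, le_rfl, fun a ha => ?_⟩
    have : ¬ η ≤ F a := fun h => by
      have : a ∈ T := ⟨ha, h⟩
      simp [hTe] at this
    simp only [hF] at this
    linarith
  · obtain ⟨b, hbT, hb⟩ := hTc.exists_isMinOn hTn continuous_dependence.continuousOn
    obtain ⟨c, hcT, hc⟩ := hTc.exists_isMaxOn hTn hFc.continuousOn
    have hb0 : 0 < dependence b := by
      have h := dependence_nonneg_of_sum_one hbT.1.1 hbT.1.2
      refine lt_of_le_of_ne h.1 fun h0 => ?_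
      have h2 := h.2 h0.symm
      have h3 : η ≤ F b := hbT.2
      simp only [hF, ← h2] at h3
      linarith
    have hc0 : 0 < F c := hη.trans_le hcT.2
    refine ⟨F c / dependence b, by positivity, fun a ha => ?_⟩
    have ha0 := (dependence_nonneg_of_sum_one ha.1 ha.2).1
    by_cases h : a ∈ T
    · have h1 : F a ≤ F c := hc h
      have h2 : dependence b ≤ dependence a := hb h
      have h3 : F c ≤ F c / dependence b * dependence a := by
        rw [div_mul_eq_mul_div, le_div_iff₀ hb0]
        exact mul_le_mul_of_nonneg_left h2 hc0.le
      simp only [hF] at h1 h3 ⊢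
      linarith
    · have h1 : ¬ η ≤ F a := fun h' => h ⟨ha, h'⟩
      have h3 : 0 ≤ F c / dependence b * dependence a := by positivity
      simp only [hF] at h1 h3 ⊢
      linarith

/-- The information of a joint input mass exceeds that of the product of its marginals by little
more than a multiple of the dependence. -/
lemma exists_cmi_le {S : Type*} [Fintype S] {V : X₁ × X₂ → Y → ℝ} (hV : IsStochastic V)
    (s : X₁ × X₂ → S) {η : ℝ} (hη : 0 < η) : ∃ K, 0 ≤ K ∧ ∀ a : X₁ × X₂ → ℝ, (∀ x, 0 ≤ a x) →
      cmi V s a ≤ (∑ x, a x) * cmi V s (prodMarginals a) + η * ∑ x, a x + K * dependence a := by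
  obtain ⟨K, hK, h⟩ := exists_cmi_le_on_simplex V s hη
  refine ⟨K, hK, fun a ha => ?_⟩
  rcases (Finset.sum_nonneg fun x (_ : x ∈ Finset.univ) => ha x).eq_or_lt with h0 | h0
  · have h1 : a = fun x => (0 : ℝ) * a x := by
      funext x
      rw [zero_mul]
      exact (Finset.sum_eq_zero_iff_of_nonneg fun x _ => ha x).1 h0.symm x (Finset.mem_univ x)
    rw [← h0, h1, cmi_smul hV, dependence_smul]
    simp
  · set m := ∑ x, a x with hm
    have ha' : a = fun x => m * (a x / m) := by
      funext x
      field_simp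
    have hb : (fun x => a x / m) ∈ stdSimplex ℝ (X₁ × X₂) :=
      ⟨fun x => div_nonneg (ha x) h0.le, by rw [← Finset.sum_div, div_self h0.ne']⟩
    have h1 := h _ hb
    have e1 : ∑ x₁, ∑ x₂, a (x₁, x₂) = m := by rw [hm, Fintype.sum_prod_type]
    have e2 : ∑ x₂, ∑ x₁, a (x₁, x₂) = m := by rw [← e1, Finset.sum_comm]
    have h2 : (prodMass (fun x₁ => ∑ x₂, a (x₁, x₂) / m) fun x₂ => ∑ x₁, a (x₁, x₂) / m)
        = prodMarginals a := by
      funext x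
      simp only [prodMass, prodMarginals]
      rw [normalize_apply (fun _ => Finset.sum_nonneg fun _ _ => ha _) (e1 ▸ h0),
        normalize_apply (fun _ => Finset.sum_nonneg fun _ _ => ha _) (e2 ▸ h0), e1, e2,
        Finset.sum_div, Finset.sum_div]
    rw [h2] at h1
    have h3 : cmi V s a = m * cmi V s (fun x => a x / m) := by rw [← cmi_smul hV, ← ha']
    have h4 : dependence a = m * dependence (fun x => a x / m) := by
      rw [← dependence_smul, ← ha']
    rw [h3, h4]
    have := mul_le_mul_of_nonneg_left h1 h0.le
    linarith

end Dependence

/-! ### Reduction to two values of the time-sharing variable. -/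

section Reduction

/-- A nonzero direction along which three weights can be moved, keeping the total weight and the
difference of the averages of `f` and `g`, without decreasing the averages. -/
lemma exists_direction (d f : Fin 3 → ℝ) : ∃ μ : Fin 3 → ℝ, μ ≠ 0 ∧ ∑ i, μ i = 0 ∧
    ∑ i, μ i * d i = 0 ∧ 0 ≤ ∑ i, μ i * f i := by
  obtain ⟨μ, h0, h1, h2⟩ : ∃ μ : Fin 3 → ℝ, μ ≠ 0 ∧ ∑ i, μ i = 0 ∧ ∑ i, μ i * d i = 0 := by
    -- Two linear conditions on three weights leave a line, spanned by the cross product of `d` and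
    -- the constant vector. That product vanishes when `d` is constant, and then any nonzero
    -- direction of zero sum serves.
    by_cases h : d 1 = d 2 ∧ d 0 = d 1
    · refine ⟨![1, -1, 0], fun h0 => ?_, ?_, ?_⟩
      · simpa using congrFun h0 0
      · simp [Fin.sum_univ_three]
      · simp [Fin.sum_univ_three, h.2]
    · refine ⟨![d 1 - d 2, d 2 - d 0, d 0 - d 1], fun h0 => h ⟨?_, ?_⟩, ?_, ?_⟩
      · simpa [sub_eq_zero] using congrFun h0 0
      · simpa [sub_eq_zero] using congrFun h0 2
      · simp [Fin.sum_univ_three]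
      · simp [Fin.sum_univ_three]; ring
  rcases le_total 0 (∑ i, μ i * f i) with h | h
  · exact ⟨μ, h0, h1, h2, h⟩
  · refine ⟨-μ, neg_ne_zero.2 h0, ?_, ?_, ?_⟩
    · simp [h1]
    · simp [h2]
    · simpa using h

variable {ι : Type*} [Fintype ι]

open Classical in
-- A Carathéodory step in the plane: three weights are moved until one vanishes. Since the average
-- of `f - g` is kept, raising the average of `f` raises that of `g` as well. This is why two points
-- suffice instead of three.
lemma exists_smaller_support (f g l : ι → ℝ) (hl : ∀ i, 0 ≤ l i)
    (hcard : 2 < (Finset.univ.filter fun i => l i ≠ 0).card) :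
    ∃ l' : ι → ℝ, (∀ i, 0 ≤ l' i) ∧ ∑ i, l' i = ∑ i, l i ∧ ∑ i, l i * f i ≤ ∑ i, l' i * f i ∧
      ∑ i, l i * g i ≤ ∑ i, l' i * g i ∧
      (Finset.univ.filter fun i => l' i ≠ 0).card < (Finset.univ.filter fun i => l i ≠ 0).card := by
  obtain ⟨a, b, c, ha, hb, hc, hab, hac, hbc⟩ := Finset.two_lt_card_iff.1 hcard
  simp only [Finset.mem_filter, Finset.mem_univ, true_and] at ha hb hc
  set e : Fin 3 → ι := ![a, b, c] with he
  have hinj : Function.Injective e := by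
    intro i j hij
    fin_cases i <;> fin_cases j <;> simp_all [eq_comm]
  have hle : ∀ i, l (e i) ≠ 0 := by intro i; fin_cases i <;> simp [he, ha, hb, hc]
  obtain ⟨μ, h0, h1, h2, h3⟩ := exists_direction (fun i => f (e i) - g (e i)) fun i => f (e i)
  set m : ι → ℝ := Function.extend e μ 0 with hm
  have hme : ∀ i, m (e i) = μ i := fun i => hinj.extend_apply _ _ _
  have hm0 : ∀ x, (¬ ∃ i, e i = x) → m x = 0 := fun x hx => Function.extend_apply' _ _ _ hx
  have hsum : ∀ φ : ι → ℝ, ∑ x, m x * φ x = ∑ i, μ i * φ (e i) := by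
    intro φ
    rw [← Finset.sum_subset (Finset.subset_univ (Finset.univ.image e)) fun x _ hx => by
      rw [hm0 x (by simpa using hx), zero_mul], Finset.sum_image fun i _ j _ h => hinj h]
    exact Finset.sum_congr rfl fun i _ => by rw [hme]
  have hs1 : ∑ x, m x = 0 := by simpa [h1] using hsum fun _ => 1
  have hs2 : 0 ≤ ∑ x, m x * f x := by rw [hsum]; exact h3
  have hs3 : 0 ≤ ∑ x, m x * g x := by
    rw [hsum]
    simp only [mul_sub, Finset.sum_sub_distrib] at h2
    linarith
  have hneg : (Finset.univ.filter fun x => m x < 0).Nonempty := by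
    by_contra hne
    rw [Finset.not_nonempty_iff_eq_empty, Finset.filter_eq_empty_iff] at hne
    have hz := (Finset.sum_eq_zero_iff_of_nonneg fun x hx => not_lt.1 (hne hx)).1 hs1
    exact h0 (funext fun i => by rw [← hme i]; exact hz _ (Finset.mem_univ _))
  -- The ratio at `x₀` is the largest step along `m` that keeps all weights nonnegative. It makes
  -- the weight at `x₀` zero.
  obtain ⟨x₀, hx₀, hmin⟩ := Finset.exists_min_image _ (fun x => l x / (-m x)) hneg
  simp only [Finset.mem_filter, Finset.mem_univ, true_and] at hx₀ hmin
  set t := l x₀ / (-m x₀) with ht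
  have ht0 : 0 ≤ t := div_nonneg (hl _) (by linarith)
  have hsupp : ∀ x, l x = 0 → m x = 0 := fun x hx => hm0 x fun ⟨i, hi⟩ => hle i (hi ▸ hx)
  have hsplit : ∀ φ : ι → ℝ, ∑ x, (l x + t * m x) * φ x =
      ∑ x, l x * φ x + t * ∑ x, m x * φ x := fun φ => by
    rw [Finset.mul_sum, ← Finset.sum_add_distrib]
    exact Finset.sum_congr rfl fun x _ => by ring
  refine ⟨fun x => l x + t * m x, fun x => ?_, ?_, ?_, ?_, Finset.card_lt_card ?_⟩
  · rcases lt_or_ge (m x) 0 with h | h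
    · have := hmin x h
      rw [le_div_iff₀ (by linarith)] at this
      linarith
    · have := mul_nonneg ht0 h
      linarith [hl x]
  · have := hsplit fun _ => 1
    simp only [mul_one, hs1, mul_zero, add_zero] at this
    exact this
  · rw [hsplit]
    have := mul_nonneg ht0 hs2
    linarith
  · rw [hsplit]
    have := mul_nonneg ht0 hs3
    linarith
  · rw [Finset.ssubset_iff_of_subset]
    · refine ⟨x₀, ?_, ?_⟩
      · simp only [Finset.mem_filter, Finset.mem_univ, true_and]
        intro h
        have := hsupp _ h
        linarith
      · simp only [Finset.mem_filter, Finset.mem_univ, true_and, not_not, ht]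
        rw [div_neg, neg_mul, div_mul_cancel₀ _ hx₀.ne]
        ring
    · intro x
      simp only [Finset.mem_filter, Finset.mem_univ, true_and]
      intro hx h
      exact hx (by simp [h, hsupp x h])

/-- Two averages over a finite set are dominated by averages over two of its points. -/
lemma exists_two_points (f g l : ι → ℝ) (hl : ∀ i, 0 ≤ l i) (hsum : ∑ i, l i = 1) :
    ∃ (i : Fin 2 → ι) (p : stdSimplex ℝ (Fin 2)), ∑ i, l i * f i ≤ ∑ q, p q * f (i q) ∧
      ∑ i, l i * g i ≤ ∑ q, p q * g (i q) := by
  classical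
  obtain ⟨n, hn⟩ : ∃ n, n = (Finset.univ.filter fun i => l i ≠ 0).card := ⟨_, rfl⟩
  induction n using Nat.strong_induction_on generalizing l with
  | _ n ih =>
    by_cases hcard : 2 < (Finset.univ.filter fun i => l i ≠ 0).card
    · obtain ⟨l', h0, h1, h2, h3, h4⟩ := exists_smaller_support f g l hl hcard
      obtain ⟨i, p, h5, h6⟩ := ih _ (hn ▸ h4) l' h0 (h1.trans hsum) rfl
      exact ⟨i, p, h2.trans h5, h3.trans h6⟩
    · have hrestr : ∀ φ : ι → ℝ, ∑ x, l x * φ x =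
          ∑ x ∈ Finset.univ.filter fun i => l i ≠ 0, l x * φ x := fun φ => by
        rw [Finset.sum_filter]
        refine Finset.sum_congr rfl fun x _ => ?_
        by_cases h : l x = 0 <;> simp [h]
      have hs := hrestr fun _ => 1
      simp only [mul_one, hsum] at hs
      have h3 : (Finset.univ.filter fun i => l i ≠ 0).card ≠ 0 := fun h => by
        rw [Finset.card_eq_zero] at h
        rw [h] at hs
        simp at hs
      have h4 : (Finset.univ.filter fun i => l i ≠ 0).card = 1 ∨
        (Finset.univ.filter fun i => l i ≠ 0).card = 2 := by omega
      rcases h4 with h4 | h4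
      · obtain ⟨x, hx⟩ := Finset.card_eq_one.1 h4
        rw [hx, Finset.sum_singleton] at hs
        refine ⟨fun _ => x, ⟨Pi.single 0 1, single_mem_stdSimplex ℝ _⟩, ?_, ?_⟩ <;>
        · rw [hrestr, hx, Finset.sum_singleton, ← hs]
          change _ ≤ ∑ q : Fin 2, (Pi.single 0 1 : Fin 2 → ℝ) q * _
          simp [Fin.sum_univ_two]
      · obtain ⟨x, y, hxy, hx⟩ := Finset.card_eq_two.1 h4
        rw [hx, Finset.sum_pair hxy] at hs
        refine ⟨![x, y], ⟨![l x, l y], ?_, ?_⟩, ?_, ?_⟩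
        · intro q; fin_cases q <;> simp [hl]
        · simp [Fin.sum_univ_two, hs]
        all_goals
          rw [hrestr, hx, Finset.sum_pair hxy]
          change _ ≤ ∑ q : Fin 2, (![l x, l y] : Fin 2 → ℝ) q * _
          simp [Fin.sum_univ_two]

/-- A point of the pentagon is dominated by a convex combination of the corners `(A₁, A₁₂ - A₁)` and
`(A₁₂ - A₂, A₂)`. Unless the second corner already dominates, `θ` is chosen to match the first
coordinate exactly. -/
lemma exists_pentagon_weight {A₁ A₂ A₁₂ b₁ b₂ : ℝ} (h1 : b₁ ≤ A₁) (h2 : b₂ ≤ A₂)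
    (h12 : b₁ + b₂ ≤ A₁₂) : ∃ θ, 0 ≤ θ ∧ θ ≤ 1 ∧
      b₁ ≤ θ * A₁ + (1 - θ) * (A₁₂ - A₂) ∧ b₂ ≤ θ * (A₁₂ - A₁) + (1 - θ) * A₂ := by
  by_cases h : b₁ ≤ A₁₂ - A₂
  · exact ⟨0, le_rfl, zero_le_one, by linarith, by linarith⟩
  · have hD : 0 < A₁ + A₂ - A₁₂ := by linarith
    refine ⟨(b₁ - (A₁₂ - A₂)) / (A₁ + A₂ - A₁₂), div_nonneg (by linarith) hD.le,
      (div_le_one hD).2 (by linarith), ?_, ?_⟩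
    · refine le_of_eq ?_
      field_simp
      ring
    · have : (b₁ - (A₁₂ - A₂)) / (A₁ + A₂ - A₁₂) * (A₁₂ - A₁) +
          (1 - (b₁ - (A₁₂ - A₂)) / (A₁ + A₂ - A₁₂)) * A₂ = A₁₂ - b₁ := by
        field_simp
        ring
      linarith

end Reduction

/-! ### The block region: time sharing and closedness. -/

section Region

variable {X₁ X₂ Y : Type*} [Fintype X₁] [Fintype X₂] [Fintype Y]

/-- Time sharing between finitely many product distributions does not leave the block region. -/
lemma mem_blockRegion_of_average (W : X₁ → X₂ → PMF Y) {ι : Type*} [Fintype ι] {l : ι → ℝ}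
    (hl : ∀ i, 0 ≤ l i) (hsum : ∑ i, l i = 1) (p₁ : ι → stdSimplex ℝ X₁)
    (p₂ : ι → stdSimplex ℝ X₂) {b₁ b₂ : ℝ}
    (h1 : b₁ ≤ ∑ i, l i * cmi (chan W) Prod.snd (prodMass (p₁ i) (p₂ i)))
    (h2 : b₂ ≤ ∑ i, l i * cmi (chan W) Prod.fst (prodMass (p₁ i) (p₂ i)))
    (h12 : b₁ + b₂ ≤ ∑ i, l i * mi (chan W) (prodMass (p₁ i) (p₂ i))) :
    (b₁, b₂) ∈ blockRegion W := by
  set I₁ := fun i => cmi (chan W) Prod.snd (prodMass (p₁ i) (p₂ i)) with hI₁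
  set I₂ := fun i => cmi (chan W) Prod.fst (prodMass (p₁ i) (p₂ i)) with hI₂
  set I₁₂ := fun i => mi (chan W) (prodMass (p₁ i) (p₂ i)) with hI₁₂
  have hI : ∀ i, I₁₂ i ≤ I₁ i + I₂ i := fun i => mi_prodMass_le (isStochastic_chan W) _ _
  obtain ⟨θ, hθ0, hθ1, e1, e2⟩ := exists_pentagon_weight h1 h2 h12
  -- For fixed `θ` the combination of corners is linear in the informations, so it is the average
  -- over `i` of points of the individual pentagons whose coordinates add up to `I₁₂ i`. Only two
  -- averages have to be preserved, and the sum inequality comes for free.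
  obtain ⟨i, p, f1, f2⟩ := exists_two_points (fun i => θ * I₁ i + (1 - θ) * (I₁₂ i - I₂ i))
    (fun i => θ * (I₁₂ i - I₁ i) + (1 - θ) * I₂ i) l hl hsum
  have s1 : ∑ i, l i * (θ * I₁ i + (1 - θ) * (I₁₂ i - I₂ i)) = θ * ∑ i, l i * I₁ i +
      (1 - θ) * (∑ i, l i * I₁₂ i - ∑ i, l i * I₂ i) := by
    rw [← Finset.sum_sub_distrib, Finset.mul_sum, Finset.mul_sum, ← Finset.sum_add_distrib]
    exact Finset.sum_congr rfl fun i _ => by ring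
  have s2 : ∑ i, l i * (θ * (I₁₂ i - I₁ i) + (1 - θ) * I₂ i) = θ * (∑ i, l i * I₁₂ i -
      ∑ i, l i * I₁ i) + (1 - θ) * ∑ i, l i * I₂ i := by
    rw [← Finset.sum_sub_distrib, Finset.mul_sum, Finset.mul_sum, ← Finset.sum_add_distrib]
    exact Finset.sum_congr rfl fun i _ => by ring
  rw [s1] at f1
  rw [s2] at f2
  refine ⟨p, fun q => p₁ (i q), fun q => p₂ (i q), ?_, ?_, ?_⟩
  · rw [info₁_eq]
    refine e1.trans (f1.trans (Finset.sum_le_sum fun q _ => mul_le_mul_of_nonneg_left ?_ (p.2.1 q)))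
    have := mul_nonneg (sub_nonneg.2 hθ1) (sub_nonneg.2 (hI (i q)))
    change _ ≤ I₁ (i q)
    linarith
  · rw [info₂_eq]
    refine e2.trans (f2.trans (Finset.sum_le_sum fun q _ => mul_le_mul_of_nonneg_left ?_ (p.2.1 q)))
    have := mul_nonneg hθ0 (sub_nonneg.2 (hI (i q)))
    change _ ≤ I₂ (i q)
    linarith
  · rw [info₁₂_eq]
    refine (add_le_add (e1.trans f1) (e2.trans f2)).trans (le_of_eq ?_)
    rw [← Finset.sum_add_distrib]
    refine Finset.sum_congr rfl fun q _ => ?_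
    change _ = p q * I₁₂ (i q)
    ring

lemma continuous_prodMass : Continuous fun p : stdSimplex ℝ X₁ × stdSimplex ℝ X₂ =>
    prodMass (p.1 : X₁ → ℝ) (p.2 : X₂ → ℝ) := by
  refine continuous_pi fun x => ?_
  have h1 : Continuous fun p : stdSimplex ℝ X₁ × stdSimplex ℝ X₂ => (p.1 : X₁ → ℝ) x.1 :=
    (continuous_apply x.1).comp (continuous_subtype_val.comp continuous_fst)
  have h2 : Continuous fun p : stdSimplex ℝ X₁ × stdSimplex ℝ X₂ => (p.2 : X₂ → ℝ) x.2 :=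
    (continuous_apply x.2).comp (continuous_subtype_val.comp continuous_snd)
  exact h1.mul h2

instance {X : Type*} [Fintype X] : CompactSpace (stdSimplex ℝ X) :=
  isCompact_iff_compactSpace.1 (isCompact_stdSimplex ℝ X)

instance {X : Type*} [Fintype X] [Nonempty X] : Nonempty (stdSimplex ℝ X) := by
  classical
  exact ⟨⟨Pi.single (Classical.arbitrary X) 1, single_mem_stdSimplex ℝ _⟩⟩

lemma continuous_sum_mul {Q : Type*} [Fintype Q] {F : (X₁ × X₂ → ℝ) → ℝ} (hF : Continuous F) :
    Continuous fun p : stdSimplex ℝ Q × (Q → stdSimplex ℝ X₁) × (Q → stdSimplex ℝ X₂) =>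
      ∑ q, (p.1 : Q → ℝ) q * F (prodMass (p.2.1 q) (p.2.2 q)) := by
  refine continuous_finsetSum _ fun q _ => Continuous.mul ?_ ?_
  · exact (continuous_apply q).comp (continuous_subtype_val.comp continuous_fst)
  · refine hF.comp (continuous_prodMass.comp (Continuous.prodMk ?_ ?_))
    · exact (continuous_apply q).comp (continuous_fst.comp continuous_snd)
    · exact (continuous_apply q).comp (continuous_snd.comp continuous_snd)

/-- The least slack `G` of the three inequalities is continuous on the compact space of
distributions. Its maximum is at least `-τ` for every `τ > 0`, so a maximizer serves for the limit
point. -/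
lemma mem_blockRegion_of_forall_sub [Nonempty X₁] [Nonempty X₂] (W : X₁ → X₂ → PMF Y) {b₁ b₂ : ℝ}
    (h : ∀ τ > 0, (b₁ - τ, b₂ - τ) ∈ blockRegion W) : (b₁, b₂) ∈ blockRegion W := by
  set G : stdSimplex ℝ (Fin 2) × (Fin 2 → stdSimplex ℝ X₁) × (Fin 2 → stdSimplex ℝ X₂) → ℝ :=
    fun p => min (∑ q, (p.1 : Fin 2 → ℝ) q * cmi (chan W) Prod.snd (prodMass (p.2.1 q) (p.2.2 q)) - b₁)
      (min (∑ q, (p.1 : Fin 2 → ℝ) q * cmi (chan W) Prod.fst (prodMass (p.2.1 q) (p.2.2 q)) - b₂)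
        (∑ q, (p.1 : Fin 2 → ℝ) q * mi (chan W) (prodMass (p.2.1 q) (p.2.2 q)) - (b₁ + b₂))) with hG
  have hGc : Continuous G :=
    ((continuous_sum_mul (continuous_cmi _ _)).sub continuous_const).min
      (((continuous_sum_mul (continuous_cmi _ _)).sub continuous_const).min
        ((continuous_sum_mul (continuous_mi _)).sub continuous_const))
  obtain ⟨p, -, hp⟩ := isCompact_univ.exists_isMaxOn Set.univ_nonempty hGc.continuousOn
  have h0 : 0 ≤ G p := by
    refine le_of_forall_pos_le_add fun τ hτ => ?_
    -- Half of `τ`, because the sum inequality is shifted twice.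
    obtain ⟨pQ, p₁, p₂, h1, h2, h12⟩ := h (τ / 2) (by positivity)
    rw [info₁_eq] at h1
    rw [info₂_eq] at h2
    rw [info₁₂_eq] at h12
    have h3 : G (pQ, p₁, p₂) ≤ G p := hp (Set.mem_univ _)
    have h4 : -τ ≤ G (pQ, p₁, p₂) := by
      simp only [hG, le_min_iff]
      dsimp only at h1 h2 h12 ⊢
      refine ⟨?_, ?_, ?_⟩ <;> linarith
    linarith
  simp only [hG, le_min_iff] at h0
  refine ⟨p.1, p.2.1, p.2.2, ?_, ?_, ?_⟩
  · rw [info₁_eq]; dsimp only; linarith [h0.1]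
  · rw [info₂_eq]; dsimp only; linarith [h0.2.1]
  · rw [info₁₂_eq]; dsimp only; linarith [h0.2.2]

end Region

/-! ### Capacity-achieving output laws. -/

section Capacity

/-- At a capacity-achieving input the divergences of the rows from the output law are at most the
capacity. -/
lemma exists_output_law {X Y : Type*} [Fintype X] [Fintype Y] [Nonempty X] {V : X → Y → ℝ}
    (hV : IsStochastic V) {c : ℝ} (hc : ∀ p : stdSimplex ℝ X, mi V p ≤ c) :
    ∃ q : Y → ℝ, (∀ y, 0 ≤ q y) ∧ ∑ y, q y = 1 ∧ (∀ x y, 0 < V x y → 0 < q y) ∧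
      ∀ x, ∑ y, V x y * (Real.log (V x y) - Real.log (q y)) ≤ c := by
  classical
  obtain ⟨p, -, hp⟩ := isCompact_univ.exists_isMaxOn (Set.univ_nonempty (α := stdSimplex ℝ X))
    ((continuous_mi V).comp continuous_subtype_val).continuousOn
  replace hp : ∀ p' : stdSimplex ℝ X, mi V p' ≤ mi V p := fun p' => hp (Set.mem_univ p')
  have hp0 : ∀ x, 0 ≤ p x := p.2.1
  have hp1 : ∑ x, p x = 1 := p.2.2
  set q : Y → ℝ := fun y => ∑ x, p x * V x y with hq
  have hq0 : ∀ y, 0 ≤ q y := fun y => Finset.sum_nonneg fun x _ => mul_nonneg (hp0 x) (hV.nonneg x y)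
  have hq1 : ∑ y, q y = 1 := by rw [hq, sum_mul_row hV]; exact hp1
  have hVle : ∀ x y, V x y ≤ 1 := fun x y => by
    rw [← hV.sum_eq_one x]
    exact Finset.single_le_sum (fun y _ => hV.nonneg x y) (Finset.mem_univ y)
  have hqle : ∀ y, q y ≤ 1 := fun y => by
    rw [← hq1]
    exact Finset.single_le_sum (fun y _ => hq0 y) (Finset.mem_univ y)
  set r : X → ℝ → Y → ℝ := fun x t y => (1 - t) * q y + t * V x y with hr
  -- Moving the maximizer `p` by a fraction `t` towards the point mass at `x` cannot raise the
  -- information. The mean divergence of the rows from `r x t` under `p` exceeds that from `q` by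
  -- the divergence of `q` from `r x t`, so it is at least `mi V p`. This leaves at most `t * mi V
  -- p` for row `x`.
  have hD : ∀ x, ∀ t ∈ Set.Ioo (0 : ℝ) 1,
      ∑ y, V x y * (Real.log (V x y) - Real.log (r x t y)) ≤ mi V p := by
    intro x t ht
    have ht1 : 0 < 1 - t := by linarith [ht.2]
    set a : X → ℝ := fun x' => (1 - t) * p x' + t * (Pi.single x 1 : X → ℝ) x' with ha
    have hs0 : ∀ x', 0 ≤ (Pi.single x 1 : X → ℝ) x' := fun x' => by
      by_cases h : x' = x <;> simp [h]
    have ha0 : ∀ x', 0 ≤ a x' := fun x' =>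
      add_nonneg (mul_nonneg ht1.le (hp0 x')) (mul_nonneg ht.1.le (hs0 x'))
    have ha1 : ∑ x', a x' = 1 := by
      simp only [ha, Finset.sum_add_distrib, ← Finset.mul_sum, hp1]
      simp
    have hlin : ∀ φ : X → ℝ, ∑ x', a x' * φ x' = (1 - t) * ∑ x', p x' * φ x' + t * φ x := fun φ => by
      simp only [ha, add_mul, Finset.sum_add_distrib, mul_assoc, ← Finset.mul_sum]
      simp [Pi.single_apply]
    have hout : ∀ y, (∑ x', a x' * V x' y) / ∑ x', a x' = r x t y := fun y => by
      rw [ha1, div_one, hlin fun x' => V x' y]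
    have h1 : mi V a ≤ mi V p := hp ⟨a, ha0, ha1⟩
    rw [mi_eq_sum_log hV ha0] at h1
    simp only [hout] at h1
    rw [hlin] at h1
    have h2 : mi V p ≤ ∑ x', p x' * ∑ y, V x' y * (Real.log (V x' y) - Real.log (r x t y)) := by
      rw [mi_eq_sum_log hV hp0, hp1]
      simp only [div_one]
      change ∑ x', p x' * ∑ y, V x' y * (Real.log (V x' y) - Real.log (q y)) ≤ _
      have h3 := sum_mul_log_div_nonneg hq0 (q := r x t)
        (fun y => add_nonneg (mul_nonneg ht1.le (hq0 y)) (mul_nonneg ht.1.le (hV.nonneg x y)))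
        (fun y hy => add_pos_of_pos_of_nonneg (mul_pos ht1 hy) (mul_nonneg ht.1.le (hV.nonneg x y)))
        (by
          simp only [hr, Finset.sum_add_distrib, ← Finset.mul_sum, hq1, hV.sum_eq_one]
          linarith)
      have h4 : ∑ x', p x' * ∑ y, V x' y * (Real.log (V x' y) - Real.log (r x t y)) -
          ∑ x', p x' * ∑ y, V x' y * (Real.log (V x' y) - Real.log (q y)) =
          ∑ y, q y * (Real.log (q y) - Real.log (r x t y)) := by
        rw [← Finset.sum_sub_distrib]
        simp only [hq, Finset.sum_mul]
        rw [Finset.sum_comm]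
        refine Finset.sum_congr rfl fun x' _ => ?_
        rw [← mul_sub, ← Finset.sum_sub_distrib, Finset.mul_sum]
        exact Finset.sum_congr rfl fun y _ => by ring
      linarith
    have h5 := mul_le_mul_of_nonneg_left h2 ht1.le
    have h6 : t * ∑ y, V x y * (Real.log (V x y) - Real.log (r x t y)) ≤ t * mi V p := by linarith
    exact le_of_mul_le_mul_left h6 ht.1
  have hlim : ∀ x y, Filter.Tendsto (fun t => r x t y) (nhdsWithin 0 (Set.Ioi 0)) (nhds (q y)) := by
    intro x y
    have : Continuous fun t => r x t y := by simp only [hr]; fun_prop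
    have h := this.tendsto 0
    simp only [hr, sub_zero, one_mul, zero_mul, add_zero] at h
    exact h.mono_left nhdsWithin_le_nhds
  have hev : ∀ᶠ t in nhdsWithin (0 : ℝ) (Set.Ioi 0), t ∈ Set.Ioo (0 : ℝ) 1 :=
    Ioo_mem_nhdsGT zero_lt_one
  -- The bound just proved keeps `r x t y` above a positive constant independent of `t`, hence also
  -- its limit `q y`. Positivity is what makes the logarithms converge as `t` tends to zero.
  have hpos : ∀ x y, 0 < V x y → 0 < q y := by
    intro x y hy
    refine lt_of_lt_of_le (Real.exp_pos (-((mi V p + rowEntropy V x) / V x y)))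
      (ge_of_tendsto (hlim x y) (hev.mono fun t ht => ?_))
    have hrle : ∀ y, r x t y ≤ 1 := fun y => by
      have h1 := mul_le_mul_of_nonneg_left (hqle y) (sub_nonneg.2 ht.2.le)
      have h2 := mul_le_mul_of_nonneg_left (hVle x y) ht.1.le
      simp only [hr]
      linarith
    have hrnn : ∀ y, 0 ≤ r x t y := fun y =>
      add_nonneg (mul_nonneg (sub_nonneg.2 ht.2.le) (hq0 y)) (mul_nonneg ht.1.le (hV.nonneg x y))
    have hrpos : 0 < r x t y :=
      add_pos_of_nonneg_of_pos (mul_nonneg (sub_nonneg.2 ht.2.le) (hq0 y)) (mul_pos ht.1 hy)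
    have h1 := hD x t ht
    have h2 : V x y * -Real.log (r x t y) ≤ ∑ y, V x y * -Real.log (r x t y) :=
      Finset.single_le_sum (f := fun y => V x y * -Real.log (r x t y)) (fun y _ =>
        mul_nonneg (hV.nonneg x y) (neg_nonneg.2 (Real.log_nonpos (hrnn y) (hrle y))))
        (Finset.mem_univ y)
    have h3 : ∑ y, V x y * (Real.log (V x y) - Real.log (r x t y)) =
        -rowEntropy V x + ∑ y, V x y * -Real.log (r x t y) := by
      rw [rowEntropy, ← Finset.sum_neg_distrib, ← Finset.sum_add_distrib]
      exact Finset.sum_congr rfl fun y _ => by rw [Real.negMulLog]; ring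
    rw [← Real.le_log_iff_exp_le hrpos, neg_le, le_div_iff₀ hy]
    linarith
  refine ⟨q, hq0, hq1, hpos, fun x => ?_⟩
  refine (le_of_tendsto (x := nhdsWithin (0 : ℝ) (Set.Ioi 0)) (tendsto_finsetSum _ fun y _ => ?_)
    (hev.mono fun t ht => hD x t ht)).trans (hc p)
  rcases (hV.nonneg x y).eq_or_lt with h | h
  · simp only [← h, zero_mul]
    exact tendsto_const_nhds
  · exact ((tendsto_const_nhds.sub ((hlim x y).log (hpos x y h).ne')).const_mul _)

variable {X₁ X₂ Y : Type*} [Fintype X₁] [Fintype X₂] [Fintype Y] [Nonempty X₁] [Nonempty X₂]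

lemma cmi_snd_prodMass {V : X₁ × X₂ → Y → ℝ} (hV : IsStochastic V) (p₁ : X₁ → ℝ) (p₂ : X₂ → ℝ) :
    cmi V Prod.snd (prodMass p₁ p₂) = ∑ x₂, p₂ x₂ * mi (fun x₁ => V (x₁, x₂)) p₁ := by
  have h : ∀ x₂, p₂ x₂ * mi (fun x₁ => V (x₁, x₂)) p₁ = _ := fun x₂ =>
    (mi_smul (W := fun x₁ => V (x₁, x₂)) ⟨fun _ _ => hV.nonneg _ _, fun _ => hV.sum_eq_one _⟩
      (p₂ x₂) p₁).symm
  rw [Finset.sum_congr rfl fun x₂ _ => h x₂]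
  simp only [mi, Finset.sum_sub_distrib, cmi_snd, prodMass, mul_comm (p₁ _) (p₂ _)]
  congr 1
  rw [Finset.sum_comm]
  rfl

lemma cmi_fst_prodMass {V : X₁ × X₂ → Y → ℝ} (hV : IsStochastic V) (p₁ : X₁ → ℝ) (p₂ : X₂ → ℝ) :
    cmi V Prod.fst (prodMass p₁ p₂) = ∑ x₁, p₁ x₁ * mi (fun x₂ => V (x₁, x₂)) p₂ := by
  have h : ∀ x₁, p₁ x₁ * mi (fun x₂ => V (x₁, x₂)) p₂ = _ := fun x₁ =>
    (mi_smul (W := fun x₂ => V (x₁, x₂)) ⟨fun _ _ => hV.nonneg _ _, fun _ => hV.sum_eq_one _⟩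
      (p₁ x₁) p₂).symm
  rw [Finset.sum_congr rfl fun x₁ _ => h x₁]
  simp only [mi, Finset.sum_sub_distrib, cmi_fst, prodMass]
  rfl

lemma info₁_trivialQ (W : X₁ → X₂ → PMF Y) (p : stdSimplex ℝ X₁ × stdSimplex ℝ X₂) :
    info₁ W trivialQ (fun _ => p.1) (fun _ => p.2) = cmi (chan W) Prod.snd (prodMass p.1 p.2) := by
  rw [info₁_eq, Fintype.sum_unique]
  exact one_mul _

lemma info₂_trivialQ (W : X₁ → X₂ → PMF Y) (p : stdSimplex ℝ X₁ × stdSimplex ℝ X₂) :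
    info₂ W trivialQ (fun _ => p.1) (fun _ => p.2) = cmi (chan W) Prod.fst (prodMass p.1 p.2) := by
  rw [info₂_eq, Fintype.sum_unique]
  exact one_mul _

lemma exists_cap₁_eq (W : X₁ → X₂ → PMF Y) : (∃ p : stdSimplex ℝ X₁ × stdSimplex ℝ X₂,
    cap₁ W = cmi (chan W) Prod.snd (prodMass p.1 p.2)) ∧
    ∀ p : stdSimplex ℝ X₁ × stdSimplex ℝ X₂, cmi (chan W) Prod.snd (prodMass p.1 p.2) ≤ cap₁ W := by
  have hc : Continuous fun p : stdSimplex ℝ X₁ × stdSimplex ℝ X₂ =>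
      cmi (chan W) Prod.snd (prodMass p.1 p.2) := (continuous_cmi _ _).comp continuous_prodMass
  obtain ⟨p, -, hp⟩ := isCompact_univ.exists_isMaxOn Set.univ_nonempty hc.continuousOn
  simp only [cap₁, info₁_trivialQ]
  have hb : BddAbove (Set.range fun p : stdSimplex ℝ X₁ × stdSimplex ℝ X₂ =>
      cmi (chan W) Prod.snd (prodMass p.1 p.2)) :=
    ⟨_, Set.forall_mem_range.2 fun p' => hp (Set.mem_univ p')⟩
  exact ⟨⟨p, le_antisymm (ciSup_le fun p' => hp (Set.mem_univ p')) (le_ciSup hb p)⟩, le_ciSup hb⟩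

lemma exists_cap₂_eq (W : X₁ → X₂ → PMF Y) : (∃ p : stdSimplex ℝ X₁ × stdSimplex ℝ X₂,
    cap₂ W = cmi (chan W) Prod.fst (prodMass p.1 p.2)) ∧
    ∀ p : stdSimplex ℝ X₁ × stdSimplex ℝ X₂, cmi (chan W) Prod.fst (prodMass p.1 p.2) ≤ cap₂ W := by
  have hc : Continuous fun p : stdSimplex ℝ X₁ × stdSimplex ℝ X₂ =>
      cmi (chan W) Prod.fst (prodMass p.1 p.2) := (continuous_cmi _ _).comp continuous_prodMass
  obtain ⟨p, -, hp⟩ := isCompact_univ.exists_isMaxOn Set.univ_nonempty hc.continuousOn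
  simp only [cap₂, info₂_trivialQ]
  have hb : BddAbove (Set.range fun p : stdSimplex ℝ X₁ × stdSimplex ℝ X₂ =>
      cmi (chan W) Prod.fst (prodMass p.1 p.2)) :=
    ⟨_, Set.forall_mem_range.2 fun p' => hp (Set.mem_univ p')⟩
  exact ⟨⟨p, le_antisymm (ciSup_le fun p' => hp (Set.mem_univ p')) (le_ciSup hb p)⟩, le_ciSup hb⟩

lemma prodMass_nonneg (p₁ : stdSimplex ℝ X₁) (p₂ : stdSimplex ℝ X₂) (x : X₁ × X₂) :
    0 ≤ prodMass p₁ p₂ x := mul_nonneg (p₁.2.1 _) (p₂.2.1 _)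

lemma cap₁_nonneg (W : X₁ → X₂ → PMF Y) : 0 ≤ cap₁ W := by
  obtain ⟨p, hp⟩ := (exists_cap₁_eq W).1
  rw [hp]
  exact cmi_nonneg (isStochastic_chan W) _ (prodMass_nonneg _ _)

lemma cap₂_nonneg (W : X₁ → X₂ → PMF Y) : 0 ≤ cap₂ W := by
  obtain ⟨p, hp⟩ := (exists_cap₂_eq W).1
  rw [hp]
  exact cmi_nonneg (isStochastic_chan W) _ (prodMass_nonneg _ _)

lemma exists_output_law₁ (W : X₁ → X₂ → PMF Y) : ∃ q : X₂ → Y → ℝ, (∀ x₂ y, 0 ≤ q x₂ y) ∧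
    (∀ x₂, ∑ y, q x₂ y = 1) ∧ (∀ x y, 0 < chan W x y → 0 < q x.2 y) ∧
      ∀ x, ∑ y, chan W x y * (Real.log (chan W x y) - Real.log (q x.2 y)) ≤ cap₁ W := by
  classical
  have h : ∀ x₂ : X₂, ∃ q : Y → ℝ, (∀ y, 0 ≤ q y) ∧ ∑ y, q y = 1 ∧
      (∀ x₁ y, 0 < chan W (x₁, x₂) y → 0 < q y) ∧ ∀ x₁, ∑ y, chan W (x₁, x₂) y *
        (Real.log (chan W (x₁, x₂) y) - Real.log (q y)) ≤ cap₁ W := fun x₂ => by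
    refine exists_output_law (V := fun x₁ => chan W (x₁, x₂))
      ⟨fun _ _ => (isStochastic_chan W).nonneg _ _, fun _ => (isStochastic_chan W).sum_eq_one _⟩
      fun p => ?_
    -- A point mass at `x₂` bounds the capacity of the channel with `x₂` fixed by `cap₁ W`, so one
    -- constant serves for every `x₂`.
    have := (exists_cap₁_eq W).2 (p, ⟨Pi.single x₂ 1, single_mem_stdSimplex ℝ _⟩)
    rw [cmi_snd_prodMass (isStochastic_chan W)] at this
    change ∑ x, (Pi.single x₂ 1 : X₂ → ℝ) x * _ ≤ _ at this
    simpa [Pi.single_apply] using this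
  choose q h0 h1 h2 h3 using h
  exact ⟨q, h0, h1, fun x y => h2 x.2 x.1 y, fun x => h3 x.2 x.1⟩

lemma exists_output_law₂ (W : X₁ → X₂ → PMF Y) : ∃ q : X₁ → Y → ℝ, (∀ x₁ y, 0 ≤ q x₁ y) ∧
    (∀ x₁, ∑ y, q x₁ y = 1) ∧ (∀ x y, 0 < chan W x y → 0 < q x.1 y) ∧
      ∀ x, ∑ y, chan W x y * (Real.log (chan W x y) - Real.log (q x.1 y)) ≤ cap₂ W := by
  classical
  have h : ∀ x₁ : X₁, ∃ q : Y → ℝ, (∀ y, 0 ≤ q y) ∧ ∑ y, q y = 1 ∧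
      (∀ x₂ y, 0 < chan W (x₁, x₂) y → 0 < q y) ∧ ∀ x₂, ∑ y, chan W (x₁, x₂) y *
        (Real.log (chan W (x₁, x₂) y) - Real.log (q y)) ≤ cap₂ W := fun x₁ => by
    refine exists_output_law (V := fun x₂ => chan W (x₁, x₂))
      ⟨fun _ _ => (isStochastic_chan W).nonneg _ _, fun _ => (isStochastic_chan W).sum_eq_one _⟩
      fun p => ?_
    have := (exists_cap₂_eq W).2 (⟨Pi.single x₁ 1, single_mem_stdSimplex ℝ _⟩, p)
    rw [cmi_fst_prodMass (isStochastic_chan W)] at this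
    change ∑ x, (Pi.single x₁ 1 : X₁ → ℝ) x * _ ≤ _ at this
    simpa [Pi.single_apply] using this
  choose q h0 h1 h2 h3 using h
  exact ⟨q, h0, h1, fun x y => h2 x.1 x.2 y, fun x => h3 x.1 x.2⟩

end Capacity

/-! ### Causal kernels on finite sequences. -/

section Sequences

variable {U : Type*} [Nonempty U]

/-- The extension of a finite sequence by an arbitrary letter. -/
def ext {n : ℕ} (u : Fin n → U) (i : ℕ) : U := if h : i < n then u ⟨i, h⟩ else Classical.arbitrary U

lemma ext_of_lt {n : ℕ} (u : Fin n → U) {i : ℕ} (h : i < n) : ext u i = u ⟨i, h⟩ := dif_pos h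

lemma ext_snoc {n : ℕ} (u : Fin n → U) (v : U) :
    ext (Fin.snoc (α := fun _ => U) u v) = Function.update (ext u) n v := by
  funext i
  rcases lt_trichotomy i n with h | h | h
  · rw [Function.update_of_ne h.ne, ext_of_lt _ h, ext_of_lt _ (h.trans (Nat.lt_succ_self n))]
    have : (⟨i, h.trans (Nat.lt_succ_self n)⟩ : Fin (n + 1)) = Fin.castSucc ⟨i, h⟩ := rfl
    rw [this, Fin.snoc_castSucc]
  · subst h
    rw [Function.update_self, ext_of_lt _ (Nat.lt_succ_self i)]
    have : (⟨i, Nat.lt_succ_self i⟩ : Fin (i + 1)) = Fin.last i := rfl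
    rw [this, Fin.snoc_last]
  · rw [Function.update_of_ne h.ne', ext, ext, dif_neg (by omega), dif_neg (by omega)]

lemma sum_ext_succ [Fintype U] (n : ℕ) (G : (ℕ → U) → ℝ) :
    ∑ u : Fin (n + 1) → U, G (ext u) = ∑ u : Fin n → U, ∑ v, G (Function.update (ext u) n v) := by
  rw [← (Fin.snocEquiv fun _ : Fin (n + 1) => U).sum_comp, Fintype.sum_prod_type, Finset.sum_comm]
  refine Finset.sum_congr rfl fun u _ => Finset.sum_congr rfl fun v _ => ?_
  rw [← ext_snoc]
  rfl

lemma prod_range_update_of_causal (κ : ℕ → (ℕ → U) → U → ℝ)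
    (hκ : ∀ i u u' v, (∀ j < i, u j = u' j) → κ i u v = κ i u' v) (u : ℕ → U) (n : ℕ) (v : U) :
    ∏ i ∈ Finset.range n, κ i (Function.update u n v) (Function.update u n v i) =
      ∏ i ∈ Finset.range n, κ i u (u i) := by
  refine Finset.prod_congr rfl fun i hi => ?_
  have hi' := Finset.mem_range.1 hi
  rw [Function.update_of_ne hi'.ne]
  exact hκ i _ _ _ fun j hj => Function.update_of_ne (by omega) _ _

/-- A causal substochastic kernel defines a substochastic law on sequences. -/
lemma sum_prod_causal_le_one [Fintype U] (κ : ℕ → (ℕ → U) → U → ℝ) (h0 : ∀ i u v, 0 ≤ κ i u v)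
    (h1 : ∀ i u, ∑ v, κ i u v ≤ 1)
    (hκ : ∀ i u u' v, (∀ j < i, u j = u' j) → κ i u v = κ i u' v) (n : ℕ) :
    ∑ u : Fin n → U, ∏ i ∈ Finset.range n, κ i (ext u) (ext u i) ≤ 1 := by
  induction n with
  | zero => simp
  | succ n ih =>
    rw [sum_ext_succ n fun u => ∏ i ∈ Finset.range (n + 1), κ i u (u i)]
    refine le_trans (Finset.sum_le_sum fun u _ => ?_) ih
    simp only [Finset.prod_range_succ, prod_range_update_of_causal κ hκ, Function.update_self]
    rw [← Finset.mul_sum]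
    refine mul_le_of_le_one_right (Finset.prod_nonneg fun i _ => h0 _ _ _) ?_
    refine le_trans (le_of_eq (Finset.sum_congr rfl fun v _ => ?_)) (h1 n (ext u))
    exact hκ n _ _ _ fun j hj => Function.update_of_ne hj.ne _ _

end Sequences

/-! ### Expectations over finitely many output letters. -/

section Expectation

variable {X Y : Type*} [Fintype Y] [Nonempty Y]

/-- The expectation of `G` when the first `n` output letters are drawn according to the channel `V`
with the input sequence `x` (the remaining letters being fixed). -/
def seqExp (V : X → Y → ℝ) (x : ℕ → X) (n : ℕ) (G : (ℕ → Y) → ℝ) : ℝ :=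
  ∑ y : Fin n → Y, (∏ i ∈ Finset.range n, V (x i) (ext y i)) * G (ext y)

variable {V : X → Y → ℝ} {x : ℕ → X} {n : ℕ}

lemma seqExp_succ (G : (ℕ → Y) → ℝ) : seqExp V x (n + 1) G =
    seqExp V x n fun y => ∑ v, V (x n) v * G (Function.update y n v) := by
  unfold seqExp
  rw [sum_ext_succ n fun y => (∏ i ∈ Finset.range (n + 1), V (x i) (y i)) * G y]
  refine Finset.sum_congr rfl fun y _ => ?_
  rw [Finset.mul_sum]
  refine Finset.sum_congr rfl fun v _ => ?_
  rw [Finset.prod_range_succ, Function.update_self,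
    prod_range_update_of_causal (fun i _ v => V (x i) v) (fun _ _ _ _ _ => rfl)]
  ring

lemma seqExp_eq_of_le (hV : IsStochastic V) {m : ℕ} (hmn : m ≤ n) {G : (ℕ → Y) → ℝ}
    (hG : ∀ y y', (∀ j < m, y j = y' j) → G y = G y') : seqExp V x n G = seqExp V x m G := by
  induction n, hmn using Nat.le_induction with
  | base => rfl
  | succ k hk ih =>
    rw [← ih, seqExp_succ]
    congr 1
    funext y
    have : ∀ v, G (Function.update y k v) = G y := fun v =>
      hG _ _ fun j hj => Function.update_of_ne (by omega) _ _
    simp only [this, ← Finset.sum_mul, hV.sum_eq_one, one_mul]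

/-- The tower rule: given the earlier letters, letter `i` has law `V (x i)`, and the later letters
integrate out. -/
lemma seqExp_letter (hV : IsStochastic V) {i : ℕ} (hi : i < n) {H : (ℕ → Y) → Y → ℝ}
    (hH : ∀ y y' v, (∀ j < i, y j = y' j) → H y v = H y' v) :
    seqExp V x n (fun y => H y (y i)) = seqExp V x n fun y => ∑ v, V (x i) v * H y v := by
  rw [seqExp_eq_of_le hV (m := i + 1) hi, seqExp_eq_of_le hV (n := n) (m := i) hi.le, seqExp_succ]
  · congr 1
    funext y
    refine Finset.sum_congr rfl fun v _ => ?_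
    rw [Function.update_self, hH _ _ _ fun j hj => Function.update_of_ne hj.ne _ _]
  · exact fun y y' h => Finset.sum_congr rfl fun v _ => by rw [hH y y' v h]
  · intro y y' h
    simp only [h i (Nat.lt_succ_self i)]
    exact hH y y' _ fun j hj => h j (by omega)

lemma seqExp_mono (hV : IsStochastic V) {G G' : (ℕ → Y) → ℝ} (h : ∀ y, G y ≤ G' y) :
    seqExp V x n G ≤ seqExp V x n G' :=
  Finset.sum_le_sum fun _ _ => mul_le_mul_of_nonneg_left (h _)
    (Finset.prod_nonneg fun _ _ => hV.nonneg _ _)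

lemma seqExp_add (G G' : (ℕ → Y) → ℝ) :
    seqExp V x n (fun y => G y + G' y) = seqExp V x n G + seqExp V x n G' := by
  simp only [seqExp, mul_add, Finset.sum_add_distrib]

lemma seqExp_mul_const (G : (ℕ → Y) → ℝ) (c : ℝ) :
    seqExp V x n (fun y => G y * c) = seqExp V x n G * c := by
  simp only [seqExp, Finset.sum_mul, mul_assoc]

lemma seqExp_sum {ι : Type*} (s : Finset ι) (G : ι → (ℕ → Y) → ℝ) :
    seqExp V x n (fun y => ∑ i ∈ s, G i y) = ∑ i ∈ s, seqExp V x n (G i) := by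
  simp only [seqExp, Finset.mul_sum]
  rw [Finset.sum_comm]

lemma seqExp_const (hV : IsStochastic V) (c : ℝ) : seqExp V x n (fun _ => c) = c := by
  rw [seqExp_eq_of_le hV (Nat.zero_le n) (by simp)]
  simp [seqExp]

lemma seqExp_nonneg (hV : IsStochastic V) {G : (ℕ → Y) → ℝ} (h : ∀ y, 0 ≤ G y) :
    0 ≤ seqExp V x n G :=
  Finset.sum_nonneg fun _ _ => mul_nonneg (Finset.prod_nonneg fun _ _ => hV.nonneg _ _) (h _)

end Expectation

/-! ### A Fano inequality by change of measure. -/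

section Fano

variable {𝒲 X Y Z I : Type*} [Fintype 𝒲] [Nonempty 𝒲] [Fintype Y] [Nonempty Y] [Fintype Z]
  [Nonempty Z] [Fintype I] [Nonempty I]

/-- The latent letters are functions of the outputs, so the sequences of pairs that occur are an
injective image of the output sequences. All other sequences of pairs contribute nonnegative terms.
-/
lemma sum_path_le (κ : ℕ → (ℕ → Z × Y) → Z × Y → ℝ) (h0 : ∀ i u v, 0 ≤ κ i u v)
    (hκ : ∀ i u u' v, (∀ j < i, u j = u' j) → κ i u v = κ i u' v) (lat : (ℕ → Y) → ℕ → Z) (n : ℕ)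
    {φ : (ℕ → Y) → ℝ} (hφ0 : ∀ y, 0 ≤ φ y)
    (hφ : ∀ y y', (∀ j < n, y j = y' j) → φ y = φ y') :
    ∑ y : Fin n → Y, (∏ i ∈ Finset.range n,
        κ i (fun j => (lat (ext y) j, ext y j)) (lat (ext y) i, ext y i)) * φ (ext y) ≤
      ∑ u : Fin n → Z × Y, (∏ i ∈ Finset.range n, κ i (ext u) (ext u i)) *
        φ (fun j => (ext u j).2) := by
  classical
  set e : (Fin n → Y) → Fin n → Z × Y := fun y i => (lat (ext y) i, y i) with he
  have hinj : Function.Injective e := fun y y' h => funext fun i => by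
    simpa [he] using congrArg Prod.snd (congrFun h i)
  have hext : ∀ y, ∀ i < n, ext (e y) i = (lat (ext y) i, ext y i) := fun y i hi => by
    rw [ext_of_lt _ hi, ext_of_lt _ hi]
  calc _ = ∑ y : Fin n → Y, (∏ i ∈ Finset.range n, κ i (ext (e y)) (ext (e y) i)) *
        φ (fun j => (ext (e y) j).2) := by
        refine Finset.sum_congr rfl fun y _ => ?_
        congr 1
        · refine Finset.prod_congr rfl fun i hi => ?_
          have hi' := Finset.mem_range.1 hi
          rw [hext y i hi']
          exact hκ _ _ _ _ fun j hj => (hext y j (hj.trans hi')).symm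
        · exact hφ _ _ fun j hj => by rw [hext y j hj]
    _ = ∑ u ∈ Finset.univ.image e, (∏ i ∈ Finset.range n, κ i (ext u) (ext u i)) *
        φ (fun j => (ext u j).2) := by
        rw [Finset.sum_image fun y _ y' _ h => hinj h]
    _ ≤ _ := Finset.sum_le_univ_sum_of_nonneg fun u =>
        mul_nonneg (Finset.prod_nonneg fun i _ => h0 _ _ _) (hφ0 _)

open Classical in
/-- A variable-length Fano inequality: the likelihood ratio of the channel law against a causal
reference law `κ`, which may involve latent letters in `Z` and under which the messages can only be
guessed, is at least the information about the messages. -/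
lemma fano {V : X → Y → ℝ} (hV : IsStochastic V) (x : 𝒲 → ℕ → X) (n : ℕ)
    (κ : 𝒲 → ℕ → (ℕ → Z × Y) → Z × Y → ℝ) (h0 : ∀ w i u v, 0 ≤ κ w i u v)
    (h1 : ∀ w i u, ∑ v, κ w i u v ≤ 1)
    (hκ : ∀ w i u u' v, (∀ j < i, u j = u' j) → κ w i u v = κ w i u' v)
    (lat : 𝒲 → (ℕ → Y) → ℕ → Z) (C : 𝒲 → (ℕ → Y) → Prop)
    (hC : ∀ w y y', (∀ j < n, y j = y' j) → (C w y ↔ C w y'))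
    (guess : I → (ℕ → Y) → 𝒲) (hdec : ∀ w y, C w y → ∃ ι, w = guess ι y)
    (hguessκ : ∀ ι i u u' v, (∀ j < i, u j = u' j) →
      κ (guess ι fun j => (u j).2) i u v = κ (guess ι fun j => (u' j).2) i u' v)
    (hpos : ∀ w y i, i < n → (∀ j < n, 0 < V (x w j) (y j)) →
      0 < κ w i (fun j => (lat w y j, y j)) (lat w y i, y i)) :
    (∑ w, seqExp V (x w) n fun y => if C w y then 1 else 0) / Fintype.card 𝒲 *
        Real.log (Fintype.card 𝒲 / Fintype.card I) - Real.log 2 ≤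
      (∑ w, seqExp V (x w) n fun y => ∑ i ∈ Finset.range n, (Real.log (V (x w i) (y i)) -
        Real.log (κ w i (fun j => (lat w y j, y j)) (lat w y i, y i)))) / Fintype.card 𝒲 := by
  set M : ℝ := (Fintype.card 𝒲 : ℝ) with hM
  set m : ℝ := M / (Fintype.card I : ℝ) with hm
  have hM0 : 0 < M := Nat.cast_pos.2 Fintype.card_pos
  have hI0 : (0 : ℝ) < Fintype.card I := Nat.cast_pos.2 Fintype.card_pos
  have hm0 : 0 < m := div_pos hM0 hI0
  set K : 𝒲 → (Fin n → Y) → ℝ := fun w y => ∏ i ∈ Finset.range n,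
    κ w i (fun j => (lat w (ext y) j, ext y j)) (lat w (ext y) i, ext y i) with hK
  set L : 𝒲 → (ℕ → Z × Y) → ℝ := fun w u => ∏ i ∈ Finset.range n, κ w i u (u i) with hL
  have hK0 : ∀ w y, 0 ≤ K w y := fun w y => Finset.prod_nonneg fun i _ => h0 _ _ _ _
  have hL0 : ∀ w u, 0 ≤ L w u := fun w u => Finset.prod_nonneg fun i _ => h0 _ _ _ _
  set P : 𝒲 × (Fin n → Y) → ℝ := fun p =>
    (∏ i ∈ Finset.range n, V (x p.1 i) (ext p.2 i)) / M with hP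
  -- The reference law, multiplied by `m` where decoding is correct, and halved. Its total is at
  -- most `(M + m * card I) / (2 * M) = 1`, because under `κ` the correctly decoded mass summed over
  -- all messages is at most the number of guesses. The tilt yields the factor `log m`, and the
  -- halving costs `log 2`.
  set R : 𝒲 × (Fin n → Y) → ℝ := fun p =>
    K p.1 p.2 * (if C p.1 (ext p.2) then m else 1) / (2 * M) with hR
  have hPsum : ∑ p, P p = 1 := by
    have : ∀ w, ∑ y : Fin n → Y, ∏ i ∈ Finset.range n, V (x w i) (ext y i) = 1 := fun w => by
      simpa [seqExp] using seqExp_const (V := V) (x := x w) (n := n) hV 1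
    simp only [hP, Fintype.sum_prod_type, ← Finset.sum_div, this]
    simp only [Finset.sum_const, Finset.card_univ, nsmul_eq_mul, mul_one]
    exact div_self hM0.ne'
  have hpos' : ∀ p, 0 < P p → ∀ j < n, 0 < V (x p.1 j) (ext p.2 j) := fun p hp j hj => by
    refine lt_of_le_of_ne (hV.nonneg _ _) fun h => ?_
    have : ∏ i ∈ Finset.range n, V (x p.1 i) (ext p.2 i) = 0 :=
      Finset.prod_eq_zero (Finset.mem_range.2 hj) h.symm
    simp [hP, this] at hp
  have hKpos : ∀ p, 0 < P p → 0 < K p.1 p.2 := fun p hp => Finset.prod_pos fun i hi =>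
    hpos p.1 (ext p.2) i (Finset.mem_range.1 hi) (hpos' p hp)
  have hRsum : ∑ p, R p ≤ 1 := by
    have hw1 : ∀ w, ∑ u : Fin n → Z × Y, L w (ext u) ≤ 1 := fun w =>
      sum_prod_causal_le_one (κ w) (h0 w) (h1 w) (hκ w) n
    -- Substituting for the message its guess from the outputs again gives a causal kernel, by
    -- `hguessκ`, so each guess accounts for mass at most one.
    have hι1 : ∀ ι, ∑ u : Fin n → Z × Y, L (guess ι fun j => (ext u j).2) (ext u) ≤ 1 := fun ι =>
      sum_prod_causal_le_one (fun i u v => κ (guess ι fun j => (u j).2) i u v)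
        (fun i u v => h0 _ _ _ _) (fun i u => h1 _ _ _) (hguessκ ι) n
    have hpath : ∀ w, ∑ y, K w y * (if C w (ext y) then m else 1) ≤
        ∑ u : Fin n → Z × Y, L w (ext u) * (if C w (fun j => (ext u j).2) then m else 1) :=
      fun w => sum_path_le (κ w) (h0 w) (hκ w) (lat w) n
        (φ := fun y => if C w y then m else 1)
        (fun y => by split_ifs <;> [exact hm0.le; exact zero_le_one])
        (fun y y' h => by simp only [hC w y y' h])
    have hsplit : ∀ w, ∑ y, K w y * (if C w (ext y) then m else 1) ≤ 1 +
        ∑ u : Fin n → Z × Y, m * (if C w (fun j => (ext u j).2) then L w (ext u) else 0) := by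
      intro w
      refine (hpath w).trans (le_trans ?_ (add_le_add_left (hw1 w) _))
      rw [← Finset.sum_add_distrib]
      refine Finset.sum_le_sum fun u _ => ?_
      split_ifs
      · linarith [hL0 w (ext u)]
      · linarith
    have hcount : ∀ u : Fin n → Z × Y,
        ∑ w, (if C w (fun j => (ext u j).2) then L w (ext u) else 0) ≤
        ∑ ι, L (guess ι fun j => (ext u j).2) (ext u) := by
      intro u
      calc _ ≤ ∑ w, ∑ ι, if w = guess ι (fun j => (ext u j).2) then L w (ext u) else 0 := by
            refine Finset.sum_le_sum fun w _ => ?_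
            split_ifs with h
            · obtain ⟨ι, hι⟩ := hdec w _ h
              refine le_trans ?_ (Finset.single_le_sum (f := fun ι =>
                if w = guess ι (fun j => (ext u j).2) then L w (ext u) else 0)
                (fun ι _ => by split_ifs <;> [exact hL0 _ _; exact le_rfl]) (Finset.mem_univ ι))
              simp only [if_pos hι]
              exact le_rfl
            · exact Finset.sum_nonneg fun ι _ => by split_ifs <;> [exact hL0 _ _; exact le_rfl]
        _ = _ := by
            rw [Finset.sum_comm]
            simp
    calc ∑ p, R p = (∑ w, ∑ y, K w y * (if C w (ext y) then m else 1)) / (2 * M) := by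
          simp only [hR, Fintype.sum_prod_type, ← Finset.sum_div]
      _ ≤ (∑ w : 𝒲, (1 + ∑ u : Fin n → Z × Y,
          m * (if C w (fun j => (ext u j).2) then L w (ext u) else 0))) / (2 * M) := by
          gcongr with w
          exact hsplit w
      _ = (M + m * ∑ u : Fin n → Z × Y,
          ∑ w, (if C w (fun j => (ext u j).2) then L w (ext u) else 0)) / (2 * M) := by
          rw [Finset.sum_add_distrib, Finset.sum_comm]
          simp only [← Finset.mul_sum]
          simp [hM]
      _ ≤ (M + m * ∑ u : Fin n → Z × Y, ∑ ι, L (guess ι fun j => (ext u j).2) (ext u)) / (2 * M) := by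
          gcongr with u
          exact hcount u
      _ ≤ (M + m * ∑ ι : I, (1 : ℝ)) / (2 * M) := by
          rw [Finset.sum_comm]
          gcongr with ι
          exact hι1 ι
      _ = 1 := by
          simp only [Finset.sum_const, Finset.card_univ, nsmul_eq_mul, mul_one, hm]
          rw [div_mul_cancel₀ _ hI0.ne']
          field_simp
          norm_num
  have hP0 : ∀ p, 0 ≤ P p := fun p =>
    div_nonneg (Finset.prod_nonneg fun i _ => hV.nonneg _ _) hM0.le
  have hif : ∀ p : 𝒲 × (Fin n → Y), 0 < (if C p.1 (ext p.2) then m else 1) := fun p => by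
    split_ifs <;> [exact hm0; exact one_pos]
  have key := sum_mul_log_div_nonneg hP0
    (q := R) (fun p => div_nonneg (mul_nonneg (hK0 _ _) (hif p).le) (by positivity))
    (fun p hp => div_pos (mul_pos (hKpos p hp) (hif p)) (by positivity)) (by rw [hPsum]; exact hRsum)
  have hterm : ∀ p, P p * (Real.log (P p) - Real.log (R p)) =
      P p * (∑ i ∈ Finset.range n, (Real.log (V (x p.1 i) (ext p.2 i)) -
        Real.log (κ p.1 i (fun j => (lat p.1 (ext p.2) j, ext p.2 j)) (lat p.1 (ext p.2) i, ext p.2 i))))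
      + P p * Real.log 2 - P p * (if C p.1 (ext p.2) then 1 else 0) * Real.log m := by
    intro p
    rcases (hP0 p).eq_or_lt with h | h
    · simp [← h]
    · have hp1 : Real.log (P p) = ∑ i ∈ Finset.range n, Real.log (V (x p.1 i) (ext p.2 i))
          - Real.log M := by
        have hne : ∏ i ∈ Finset.range n, V (x p.1 i) (ext p.2 i) ≠ 0 :=
          Finset.prod_ne_zero_iff.2 fun i hi => (hpos' p h i (Finset.mem_range.1 hi)).ne'
        rw [hP]
        dsimp only
        rw [Real.log_div hne hM0.ne',
          Real.log_prod fun i hi => (hpos' p h i (Finset.mem_range.1 hi)).ne']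
      have hp2 : Real.log (R p) = ∑ i ∈ Finset.range n, Real.log (κ p.1 i
          (fun j => (lat p.1 (ext p.2) j, ext p.2 j)) (lat p.1 (ext p.2) i, ext p.2 i))
          + (if C p.1 (ext p.2) then 1 else 0) * Real.log m - (Real.log 2 + Real.log M) := by
        rw [hR]
        dsimp only
        rw [Real.log_div (mul_pos (hKpos p h) (hif p)).ne' (by positivity),
          Real.log_mul (hKpos p h).ne' (hif p).ne', Real.log_mul two_ne_zero hM0.ne', hK]
        dsimp only
        rw [Real.log_prod fun i hi =>
          (hpos p.1 (ext p.2) i (Finset.mem_range.1 hi) (hpos' p h)).ne']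
        split_ifs <;> simp
      rw [hp1, hp2, Finset.sum_sub_distrib]
      ring
  simp only [hterm, Finset.sum_add_distrib, Finset.sum_sub_distrib] at key
  rw [← Finset.sum_mul, hPsum, one_mul, ← Finset.sum_mul] at key
  have e1 : ∑ p, P p * (if C p.1 (ext p.2) then 1 else 0) =
      (∑ w, seqExp V (x w) n fun y => if C w y then 1 else 0) / M := by
    simp only [hP, Fintype.sum_prod_type, seqExp, Finset.sum_div]
    exact Finset.sum_congr rfl fun w _ => Finset.sum_congr rfl fun y _ => by ring
  have e2 : ∑ p, P p * ∑ i ∈ Finset.range n, (Real.log (V (x p.1 i) (ext p.2 i)) -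
        Real.log (κ p.1 i (fun j => (lat p.1 (ext p.2) j, ext p.2 j)) (lat p.1 (ext p.2) i, ext p.2 i)))
      = (∑ w, seqExp V (x w) n fun y => ∑ i ∈ Finset.range n, (Real.log (V (x w i) (y i)) -
        Real.log (κ w i (fun j => (lat w y j, y j)) (lat w y i, y i)))) / M := by
    simp only [hP, Fintype.sum_prod_type, seqExp, Finset.sum_div]
    exact Finset.sum_congr rfl fun w _ => Finset.sum_congr rfl fun y _ => by ring
  simp only [Finset.sum_sub_distrib] at e2 ⊢
  rw [e1] at key
  linarith

end Fano

/-! ### Prediction of the output letter. -/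

section Predictive

variable {X Y T : Type*} [Fintype X] [Fintype Y] [Fintype T]

/-- The law of the output letter given the side information `t` under the input mass `a`. -/
def predictive (V : X → Y → ℝ) (s : X → T) (a : X → ℝ) (t : T) (v : Y) : ℝ :=
  (∑ ξ, restrictTo s a t ξ * V ξ v) / ∑ ξ, restrictTo s a t ξ

variable {V : X → Y → ℝ} (hV : IsStochastic V) (s : X → T) {a : X → ℝ} (ha : ∀ ξ, 0 ≤ a ξ)
include hV ha

lemma predictive_nonneg (t : T) (v : Y) : 0 ≤ predictive V s a t v :=
  div_nonneg (Finset.sum_nonneg fun ξ _ => mul_nonneg (restrictTo_nonneg ha s t ξ) (hV.nonneg _ _))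
    (Finset.sum_nonneg fun ξ _ => restrictTo_nonneg ha s t ξ)

/-- Equality fails when `t` has mass zero: division by zero then makes the whole predictive law
zero. -/
lemma sum_predictive_le (t : T) : ∑ v, predictive V s a t v ≤ 1 := by
  simp only [predictive]
  rw [← Finset.sum_div, sum_mul_row hV]
  exact div_self_le_one _

lemma predictive_pos {ξ : X} {v : Y} (h : 0 < a ξ) (hv : 0 < V ξ v) :
    0 < predictive V s a (s ξ) v := by
  have h1 : restrictTo s a (s ξ) ξ = a ξ := if_pos rfl
  refine div_pos ?_ ?_
  · refine lt_of_lt_of_le (mul_pos (h1 ▸ h) hv) (Finset.single_le_sum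
      (f := fun ξ' => restrictTo s a (s ξ) ξ' * V ξ' v)
      (fun ξ' _ => mul_nonneg (restrictTo_nonneg ha s _ ξ') (hV.nonneg _ _)) (Finset.mem_univ ξ))
  · exact lt_of_lt_of_le (h1.symm ▸ h) (Finset.single_le_sum
      (f := fun ξ' => restrictTo s a (s ξ) ξ')
      (fun ξ' _ => restrictTo_nonneg ha s _ ξ') (Finset.mem_univ ξ))

/-- The predictive law is the reference whose mean log-likelihood ratio is exactly the conditional
information, hence its place in `refKernel`. -/
lemma cmi_eq_sum_log : cmi V s a = ∑ ξ, a ξ * ∑ v, V ξ v *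
    (Real.log (V ξ v) - Real.log (predictive V s a (s ξ) v)) := by
  classical
  have h : ∀ t, mi V (restrictTo s a t) = _ := fun t => mi_eq_sum_log hV (restrictTo_nonneg ha s t)
  rw [cmi, Finset.sum_congr rfl fun t _ => h t, Finset.sum_comm]
  refine Finset.sum_congr rfl fun ξ _ => ?_
  simp only [predictive, restrictTo, ite_mul, zero_mul, Finset.sum_ite_eq, Finset.mem_univ, if_true]

end Predictive

/-! ### The converse with revealed letters. -/

section Converse

variable {𝒲 X Y T I : Type*} [Fintype 𝒲] [Nonempty 𝒲] [Fintype X] [Nonempty X] [Fintype Y]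
  [Nonempty Y] [Fintype T] [Fintype I] [Nonempty I]

/-- The letters of the input sequence at the times `j < i` in `S`. -/
def inputKey (x : 𝒲 → ℕ → X) (S : Finset ℕ) (n i : ℕ) (w : 𝒲) (j : Fin n) : X :=
  if (j : ℕ) < i ∧ (j : ℕ) ∈ S then x w j else Classical.arbitrary X

open Classical in
/-- The joint mass of the message `w` and the event `A i`, when the messages are equiprobable. -/
def eventMass (V : X → Y → ℝ) (x : 𝒲 → ℕ → X) (A : ℕ → (ℕ → Y) → Prop) (i : ℕ) (w : 𝒲) : ℝ :=
  (seqExp V (x w) i fun y => if A i y then 1 else 0) / Fintype.card 𝒲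

/-- The mass of the `i`-th input letter jointly with the key `ζ`. -/
def stepMass (α : ℕ → 𝒲 → ℝ) (x : 𝒲 → ℕ → X) (S : Finset ℕ) (n i : ℕ) (ζ : Fin n → X) (ξ : X) : ℝ :=
  law (α i) (fun w => (inputKey x S n i w, x w i)) (ζ, ξ)

open Classical in
/-- The reference kernel: while `A i` holds, the input letter itself is revealed at the times in
`S`, and at the other times the output is predicted from the revealed letters and the side
information `s`; afterwards the kernel `θ` is used. -/
def refKernel (V : X → Y → ℝ) (x : 𝒲 → ℕ → X) (A : ℕ → (ℕ → Y) → Prop) (S : Finset ℕ) (n : ℕ)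
    (s : X → T) (θ : 𝒲 → ℕ → (ℕ → Y) → Y → ℝ) (w : 𝒲) (i : ℕ) (u : ℕ → X × Y) (p : X × Y) : ℝ :=
  if A i (fun j => (u j).2) then
    if i ∈ S then V p.1 p.2 / Fintype.card X
    else if p.1 = Classical.arbitrary X then
      predictive V s (stepMass (eventMass V x A) x S n i fun j =>
        if (j : ℕ) < i ∧ (j : ℕ) ∈ S then (u j).1 else Classical.arbitrary X) (s (x w i)) p.2
    else 0
  else if p.1 = Classical.arbitrary X then θ w i (fun j => (u j).2) p.2 else 0

variable {V : X → Y → ℝ} (hV : IsStochastic V)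
include hV

lemma eventMass_nonneg (x : 𝒲 → ℕ → X) (A : ℕ → (ℕ → Y) → Prop) (i : ℕ) (w : 𝒲) :
    0 ≤ eventMass V x A i w :=
  div_nonneg (seqExp_nonneg hV fun y => by split_ifs <;> simp) (Nat.cast_nonneg _)

lemma eventMass_pos {x : 𝒲 → ℕ → X} {A : ℕ → (ℕ → Y) → Prop}
    (hA : ∀ i y y', (∀ j < i, y j = y' j) → (A i y ↔ A i y')) {i : ℕ} {w : 𝒲} {y : ℕ → Y}
    (hAy : A i y) (hy : ∀ j < i, 0 < V (x w j) (y j)) : 0 < eventMass V x A i w := by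
  classical
  refine div_pos ?_ (Nat.cast_pos.2 Fintype.card_pos)
  set y' : Fin i → Y := fun j => y j with hy'
  have h1 : ∀ j < i, ext y' j = y j := fun j hj => ext_of_lt y' hj
  refine lt_of_lt_of_le ?_ (Finset.single_le_sum
    (f := fun y : Fin i → Y => (∏ j ∈ Finset.range i, V (x w j) (ext y j)) *
      (if A i (ext y) then (1 : ℝ) else 0)) (fun y _ => mul_nonneg
        (Finset.prod_nonneg fun j _ => hV.nonneg _ _) (by split_ifs <;> simp)) (Finset.mem_univ y'))
  rw [if_pos ((hA i _ _ h1).2 hAy), mul_one]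
  exact Finset.prod_pos fun j hj => by
    rw [h1 j (Finset.mem_range.1 hj)]
    exact hy j (Finset.mem_range.1 hj)

lemma stepMass_nonneg (x : 𝒲 → ℕ → X) (A : ℕ → (ℕ → Y) → Prop) (S : Finset ℕ) (n i : ℕ)
    (ζ : Fin n → X) (ξ : X) : 0 ≤ stepMass (eventMass V x A) x S n i ζ ξ :=
  law_nonneg (eventMass_nonneg hV x A i) _ _

lemma refKernel_nonneg {x : 𝒲 → ℕ → X} {A : ℕ → (ℕ → Y) → Prop} {S : Finset ℕ} {n : ℕ}
    {s : X → T} {θ : 𝒲 → ℕ → (ℕ → Y) → Y → ℝ} (hθ0 : ∀ w i y v, 0 ≤ θ w i y v) (w : 𝒲) (i : ℕ)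
    (u : ℕ → X × Y) (p : X × Y) : 0 ≤ refKernel V x A S n s θ w i u p := by
  unfold refKernel
  split_ifs
  · exact div_nonneg (hV.nonneg _ _) (Nat.cast_nonneg _)
  · exact predictive_nonneg hV s (stepMass_nonneg hV x A S n i _) _ _
  · exact le_rfl
  · exact hθ0 _ _ _ _
  · exact le_rfl

lemma sum_refKernel_le {x : 𝒲 → ℕ → X} {A : ℕ → (ℕ → Y) → Prop} {S : Finset ℕ} {n : ℕ}
    {s : X → T} {θ : 𝒲 → ℕ → (ℕ → Y) → Y → ℝ} (hθ1 : ∀ w i y, ∑ v, θ w i y v ≤ 1) (w : 𝒲) (i : ℕ)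
    (u : ℕ → X × Y) : ∑ p, refKernel V x A S n s θ w i u p ≤ 1 := by
  classical
  unfold refKernel
  by_cases h1 : A i (fun j => (u j).2)
  · by_cases h2 : i ∈ S
    · simp only [if_pos h1, if_pos h2, Fintype.sum_prod_type, ← Finset.sum_div, hV.sum_eq_one]
      simp
    · simp only [if_pos h1, if_neg h2, Fintype.sum_prod_type, Finset.sum_ite_irrel,
        Finset.sum_const_zero, Finset.sum_ite_eq', Finset.mem_univ, if_true]
      exact sum_predictive_le hV s (stepMass_nonneg hV x A S n i _) _
  · simp only [if_neg h1, Fintype.sum_prod_type, Finset.sum_ite_irrel,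
        Finset.sum_const_zero, Finset.sum_ite_eq', Finset.mem_univ, if_true]
    exact hθ1 _ _ _

open Classical in
/-- The converse for finitely many received letters. The first term on the right accounts for the
times at which `A` holds, the second for the others. -/
lemma converse (x : 𝒲 → ℕ → X) (n : ℕ) (A : ℕ → (ℕ → Y) → Prop)
    (hA : ∀ i y y', (∀ j < i, y j = y' j) → (A i y ↔ A i y'))
    (hAanti : ∀ i j y, i ≤ j → A j y → A i y) (S : Finset ℕ) (s : X → T)
    (θ : 𝒲 → ℕ → (ℕ → Y) → Y → ℝ) (hθ0 : ∀ w i y v, 0 ≤ θ w i y v)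
    (hθ1 : ∀ w i y, ∑ v, θ w i y v ≤ 1)
    (hθ : ∀ w i y y' v, (∀ j < i, y j = y' j) → θ w i y v = θ w i y' v)
    (hθpos : ∀ w i y v, 0 < V (x w i) v → 0 < θ w i y v)
    (C : 𝒲 → (ℕ → Y) → Prop) (hC : ∀ w y y', (∀ j < n, y j = y' j) → (C w y ↔ C w y'))
    (guess : I → (ℕ → Y) → 𝒲) (hdec : ∀ w y, C w y → ∃ ι, w = guess ι y)
    (hs : ∀ ι i y y', (∀ j < i, y j = y' j) → A i y →
      s (x (guess ι y) i) = s (x (guess ι y') i))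
    (hguessθ : ∀ ι i y y' v, (∀ j < i, y j = y' j) → ¬ A i y →
      θ (guess ι y) i y v = θ (guess ι y') i y' v)
    (c : ℕ → (ℕ → Y) → ℝ) (hc : ∀ w i y, ¬ A i y →
      ∑ v, V (x w i) v * (Real.log (V (x w i) v) - Real.log (θ w i y v)) ≤ c i y) :
    (∑ w, seqExp V (x w) n fun y => if C w y then 1 else 0) / Fintype.card 𝒲 *
        Real.log (Fintype.card 𝒲 / Fintype.card I) - Real.log 2 ≤
      ∑ i ∈ Finset.range n, ((if i ∈ S then (∑ w, eventMass V x A i w) * Real.log (Fintype.card X)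
        else ∑ ζ, cmi V s (stepMass (eventMass V x A) x S n i ζ)) +
        (∑ w, seqExp V (x w) n fun y => if A i y then 0 else c i y) / Fintype.card 𝒲) := by
  set x₀ : X := Classical.arbitrary X with hx₀
  set lat : 𝒲 → (ℕ → Y) → ℕ → X := fun w y i => if A i y ∧ i ∈ S then x w i else x₀ with hlat
  have hX0 : (0 : ℝ) < Fintype.card X := Nat.cast_pos.2 Fintype.card_pos
  have hM0 : (0 : ℝ) < Fintype.card 𝒲 := Nat.cast_pos.2 Fintype.card_pos
  -- If `A i` holds it held at all earlier times, so the latent letters recorded so far are the true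
  -- inputs at the revealed times.
  have hkey : ∀ w y i, A i y → (fun j : Fin n => if (j : ℕ) < i ∧ (j : ℕ) ∈ S then lat w y j else x₀)
      = inputKey x S n i w := by
    intro w y i h
    funext j
    simp only [inputKey, hlat]
    by_cases hj : (j : ℕ) < i ∧ (j : ℕ) ∈ S
    · rw [if_pos hj, if_pos hj, if_pos ⟨hAanti _ _ _ hj.1.le h, hj.2⟩]
    · rw [if_neg hj, if_neg hj]
  -- Serves twice for `fano`, for causality with a fixed message and for causality along a guess.
  -- The message enters the kernel only through `s (x w i)` while `A` holds, and only through `θ`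
  -- afterwards.
  have hcausal : ∀ w w' i (u u' : ℕ → X × Y) v, (∀ j < i, u j = u' j) →
      (A i (fun j => (u j).2) → s (x w i) = s (x w' i)) →
      (¬ A i (fun j => (u j).2) → ∀ v, θ w i (fun j => (u j).2) v = θ w' i (fun j => (u' j).2) v) →
      refKernel V x A S n s θ w i u v = refKernel V x A S n s θ w' i u' v := by
    intro w w' i u u' v hu h1 h2
    have hu2 : ∀ j < i, (u j).2 = (u' j).2 := fun j hj => by rw [hu j hj]
    have hk : (fun j : Fin n => if (j : ℕ) < i ∧ (j : ℕ) ∈ S then (u j).1 else x₀) =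
        fun j : Fin n => if (j : ℕ) < i ∧ (j : ℕ) ∈ S then (u' j).1 else x₀ := by
      funext j
      by_cases hj : (j : ℕ) < i ∧ (j : ℕ) ∈ S
      · rw [if_pos hj, if_pos hj, hu _ hj.1]
      · rw [if_neg hj, if_neg hj]
    unfold refKernel
    rw [hk]
    by_cases hAi : A i (fun j => (u j).2)
    · rw [if_pos hAi, if_pos ((hA i _ _ hu2).1 hAi), h1 hAi]
    · rw [if_neg hAi, if_neg (fun h => hAi ((hA i _ _ hu2).2 h)), h2 hAi]
  have hpos : ∀ w y i, i < n → (∀ j < n, 0 < V (x w j) (y j)) →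
      0 < refKernel V x A S n s θ w i (fun j => (lat w y j, y j)) (lat w y i, y i) := by
    intro w y i hi hy
    unfold refKernel
    dsimp only
    split_ifs with h1 h2 h3 h3
    · simp only [hlat, if_pos (And.intro h1 h2)]
      exact div_pos (hy i hi) hX0
    · rw [hkey w y i h1]
      refine predictive_pos hV s (stepMass_nonneg hV x A S n i _) ?_ (hy i hi)
      exact (eventMass_pos hV hA h1 fun j hj => hy j (hj.trans hi)).trans_le
        (le_law (eventMass_nonneg hV x A i) (fun w => (inputKey x S n i w, x w i)) w)
    · exact absurd (if_neg fun h => h2 h.2) h3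
    · exact hθpos w i _ _ (hy i hi)
    · exact absurd (if_neg fun h => h1 h.1) h3
  refine (fano hV x n (refKernel V x A S n s θ) (refKernel_nonneg hV hθ0)
    (sum_refKernel_le hV hθ1) (fun w i u u' v hu => hcausal w w i u u' v hu (fun _ => rfl)
      fun _ v => hθ w i _ _ v fun j hj => by rw [hu j hj])
    lat C hC guess hdec (fun ι i u u' v hu => hcausal _ _ i u u' v hu
      (fun h => hs ι i _ _ (fun j hj => by rw [hu j hj]) h)
      fun h v => hguessθ ι i _ _ v (fun j hj => by rw [hu j hj]) h) hpos).trans ?_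
  -- The mean log ratio at time `i`. A revealed letter costs `log |X|`, since the reference draws it
  -- uniformly and then uses the channel itself. Otherwise the divergence from the predictive law
  -- appears, and `c i` once `A` has ended.
  have hstep : ∀ w, ∀ i < n, seqExp V (x w) n (fun y => Real.log (V (x w i) (y i)) -
      Real.log (refKernel V x A S n s θ w i (fun j => (lat w y j, y j)) (lat w y i, y i))) ≤
      (seqExp V (x w) i fun y => if A i y then 1 else 0) * (if i ∈ S then Real.log (Fintype.card X)
        else ∑ v, V (x w i) v * (Real.log (V (x w i) v) - Real.log (predictive V s
          (stepMass (eventMass V x A) x S n i (inputKey x S n i w)) (s (x w i)) v))) +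
      seqExp V (x w) n fun y => if A i y then 0 else c i y := by
    intro w i hi
    rw [seqExp_letter hV hi (H := fun y v => Real.log (V (x w i) v) -
      Real.log (refKernel V x A S n s θ w i (fun j => (lat w y j, y j)) (lat w y i, v)))]
    · rw [← seqExp_eq_of_le hV hi.le fun y y' h => by simp only [hA i y y' h], ← seqExp_mul_const,
        ← seqExp_add]
      refine seqExp_mono hV fun y => ?_
      dsimp only [refKernel]
      by_cases h1 : A i y
      · simp only [if_pos h1]
        by_cases h2 : i ∈ S
        · simp only [if_pos h2, hlat, if_pos (And.intro h1 h2)]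
          have : ∀ v, V (x w i) v * (Real.log (V (x w i) v) -
              Real.log (V (x w i) v / Fintype.card X)) = V (x w i) v * Real.log (Fintype.card X) := by
            intro v
            rcases (hV.nonneg (x w i) v).eq_or_lt with h | h
            · simp [← h]
            · rw [Real.log_div h.ne' hX0.ne']
              ring
          simp only [this, ← Finset.sum_mul, hV.sum_eq_one]
          simp
        · have h3 : lat w y i = x₀ := if_neg fun h => h2 h.2
          simp only [if_neg h2, h3, ← hx₀, if_true, hkey w y i h1, one_mul, add_zero]
          exact le_rfl
      · have h3 : lat w y i = x₀ := if_neg fun h => h1 h.1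
        simp only [if_neg h1, h3, ← hx₀, if_true, zero_mul, zero_add]
        exact hc w i y h1
    · intro y y' v h
      have hl : ∀ j < i, lat w y j = lat w y' j := fun j hj => by
        simp only [hlat, hA j y y' fun k hk => h k (hk.trans hj)]
      have hl' : lat w y i = lat w y' i := by simp only [hlat, hA i y y' h]
      rw [hl']
      congr 2
      exact hcausal w w i _ _ _ (fun j hj => by rw [hl j hj, h j hj]) (fun _ => rfl)
        fun _ v => hθ w i _ _ v fun j hj => h j hj
  simp only [seqExp_sum]
  rw [Finset.sum_comm, Finset.sum_div]
  refine Finset.sum_le_sum fun i hi => ?_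
  have hi' := Finset.mem_range.1 hi
  refine (div_le_div_of_nonneg_right (Finset.sum_le_sum fun w _ => hstep w i hi') hM0.le).trans ?_
  rw [Finset.sum_add_distrib, add_div]
  refine add_le_add_left (le_of_eq ?_) _
  rw [Finset.sum_div]
  by_cases h2 : i ∈ S
  · simp only [if_pos h2, Finset.sum_mul, eventMass]
    exact Finset.sum_congr rfl fun w _ => by ring
  · simp only [if_neg h2]
    rw [Finset.sum_congr rfl fun ζ (_ : ζ ∈ Finset.univ) =>
      cmi_eq_sum_log hV s (stepMass_nonneg hV x A S n i ζ), ← Fintype.sum_prod_type'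
      (f := fun ζ ξ => stepMass (eventMass V x A) x S n i ζ ξ * ∑ v, V ξ v * (Real.log (V ξ v) -
        Real.log (predictive V s (stepMass (eventMass V x A) x S n i ζ) (s ξ) v)))]
    refine Eq.trans ?_ (sum_law_mul (eventMass V x A i) (fun w => (inputKey x S n i w, x w i))
      fun p => ∑ v, V p.2 v * (Real.log (V p.2 v) -
        Real.log (predictive V s (stepMass (eventMass V x A) x S n i p.1) (s p.2) v))).symm
    exact Finset.sum_congr rfl fun w _ => by rw [eventMass]; ring

end Converse

/-! ### Wringing: making the inputs nearly independent. -/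

section Wringing

variable {𝒲₁ 𝒲₂ : Type*} [Fintype 𝒲₁] [Fintype 𝒲₂] [Nonempty 𝒲₁] [Nonempty 𝒲₂]

/-- The uniform mass function. -/
def unif (𝒲 : Type*) [Fintype 𝒲] (_ : 𝒲) : ℝ := 1 / Fintype.card 𝒲

lemma unif_pos {𝒲 : Type*} [Fintype 𝒲] (w : 𝒲) : 0 < unif 𝒲 w :=
  div_pos one_pos (Nat.cast_pos.2 (Fintype.card_pos_iff.2 ⟨w⟩))

lemma law_unif_pos {𝒲 K : Type*} [Fintype 𝒲] (k : 𝒲 → K) (w : 𝒲) : 0 < law (unif 𝒲) k (k w) :=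
  (unif_pos w).trans_le (le_law (fun w => (unif_pos w).le) k w)

lemma sum_unif {𝒲 : Type*} [Fintype 𝒲] [Nonempty 𝒲] : ∑ w, unif 𝒲 w = 1 := by
  simp [unif]

variable {K₁ K₂ K₁' K₂' X₁ X₂ : Type*} [Fintype K₁] [Fintype K₂] [Fintype X₁] [Fintype X₂]

/-- The divergence of the joint law of the keys `k₁`, `k₂` under the mass `α` from the product of
their laws under the uniform distribution. -/
def potential (k₁ : 𝒲₁ → K₁) (k₂ : 𝒲₂ → K₂) (α : 𝒲₁ × 𝒲₂ → ℝ) : ℝ :=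
  ∑ w, α w * (Real.log (law α (fun w => (k₁ w.1, k₂ w.2)) (k₁ w.1, k₂ w.2))
    - Real.log (law (unif 𝒲₁) k₁ (k₁ w.1)) - Real.log (law (unif 𝒲₂) k₂ (k₂ w.2)))

/-- The dependence of `ξ₁` and `ξ₂` given `k`, under the mass `α`. -/
def condDependence {𝒲 K : Type*} [Fintype 𝒲] (α : 𝒲 → ℝ) (k : 𝒲 → K) (ξ₁ : 𝒲 → X₁)
    (ξ₂ : 𝒲 → X₂) : ℝ :=
  ∑ w, α w * (Real.log (law α (fun w => (k w, ξ₁ w, ξ₂ w)) (k w, ξ₁ w, ξ₂ w))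
    + Real.log (law α k (k w)) - Real.log (law α (fun w => (k w, ξ₁ w)) (k w, ξ₁ w))
    - Real.log (law α (fun w => (k w, ξ₂ w)) (k w, ξ₂ w)))

lemma potential_congr {k₁ : 𝒲₁ → K₁} {k₂ : 𝒲₂ → K₂} {k₁' : 𝒲₁ → K₁'} {k₂' : 𝒲₂ → K₂'}
    (h₁ : ∀ w w', k₁ w = k₁ w' ↔ k₁' w = k₁' w') (h₂ : ∀ w w', k₂ w = k₂ w' ↔ k₂' w = k₂' w')
    (α : 𝒲₁ × 𝒲₂ → ℝ) : potential k₁ k₂ α = potential k₁' k₂' α := by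
  refine Finset.sum_congr rfl fun w _ => ?_
  rw [law_congr (fun w' => h₁ w' w.1), law_congr (fun w' => h₂ w' w.2),
    law_congr (b := (k₁' w.1, k₂' w.2)) (g := fun w => (k₁' w.1, k₂' w.2)) fun w' => by
      simp only [Prod.mk.injEq, h₁, h₂]]

lemma condDependence_congr {𝒲 K K' : Type*} [Fintype 𝒲] (α : 𝒲 → ℝ) {k : 𝒲 → K} {k' : 𝒲 → K'}
    (h : ∀ w w', k w = k w' ↔ k' w = k' w') (ξ₁ : 𝒲 → X₁) (ξ₂ : 𝒲 → X₂) :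
    condDependence α k ξ₁ ξ₂ = condDependence α k' ξ₁ ξ₂ := by
  refine Finset.sum_congr rfl fun w _ => ?_
  have h1 : law α (fun w => (k w, ξ₁ w, ξ₂ w)) (k w, ξ₁ w, ξ₂ w) =
      law α (fun w => (k' w, ξ₁ w, ξ₂ w)) (k' w, ξ₁ w, ξ₂ w) :=
    law_congr fun w' => by simp only [Prod.mk.injEq, h]
  have h2 : law α (fun w => (k w, ξ₁ w)) (k w, ξ₁ w) = law α (fun w => (k' w, ξ₁ w)) (k' w, ξ₁ w) :=
    law_congr fun w' => by simp only [Prod.mk.injEq, h]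
  have h3 : law α (fun w => (k w, ξ₂ w)) (k w, ξ₂ w) = law α (fun w => (k' w, ξ₂ w)) (k' w, ξ₂ w) :=
    law_congr fun w' => by simp only [Prod.mk.injEq, h]
  rw [law_congr (fun w' => h w' w), h1, h2, h3]

lemma law_le_mul_law {α : 𝒲₁ × 𝒲₂ → ℝ} (hα : ∀ w, α w ≤ unif 𝒲₁ w.1 * unif 𝒲₂ w.2)
    (k₁ : 𝒲₁ → K₁) (k₂ : 𝒲₂ → K₂) (a : K₁) (b : K₂) :
    law α (fun w => (k₁ w.1, k₂ w.2)) (a, b) ≤ law (unif 𝒲₁) k₁ a * law (unif 𝒲₂) k₂ b := by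
  classical
  simp only [law, Finset.sum_mul_sum, Fintype.sum_prod_type, Prod.mk.injEq]
  refine Finset.sum_le_sum fun w₁ _ => Finset.sum_le_sum fun w₂ _ => ?_
  by_cases h1 : k₁ w₁ = a <;> by_cases h2 : k₂ w₂ = b <;> simp [h1, h2, hα (w₁, w₂)]

variable {α : 𝒲₁ × 𝒲₂ → ℝ} (hα0 : ∀ w, 0 ≤ α w)
include hα0

/-- The joint mass of the keys is dominated by the product of their uniform-message laws, so each
logarithm is at most zero. -/
lemma potential_nonpos (hα : ∀ w, α w ≤ unif 𝒲₁ w.1 * unif 𝒲₂ w.2) (k₁ : 𝒲₁ → K₁)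
    (k₂ : 𝒲₂ → K₂) : potential k₁ k₂ α ≤ 0 := by
  refine Finset.sum_nonpos fun w _ => ?_
  rcases (hα0 w).eq_or_lt with h | h
  · simp [← h]
  · refine mul_nonpos_of_nonneg_of_nonpos h.le ?_
    have h1 := Real.log_le_log (h.trans_le (le_law hα0 (fun w => (k₁ w.1, k₂ w.2)) w))
      (law_le_mul_law hα k₁ k₂ (k₁ w.1) (k₂ w.2))
    rw [Real.log_mul (law_unif_pos k₁ _).ne' (law_unif_pos k₂ _).ne'] at h1
    linarith

omit hα0 in
-- The derivative of `a log (a / p)` in `a` is `log (a / p) + 1`, which is at most one for `a ≤ p`.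
lemma mul_log_sub_le {a a' p : ℝ} (h0 : 0 ≤ a') (h1 : a' ≤ a) (h2 : a ≤ p) :
    a * (Real.log a - Real.log p) - a' * (Real.log a' - Real.log p) ≤ a - a' := by
  rcases h0.eq_or_lt with h | h
  · subst h
    rcases h1.eq_or_lt with h' | h'
    · simp [← h']
    · have := mul_nonpos_of_nonneg_of_nonpos h1 (sub_nonpos.2 (Real.log_le_log h' h2))
      linarith
  · have ha := h.trans_le h1
    have h3 := Real.log_le_sub_one_of_pos (div_pos ha h)
    rw [Real.log_div ha.ne' h.ne'] at h3
    have h4 := mul_le_mul_of_nonneg_left h3 h.le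
    have h5 : a' * (a / a' - 1) = a - a' := by field_simp
    have h6 := mul_nonpos_of_nonneg_of_nonpos (sub_nonneg.2 h1)
      (sub_nonpos.2 (Real.log_le_log ha h2))
    linarith

/-- The potential decreases by at most the lost mass when the mass decreases. -/
lemma potential_sub_le {α' : 𝒲₁ × 𝒲₂ → ℝ} (hα'0 : ∀ w, 0 ≤ α' w) (hα' : ∀ w, α' w ≤ α w)
    (hα : ∀ w, α w ≤ unif 𝒲₁ w.1 * unif 𝒲₂ w.2) (k₁ : 𝒲₁ → K₁) (k₂ : 𝒲₂ → K₂) :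
    potential k₁ k₂ α - potential k₁ k₂ α' ≤ ∑ w, α w - ∑ w, α' w := by
  have hsum : ∀ β : 𝒲₁ × 𝒲₂ → ℝ, potential k₁ k₂ β = ∑ z, law β (fun w => (k₁ w.1, k₂ w.2)) z *
      (Real.log (law β (fun w => (k₁ w.1, k₂ w.2)) z) - Real.log (law (unif 𝒲₁) k₁ z.1)
        - Real.log (law (unif 𝒲₂) k₂ z.2)) := fun β =>
    (sum_law_mul β (fun w => (k₁ w.1, k₂ w.2)) fun z =>
      (Real.log (law β (fun w => (k₁ w.1, k₂ w.2)) z) - Real.log (law (unif 𝒲₁) k₁ z.1)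
        - Real.log (law (unif 𝒲₂) k₂ z.2))).symm
  rw [hsum, hsum, ← sum_law α fun w => (k₁ w.1, k₂ w.2), ← sum_law α' fun w => (k₁ w.1, k₂ w.2),
    ← Finset.sum_sub_distrib, ← Finset.sum_sub_distrib]
  refine Finset.sum_le_sum fun z _ => ?_
  have h1 : law α' (fun w => (k₁ w.1, k₂ w.2)) z ≤ law α (fun w => (k₁ w.1, k₂ w.2)) z :=
    Finset.sum_le_sum fun w _ => by split_ifs <;> simp [hα']
  have h2 := law_le_mul_law hα k₁ k₂ z.1 z.2
  have h3 := mul_log_sub_le (law_nonneg hα'0 _ _) h1 h2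
  rcases (law_nonneg hα0 (fun w => (k₁ w.1, k₂ w.2)) z).eq_or_lt with h | h
  · have h4 : law α' (fun w => (k₁ w.1, k₂ w.2)) z = 0 :=
      le_antisymm (h1.trans h.symm.le) (law_nonneg hα'0 _ _)
    simp [← h, h4]
  · have h5 : 0 < law (unif 𝒲₁) k₁ z.1 * law (unif 𝒲₂) k₂ z.2 := h.trans_le h2
    have h6 : 0 < law (unif 𝒲₁) k₁ z.1 := lt_of_le_of_ne
      (law_nonneg (fun w => (unif_pos w).le) _ _) fun h' => by simp [← h'] at h5
    have h7 : 0 < law (unif 𝒲₂) k₂ z.2 := lt_of_le_of_ne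
      (law_nonneg (fun w => (unif_pos w).le) _ _) fun h' => by simp [← h'] at h5
    rw [Real.log_mul h6.ne' h7.ne'] at h3
    simp only [sub_sub]
    exact h3

/-- A conditional divergence: `cond_gibbs` with the conditional law of `ξ` given `k` under uniform
messages as the reference. In the application `κ` selects one user's message and `π` forgets the
other user's key. -/
lemma cross_entropy_gain {𝒲 K X : Type*} [Fintype 𝒲] [Fintype K] [Fintype X] (k : 𝒲 → K)
    (ξ : 𝒲 → X) (κ : 𝒲₁ × 𝒲₂ → 𝒲) {K' : Type*} [Fintype K'] (k' : 𝒲₁ × 𝒲₂ → K') (π : K' → K)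
    (hk : ∀ w, π (k' w) = k (κ w)) :
    0 ≤ ∑ w, α w * (Real.log (law α (fun w => (k' w, ξ (κ w))) (k' w, ξ (κ w)))
      - Real.log (law α k' (k' w))
      - (Real.log (law (unif 𝒲) (fun w => (k w, ξ w)) (k (κ w), ξ (κ w)))
        - Real.log (law (unif 𝒲) k (k (κ w))))) := by
  have hu : ∀ w : 𝒲, 0 ≤ unif 𝒲 w := fun w => (unif_pos w).le
  refine (cond_gibbs hα0 k' (fun w => ξ (κ w))
    (fun a b => law (unif 𝒲) (fun w => (k w, ξ w)) (π a, b) / law (unif 𝒲) k (π a))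
    (fun a b => div_nonneg (law_nonneg hu _ _) (law_nonneg hu _ _))
    (fun a => by rw [← Finset.sum_div, sum_law_pair]; exact div_self_le_one _)
    (fun w _ => by
      rw [hk]
      exact div_pos (law_unif_pos (fun w => (k w, ξ w)) (κ w)) (law_unif_pos k (κ w)))).trans
    (le_of_eq (Finset.sum_congr rfl fun w _ => ?_))
  rw [hk, Real.log_div (law_unif_pos (fun w => (k w, ξ w)) (κ w)).ne' (law_unif_pos k (κ w)).ne']

/-- Refining the keys by `ξ₁`, `ξ₂` increases the potential by at least their dependence. -/
lemma potential_add_le (k₁ : 𝒲₁ → K₁) (k₂ : 𝒲₂ → K₂) (ξ₁ : 𝒲₁ → X₁) (ξ₂ : 𝒲₂ → X₂) :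
    potential k₁ k₂ α +
      condDependence α (fun w => (k₁ w.1, k₂ w.2)) (fun w => ξ₁ w.1) (fun w => ξ₂ w.2) ≤
    potential (fun w => (k₁ w, ξ₁ w)) (fun w => (k₂ w, ξ₂ w)) α := by
  -- By the chain rule the gain in potential is the conditional dependence plus, for each user, a
  -- conditional divergence of the new letter from its law under uniform messages. Those two are
  -- nonnegative.
  have h1 := cross_entropy_gain hα0 k₁ ξ₁ Prod.fst (fun w => (k₁ w.1, k₂ w.2)) Prod.fst
    fun _ => rfl
  have h2 := cross_entropy_gain hα0 k₂ ξ₂ Prod.snd (fun w => (k₁ w.1, k₂ w.2)) Prod.snd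
    fun _ => rfl
  have h3 : ∀ w : 𝒲₁ × 𝒲₂, law α (fun w => ((k₁ w.1, ξ₁ w.1), k₂ w.2, ξ₂ w.2))
      ((k₁ w.1, ξ₁ w.1), k₂ w.2, ξ₂ w.2) =
      law α (fun w => ((k₁ w.1, k₂ w.2), ξ₁ w.1, ξ₂ w.2)) ((k₁ w.1, k₂ w.2), ξ₁ w.1, ξ₂ w.2) :=
    fun w => law_congr fun w' => by simp only [Prod.mk.injEq]; tauto
  simp only [potential, condDependence, h3]
  simp only [mul_sub, mul_add, Finset.sum_sub_distrib, Finset.sum_add_distrib] at h1 h2 ⊢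
  linarith

omit hα0
variable [Nonempty X₁] [Nonempty X₂]

lemma inputKey_succ_of_notMem {𝒲 X : Type*} [Nonempty X] (x : 𝒲 → ℕ → X) {S : Finset ℕ} {n i : ℕ}
    (h : i ∉ S) (w : 𝒲) : inputKey x S n (i + 1) w = inputKey x S n i w := by
  funext j
  have : ((j : ℕ) < i + 1 ∧ (j : ℕ) ∈ S) ↔ ((j : ℕ) < i ∧ (j : ℕ) ∈ S) := by
    constructor
    · rintro ⟨h1, h2⟩
      have : (j : ℕ) ≠ i := fun h' => h (h' ▸ h2)
      exact ⟨by omega, h2⟩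
    · exact fun h => ⟨by omega, h.2⟩
  simp only [inputKey, this]

lemma inputKey_insert {𝒲 X : Type*} [Nonempty X] (x : 𝒲 → ℕ → X) {S : Finset ℕ} {n i m : ℕ}
    (h : i ≤ m) (w : 𝒲) : inputKey x (insert m S) n i w = inputKey x S n i w := by
  funext j
  have : ((j : ℕ) < i ∧ (j : ℕ) ∈ insert m S) ↔ ((j : ℕ) < i ∧ (j : ℕ) ∈ S) := by
    rw [Finset.mem_insert]
    constructor
    · rintro ⟨h1, h2 | h2⟩
      · omega
      · exact ⟨h1, h2⟩
    · exact fun h => ⟨h.1, Or.inr h.2⟩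
  simp only [inputKey, this]

/-- Revealing time `m` appends one letter to the key. An equivalence of equalities suffices because
the potential depends only on the partitions that the keys induce. -/
lemma inputKey_insert_succ {𝒲 X : Type*} [Nonempty X] (x : 𝒲 → ℕ → X) {S : Finset ℕ} {n m : ℕ}
    (h : m < n) (w w' : 𝒲) :
    inputKey x (insert m S) n (m + 1) w = inputKey x (insert m S) n (m + 1) w' ↔
      (inputKey x S n m w, x w m) = (inputKey x S n m w', x w' m) := by
  rw [Prod.mk.injEq, ← inputKey_insert x (S := S) (n := n) (le_refl m) w,
    ← inputKey_insert x (S := S) (n := n) (le_refl m) w']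
  constructor
  · intro h'
    refine ⟨funext fun j => ?_, ?_⟩
    · have := congrFun h' j
      simp only [inputKey] at this ⊢
      by_cases hj : (j : ℕ) < m ∧ (j : ℕ) ∈ insert m S
      · rw [if_pos ⟨by omega, hj.2⟩, if_pos ⟨by omega, hj.2⟩] at this
        rw [if_pos hj, if_pos hj, this]
      · rw [if_neg hj, if_neg hj]
    · have := congrFun h' ⟨m, h⟩
      simpa [inputKey] using this
  · rintro ⟨h1, h2⟩
    funext j
    have h3 := congrFun h1 j
    simp only [inputKey] at h3 ⊢
    by_cases hj : (j : ℕ) < m + 1 ∧ (j : ℕ) ∈ insert m S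
    · rw [if_pos hj, if_pos hj]
      by_cases hjm : (j : ℕ) = m
      · rw [hjm, h2]
      · rw [if_pos ⟨by omega, hj.2⟩, if_pos ⟨by omega, hj.2⟩] at h3
        exact h3
    · rw [if_neg hj, if_neg hj]

/-- Wringing: after revealing the input letters at a set `S` of times of small total mass, the two
input letters are nearly independent at all other times. -/
lemma exists_wringing_set (x₁ : 𝒲₁ → ℕ → X₁) (x₂ : 𝒲₂ → ℕ → X₂) (α : ℕ → 𝒲₁ × 𝒲₂ → ℝ)
    (h0 : ∀ i w, 0 ≤ α i w) (hanti : ∀ i w, α (i + 1) w ≤ α i w)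
    (hinit : ∀ w, α 0 w = unif 𝒲₁ w.1 * unif 𝒲₂ w.2) {δ : ℝ} (n : ℕ) :
    ∃ S : Finset ℕ, (∀ i < n, i ∉ S → condDependence (α i)
        (fun w => (inputKey x₁ S n i w.1, inputKey x₂ S n i w.2)) (fun w => x₁ w.1 i)
        (fun w => x₂ w.2 i) ≤ δ * ∑ w, α i w) ∧ S ⊆ Finset.range n ∧
      δ * ∑ i ∈ S, ∑ w, α i w ≤ 1 := by
  have hle : ∀ i w, α i w ≤ unif 𝒲₁ w.1 * unif 𝒲₂ w.2 := fun i w => by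
    induction i with
    | zero => exact (hinit w).le
    | succ i ih => exact (hanti i w).trans ih
  -- Greedy choice of `S`: time `m` is revealed exactly when the dependence of its letters, given
  -- those already revealed, exceeds `δ` times the surviving mass. That raises the potential by more
  -- than this amount, while passing from mass `α m` to `α (m + 1)` lowers it by at most the mass
  -- lost. The term `1 - ∑ w, α m w` is the total loss so far.
  have main : ∀ m ≤ n, ∃ S : Finset ℕ, S ⊆ Finset.range m ∧ (∀ i < m, i ∉ S → condDependence (α i)
        (fun w => (inputKey x₁ S n i w.1, inputKey x₂ S n i w.2)) (fun w => x₁ w.1 i)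
        (fun w => x₂ w.2 i) ≤ δ * ∑ w, α i w) ∧
      δ * ∑ i ∈ S, ∑ w, α i w ≤
        potential (inputKey x₁ S n m) (inputKey x₂ S n m) (α m) + 1 - ∑ w, α m w := by
    intro m
    induction m with
    | zero =>
      refine fun _ => ⟨∅, by simp, by simp, ?_⟩
      have hsum : ∑ w, α 0 w = 1 := by
        simp only [hinit, Fintype.sum_prod_type, ← Finset.mul_sum, sum_unif, mul_one]
      have hk₁ : ∀ w w', inputKey x₁ ∅ n 0 w = inputKey x₁ ∅ n 0 w' ↔ () = () :=
        fun w w' => ⟨fun _ => rfl, fun _ => funext fun j => by simp [inputKey]⟩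
      have hk₂ : ∀ w w', inputKey x₂ ∅ n 0 w = inputKey x₂ ∅ n 0 w' ↔ () = () :=
        fun w w' => ⟨fun _ => rfl, fun _ => funext fun j => by simp [inputKey]⟩
      rw [potential_congr (k₁' := fun _ => ()) (k₂' := fun _ => ()) hk₁ hk₂]
      simp [potential, law, hsum, sum_unif]
    | succ m ih =>
      intro hm
      obtain ⟨S, hSm, hS, hpot⟩ := ih (by omega)
      have hmS : m ∉ S := fun h => by simpa using hSm h
      by_cases hc : condDependence (α m)
        (fun w => (inputKey x₁ S n m w.1, inputKey x₂ S n m w.2)) (fun w => x₁ w.1 m)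
        (fun w => x₂ w.2 m) ≤ δ * ∑ w, α m w
      · refine ⟨S, hSm.trans (Finset.range_mono (Nat.le_succ m)), fun i hi hiS => ?_, ?_⟩
        · rcases Nat.lt_succ_iff_lt_or_eq.1 hi with h | h
          · exact hS i h hiS
          · exact h ▸ hc
        · have h1 := potential_sub_le (h0 m) (h0 (m + 1)) (hanti m) (hle m)
            (inputKey x₁ S n m) (inputKey x₂ S n m)
          rw [potential_congr (fun w w' => by
            rw [inputKey_succ_of_notMem x₁ hmS, inputKey_succ_of_notMem x₁ hmS])
            (fun w w' => by
            rw [inputKey_succ_of_notMem x₂ hmS, inputKey_succ_of_notMem x₂ hmS])]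
          linarith
      · refine ⟨insert m S, ?_, fun i hi hiS => ?_, ?_⟩
        · intro i hi
          rcases Finset.mem_insert.1 hi with h | h
          · simp [h]
          · exact Finset.range_mono (Nat.le_succ m) (hSm h)
        · rw [Finset.mem_insert, not_or] at hiS
          have := hS i (by omega) hiS.2
          simpa only [inputKey_insert _ (show i ≤ m by omega)] using this
        · rw [Finset.sum_insert hmS]
          have h1 := potential_sub_le (h0 m) (h0 (m + 1)) (hanti m) (hle m)
            (inputKey x₁ (insert m S) n (m + 1)) (inputKey x₂ (insert m S) n (m + 1))
          have h2 := potential_add_le (h0 m) (inputKey x₁ S n m) (inputKey x₂ S n m)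
            (fun w => x₁ w m) (fun w => x₂ w m)
          rw [← potential_congr (inputKey_insert_succ x₁ hm) (inputKey_insert_succ x₂ hm)] at h2
          linarith
  obtain ⟨S, hSn, hS, hpot⟩ := main n le_rfl
  have h1 := potential_nonpos (h0 n) (hle n) (inputKey x₁ S n n) (inputKey x₂ S n n)
  have h2 : 0 ≤ ∑ w, α n w := Finset.sum_nonneg fun w _ => h0 n w
  exact ⟨S, hS, hSn, by linarith⟩

lemma sum_sum_negMulLog_law {𝒲 K L : Type*} [Fintype 𝒲] [Fintype K] [Fintype L] (α : 𝒲 → ℝ)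
    (k : 𝒲 → K × L) : ∑ ζ, ∑ a, Real.negMulLog (law α k (ζ, a)) =
      -∑ w, α w * Real.log (law α k (k w)) := by
  rw [← entropy_eq, entropy, Fintype.sum_prod_type]

/-- The total dependence of the letter masses is the dependence given the key. -/
lemma sum_dependence_stepMass {𝒲 : Type*} [Fintype 𝒲] (α : ℕ → 𝒲 → ℝ) (x : 𝒲 → ℕ → X₁ × X₂)
    (S : Finset ℕ) (n i : ℕ) : ∑ ζ, dependence (stepMass α x S n i ζ) =
      condDependence (α i) (inputKey x S n i) (fun w => (x w i).1) (fun w => (x w i).2) := by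
  have e1 : ∀ ζ a, ∑ b, stepMass α x S n i ζ (a, b) =
      law (α i) (fun w => (inputKey x S n i w, (x w i).1)) (ζ, a) := fun ζ a => by
    rw [← sum_law_pair (α i) (fun w => (inputKey x S n i w, (x w i).1)) fun w => (x w i).2]
    exact Finset.sum_congr rfl fun b _ => law_congr fun w => by
      simp only [Prod.ext_iff]; tauto
  have e2 : ∀ ζ b, ∑ a, stepMass α x S n i ζ (a, b) =
      law (α i) (fun w => (inputKey x S n i w, (x w i).2)) (ζ, b) := fun ζ b => by
    rw [← sum_law_pair (α i) (fun w => (inputKey x S n i w, (x w i).2)) fun w => (x w i).1]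
    exact Finset.sum_congr rfl fun a _ => law_congr fun w => by
      simp only [Prod.ext_iff]; tauto
  have e3 : ∀ ζ, ∑ ξ, stepMass α x S n i ζ ξ = law (α i) (inputKey x S n i) ζ := fun ζ =>
    sum_law_pair (α i) (inputKey x S n i) (fun w => x w i) ζ
  simp only [dependence, e1, e2, e3, Finset.sum_sub_distrib, Finset.sum_add_distrib]
  rw [sum_sum_negMulLog_law, sum_sum_negMulLog_law]
  have e5 : ∑ ζ, ∑ ξ, Real.negMulLog (stepMass α x S n i ζ ξ) = -∑ w, α i w * Real.log
      (law (α i) (fun w => (inputKey x S n i w, x w i)) (inputKey x S n i w, x w i)) :=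
    sum_sum_negMulLog_law _ fun w => (inputKey x S n i w, x w i)
  have e6 : ∑ ζ, Real.negMulLog (law (α i) (inputKey x S n i) ζ) = -∑ w, α i w *
      Real.log (law (α i) (inputKey x S n i) (inputKey x S n i w)) := entropy_eq _ _
  rw [e5, e6]
  simp only [condDependence, mul_sub, mul_add, Finset.sum_sub_distrib, Finset.sum_add_distrib,
    Prod.mk.eta]
  ring

end Wringing

/-! ### Stopped codes in terms of finite sums. -/

section Bridge

variable {X₁ X₂ Y : Type*} [Fintype X₁] [Fintype X₂] [Nonempty X₁] [Nonempty X₂] [Fintype Y]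
  [Nonempty Y] [MeasurableSpace Y]

/-- A set of sequences that is determined by the first `n` letters. -/
def DependsOnFirst (n : ℕ) (E : Set (ℕ → Y)) : Prop :=
  ∀ y y' : ℕ → Y, (∀ j < n, y j = y' j) → (y ∈ E ↔ y' ∈ E)

/-- The σ-algebra of the first `n` letters lies in the pullback of the discrete one on `Fin n → Y`,
so each of its sets is a preimage under restriction. -/
lemma dependsOnFirst_of_measurableSet {n : ℕ} {E : Set (ℕ → Y)}
    (hE : MeasurableSet[outputFiltration Y n] E) : DependsOnFirst n E := by
  have hle : outputFiltration Y n ≤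
      MeasurableSpace.comap (fun (y : ℕ → Y) (j : Fin n) => y j) ⊤ := by
    refine iSup₂_le fun i hi => ?_
    rintro _ ⟨B, -, rfl⟩
    exact ⟨{u | u ⟨i, Finset.mem_range.1 hi⟩ ∈ B}, trivial, rfl⟩
  obtain ⟨T, -, rfl⟩ := hle _ hE
  intro y y' h
  have : (fun j : Fin n => y j) = fun j : Fin n => y' j := funext fun j => h j j.2
  simp only [Set.mem_preimage, this]

lemma dependsOnFirst_lt {N : (ℕ → Y) → ℕ∞} (hN : IsStoppingTime (outputFiltration Y) N) (i : ℕ) :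
    DependsOnFirst i {y | (i : ℕ∞) < N y} := by
  have h := dependsOnFirst_of_measurableSet (hN i)
  intro y y' hy
  have := not_congr (h y y' hy)
  simp only [Set.mem_ofPred_eq] at this
  exact (not_le.symm.trans this).trans not_le

/-- The sequences that extend `u`. -/
def cylinder {n : ℕ} (u : Fin n → Y) : Set (ℕ → Y) := Set.pi (Finset.range n) fun i => {ext u i}

lemma mem_cylinder {n : ℕ} {u : Fin n → Y} {y : ℕ → Y} :
    y ∈ cylinder u ↔ ∀ j < n, y j = ext u j := by
  simp [cylinder, Set.mem_pi]

open Classical in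
lemma DependsOnFirst.eq_biUnion {n : ℕ} {E : Set (ℕ → Y)} (h : DependsOnFirst n E) :
    E = ⋃ u ∈ Finset.univ.filter (fun u : Fin n → Y => ext u ∈ E), cylinder u := by
  ext y
  simp only [Finset.mem_filter, Finset.mem_univ, true_and, Set.mem_iUnion, mem_cylinder, exists_prop]
  constructor
  · intro hy
    have hu : ∀ j < n, y j = ext (fun j : Fin n => y j) j := fun j hj =>
      (ext_of_lt (fun j : Fin n => y j) hj).symm
    exact ⟨fun j => y j, (h _ _ hu).1 hy, hu⟩
  · rintro ⟨u, hu, hy⟩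
    exact (h _ _ hy).2 hu

variable [DiscreteMeasurableSpace Y]

lemma measurableSet_cylinder {n : ℕ} (u : Fin n → Y) : MeasurableSet (cylinder u) :=
  MeasurableSet.pi (Finset.countable_toSet _) fun _ _ => MeasurableSet.of_discrete

lemma DependsOnFirst.measurableSet {n : ℕ} {E : Set (ℕ → Y)} (h : DependsOnFirst n E) :
    MeasurableSet E := by
  rw [h.eq_biUnion]
  exact Finset.measurableSet_biUnion _ fun u _ => measurableSet_cylinder u

namespace VLCode

variable (c : VLCode X₁ X₂ Y) (W : X₁ → X₂ → PMF Y)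

/-- The sequence of pairs of input letters. -/
def input (w : Fin c.M₁ × Fin c.M₂) (i : ℕ) : X₁ × X₂ := (c.enc₁ w.1 i, c.enc₂ w.2 i)

instance (w₁ : Fin c.M₁) (w₂ : Fin c.M₂) : IsProbabilityMeasure (c.outputLaw W w₁ w₂) := by
  unfold outputLaw
  infer_instance

instance : Nonempty (Fin c.M₁) := ⟨⟨0, c.M₁_pos⟩⟩

instance : Nonempty (Fin c.M₂) := ⟨⟨0, c.M₂_pos⟩⟩

open Classical in
-- A set determined by `n` letters is a finite disjoint union of cylinders, whose measures are
-- products of transition probabilities.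
lemma outputLaw_real (w : Fin c.M₁ × Fin c.M₂) {n : ℕ} {E : Set (ℕ → Y)} (h : DependsOnFirst n E) :
    (c.outputLaw W w.1 w.2).real E =
      seqExp (chan W) (c.input w) n fun y => if y ∈ E then 1 else 0 := by
  have hcyl : ∀ u : Fin n → Y, (c.outputLaw W w.1 w.2).real (cylinder u) =
      ∏ i ∈ Finset.range n, chan W (c.input w i) (ext u i) := by
    intro u
    rw [measureReal_def, outputLaw, cylinder,
      Measure.infinitePi_pi _ (fun _ _ => MeasurableSet.of_discrete), ENNReal.toReal_prod]
    refine Finset.prod_congr rfl fun i _ => ?_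
    rw [PMF.toMeasure_apply_singleton _ _ MeasurableSet.of_discrete]
    rfl
  conv_lhs => rw [h.eq_biUnion]
  rw [measureReal_biUnion_finset]
  · simp only [hcyl, seqExp, mul_ite, mul_one, mul_zero, Finset.sum_filter]
  · intro u _ u' _ huu'
    refine Set.disjoint_left.2 fun y hy hy' => huu' (funext fun j => ?_)
    have h1 := mem_cylinder.1 hy j j.2
    have h2 := mem_cylinder.1 hy' j j.2
    rw [ext_of_lt _ j.2] at h1 h2
    exact h1.symm.trans h2
  · exact fun u _ => measurableSet_cylinder u

/-- The probability that the time `N` exceeds `i`, for equiprobable messages. -/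
def survival (N : (ℕ → Y) → ℕ∞) (i : ℕ) : ℝ :=
  ∑ w, eventMass (chan W) c.input (fun i y => (i : ℕ∞) < N y) i w

lemma survival_nonneg (N : (ℕ → Y) → ℕ∞) (i : ℕ) : 0 ≤ c.survival W N i :=
  Finset.sum_nonneg fun _ _ => eventMass_nonneg (isStochastic_chan W) _ _ _ _

lemma survival_eq {N : (ℕ → Y) → ℕ∞} {i : ℕ} (hN : DependsOnFirst i {y | (i : ℕ∞) < N y}) :
    c.survival W N i = (∑ w : Fin c.M₁ × Fin c.M₂,
      (c.outputLaw W w.1 w.2).real {y | (i : ℕ∞) < N y}) / (c.M₁ * c.M₂) := by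
  have hM : (Fintype.card (Fin c.M₁ × Fin c.M₂) : ℝ) = c.M₁ * c.M₂ := by simp
  simp only [survival, eventMass, hM, ← Finset.sum_div]
  congr 1
  refine Finset.sum_congr rfl fun w _ => ?_
  rw [c.outputLaw_real W _ hN]
  rfl

end VLCode

open Classical in
lemma toENNReal_eq_tsum (m : ℕ∞) :
    (m : ℝ≥0∞) = ∑' i : ℕ, if (i : ℕ∞) < m then (1 : ℝ≥0∞) else 0 := by
  induction m using ENat.recTopCoe with
  | top => simp
  | coe k =>
    rw [tsum_eq_sum (s := Finset.range k)]
    · rw [Finset.sum_congr rfl fun i hi => if_pos (Nat.cast_lt.2 (Finset.mem_range.1 hi))]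
      simp
    · exact fun i hi => if_neg fun h => hi (Finset.mem_range.2 (Nat.cast_lt.1 h))

namespace VLCode

variable (c : VLCode X₁ X₂ Y) (W : X₁ → X₂ → PMF Y)

/-- The tail-sum formula for the mean of a time with values in `ℕ∞`. -/
lemma expect_eq_tsum {N : (ℕ → Y) → ℕ∞} (hN : ∀ i : ℕ, DependsOnFirst i {y | (i : ℕ∞) < N y}) :
    c.expect W (fun y => (N y : ℝ≥0∞)) = ∑' i, ENNReal.ofReal (c.survival W N i) := by
  classical
  have hM : (c.M₁ * c.M₂ : ℝ≥0∞) ≠ 0 := by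
    simp [c.M₁_pos.ne', c.M₂_pos.ne']
  have hint : ∀ w : Fin c.M₁ × Fin c.M₂, ∫⁻ y, (N y : ℝ≥0∞) ∂(c.outputLaw W w.1 w.2) =
      ∑' i : ℕ, c.outputLaw W w.1 w.2 {y | (i : ℕ∞) < N y} := by
    intro w
    simp only [toENNReal_eq_tsum]
    have hind : ∀ i : ℕ, (fun y => if (i : ℕ∞) < N y then (1 : ℝ≥0∞) else 0) =
        Set.indicator {y | (i : ℕ∞) < N y} 1 := fun i => by
      funext y
      simp [Set.indicator_apply]
    rw [lintegral_tsum]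
    · refine tsum_congr fun i => ?_
      rw [hind, lintegral_indicator_one (hN i).measurableSet]
    · intro i
      rw [hind]
      exact (measurable_one.indicator (hN i).measurableSet).aemeasurable
  have hterm : ∀ i, ENNReal.ofReal (c.survival W N i) =
      (∑ w : Fin c.M₁ × Fin c.M₂, c.outputLaw W w.1 w.2 {y | (i : ℕ∞) < N y}) /
        (c.M₁ * c.M₂) := by
    intro i
    rw [c.survival_eq W (hN i), ENNReal.ofReal_div_of_pos
      (mul_pos (Nat.cast_pos.2 c.M₁_pos) (Nat.cast_pos.2 c.M₂_pos)),
      ENNReal.ofReal_sum_of_nonneg fun _ _ => measureReal_nonneg,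
      ENNReal.ofReal_mul (Nat.cast_nonneg _), ENNReal.ofReal_natCast, ENNReal.ofReal_natCast]
    congr 1
    exact Finset.sum_congr rfl fun w _ => ofReal_measureReal (measure_ne_top _ _)
  simp only [hterm, div_eq_mul_inv, ENNReal.tsum_mul_right, expect]
  rw [Summable.tsum_finsetSum fun _ _ => ENNReal.summable, Fintype.sum_prod_type]
  congr 1
  exact Finset.sum_congr rfl fun w₁ _ => Finset.sum_congr rfl fun w₂ _ => hint (w₁, w₂)

lemma hasSum_survival {N : (ℕ → Y) → ℕ∞} (hN : ∀ i : ℕ, DependsOnFirst i {y | (i : ℕ∞) < N y})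
    (hfin : c.expect W (fun y => (N y : ℝ≥0∞)) ≠ ∞) :
    HasSum (c.survival W N) (c.expect W fun y => (N y : ℝ≥0∞)).toReal := by
  rw [c.expect_eq_tsum W hN] at hfin ⊢
  have := (ENNReal.summable_toReal hfin).hasSum
  rw [← ENNReal.tsum_toReal_eq fun i => ENNReal.ofReal_ne_top] at this
  simpa only [ENNReal.toReal_ofReal (c.survival_nonneg W N _)] using this

lemma dependsOnFirst_min (i : ℕ) :
    DependsOnFirst i {y | (i : ℕ∞) < min (c.N₁ y) (c.N₂ y)} := by
  intro y y' h
  have h1 := dependsOnFirst_lt c.stop₁ i y y' h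
  have h2 := dependsOnFirst_lt c.stop₂ i y y' h
  simp only [Set.mem_ofPred_eq, lt_min_iff] at *
  rw [h1, h2]

/-- Both messages are correctly decoded by the time `n`. -/
def DecodedBy (n : ℕ) (w : Fin c.M₁ × Fin c.M₂) (y : ℕ → Y) : Prop :=
  c.N₁ y ≤ n ∧ c.N₂ y ≤ n ∧ DecodesTo c.N₁ c.dec₁ w.1 y ∧ DecodesTo c.N₂ c.dec₂ w.2 y

end VLCode

lemma stopped_congr {N : (ℕ → Y) → ℕ∞} (hN : ∀ i : ℕ, DependsOnFirst i {y | (i : ℕ∞) < N y})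
    {n k : ℕ} {y y' : ℕ → Y} (hy : ∀ j < n, y j = y' j) (hk : k ≤ n) (h : N y = k) : N y' = k := by
  have h1 : ∀ i : ℕ, i ≤ n → ((i : ℕ∞) < N y ↔ (i : ℕ∞) < N y') := fun i hi =>
    hN i y y' fun j hj => hy j (hj.trans_le hi)
  rw [h] at h1
  refine le_antisymm (not_lt.1 fun h' => lt_irrefl _ ((h1 k hk).2 h')) ?_
  rcases k with _ | k
  · simp
  · have := (h1 k (by omega)).1 (Nat.cast_lt.2 k.lt_succ_self)
    simpa using Order.add_one_le_of_lt this

lemma exists_eq_of_le {m : ℕ∞} {n : ℕ} (h : m ≤ n) : ∃ k : ℕ, k ≤ n ∧ m = k := by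
  lift m to ℕ using (h.trans_lt (ENat.natCast_lt_top n)).ne
  exact ⟨m, Nat.cast_le.1 h, rfl⟩

lemma decodesTo_congr {N : (ℕ → Y) → ℕ∞} (hN : ∀ i : ℕ, DependsOnFirst i {y | (i : ℕ∞) < N y})
    {M : ℕ} (g : List Y → Fin M) (w : Fin M) {n : ℕ} {y y' : ℕ → Y} (hy : ∀ j < n, y j = y' j)
    (h : N y ≤ n ∧ DecodesTo N g w y) : N y' ≤ n ∧ DecodesTo N g w y' := by
  obtain ⟨hn, k, hk, hg⟩ := h
  have hkn : k ≤ n := by rwa [hk, Nat.cast_le] at hn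
  have hk' := stopped_congr hN hy hkn hk
  refine ⟨hk'.trans_le (Nat.cast_le.2 hkn), k, hk', ?_⟩
  rw [← hg]
  congr 2
  funext j
  exact (hy j (j.2.trans_le hkn)).symm

namespace VLCode

variable (c : VLCode X₁ X₂ Y) (W : X₁ → X₂ → PMF Y)

lemma dependsOnFirst_decodedBy (n : ℕ) (w : Fin c.M₁ × Fin c.M₂) :
    DependsOnFirst n {y | c.DecodedBy n w y} := by
  have key : ∀ y y' : ℕ → Y, (∀ j < n, y j = y' j) → c.DecodedBy n w y → c.DecodedBy n w y' := by
    intro y y' hy h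
    obtain ⟨h1, h1'⟩ := decodesTo_congr (dependsOnFirst_lt c.stop₁) c.dec₁ w.1 hy ⟨h.1, h.2.2.1⟩
    obtain ⟨h2, h2'⟩ := decodesTo_congr (dependsOnFirst_lt c.stop₂) c.dec₂ w.2 hy ⟨h.2.1, h.2.2.2⟩
    exact ⟨h1, h2, h1', h2'⟩
  exact fun y y' hy => ⟨key y y' hy, key y' y fun j hj => (hy j hj).symm⟩

lemma errorProb_toReal : (c.errorProb W).toReal =
    (∑ w : Fin c.M₁ × Fin c.M₂, (c.outputLaw W w.1 w.2).real
      {y | ¬ (DecodesTo c.N₁ c.dec₁ w.1 y ∧ DecodesTo c.N₂ c.dec₂ w.2 y)}) /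
      Fintype.card (Fin c.M₁ × Fin c.M₂) := by
  rw [errorProb, ENNReal.toReal_div, Fintype.sum_prod_type, ENNReal.toReal_sum]
  · simp only [Fintype.card_prod, Fintype.card_fin, Nat.cast_mul, ENNReal.toReal_mul,
      ENNReal.toReal_natCast]
    congr 1
    refine Finset.sum_congr rfl fun w₁ _ => ?_
    rw [ENNReal.toReal_sum fun _ _ => measure_ne_top _ _]
    rfl
  · exact fun w₁ _ => (ENNReal.sum_lt_top.2 fun _ _ => measure_lt_top _ _).ne

open Classical in
-- A union bound: if decoding is not complete and correct by time `n`, then there is an error or one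
-- of the two times exceeds `n`.
lemma decodedBy_ge {n : ℕ} : 1 - (c.errorProb W).toReal - c.survival W c.N₁ n - c.survival W c.N₂ n ≤
    (∑ w, seqExp (chan W) (c.input w) n fun y => if c.DecodedBy n w y then 1 else 0) /
      Fintype.card (Fin c.M₁ × Fin c.M₂) := by
  set M : ℝ := (Fintype.card (Fin c.M₁ × Fin c.M₂) : ℝ) with hM
  have hM0 : 0 < M := Nat.cast_pos.2 Fintype.card_pos
  have h1 := dependsOnFirst_lt c.stop₁ n
  have h2 := dependsOnFirst_lt c.stop₂ n
  have hC := c.dependsOnFirst_decodedBy n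
  have hs : ∀ {N : (ℕ → Y) → ℕ∞}, DependsOnFirst n {y | (n : ℕ∞) < N y} → c.survival W N n =
      (∑ w : Fin c.M₁ × Fin c.M₂, (c.outputLaw W w.1 w.2).real {y | (n : ℕ∞) < N y}) / M := by
    intro N hN
    rw [c.survival_eq W hN, hM]
    simp
  have hG : (∑ w, seqExp (chan W) (c.input w) n fun y => if c.DecodedBy n w y then 1 else 0) =
      ∑ w : Fin c.M₁ × Fin c.M₂, (c.outputLaw W w.1 w.2).real {y | c.DecodedBy n w y} := by
    simp only [c.outputLaw_real W _ (hC _), Set.mem_ofPred_eq]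
  have hone : (1 : ℝ) = (∑ w : Fin c.M₁ × Fin c.M₂, (1 : ℝ)) / M := by
    simp only [Finset.sum_const, Finset.card_univ, nsmul_eq_mul, mul_one]
    exact (div_self hM0.ne').symm
  rw [c.errorProb_toReal W, hs h1, hs h2, hG, hone, ← sub_div, ← sub_div, ← sub_div, ← Finset.sum_sub_distrib,
    ← Finset.sum_sub_distrib, ← Finset.sum_sub_distrib]
  gcongr with w
  set μ := c.outputLaw W w.1 w.2
  have hcompl := probReal_add_probReal_compl (μ := μ) (hC w).measurableSet
  have hsub : {y | c.DecodedBy n w y}ᶜ ⊆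
      ({y | ¬ (DecodesTo c.N₁ c.dec₁ w.1 y ∧ DecodesTo c.N₂ c.dec₂ w.2 y)} ∪
        {y | (n : ℕ∞) < c.N₁ y}) ∪ {y | (n : ℕ∞) < c.N₂ y} := by
    intro y hy
    by_contra h
    simp only [Set.mem_union, Set.mem_ofPred_eq, not_or, not_not, not_lt] at h
    exact hy ⟨h.1.2, h.2, h.1.1⟩
  have hle := (measureReal_mono (μ := μ) hsub).trans (measureReal_union_le _ _)
  have hle' := measureReal_union_le (μ := μ)
    {y | ¬ (DecodesTo c.N₁ c.dec₁ w.1 y ∧ DecodesTo c.N₂ c.dec₂ w.2 y)} {y | (n : ℕ∞) < c.N₁ y}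
  linarith

end VLCode

end Bridge

/-! ### The converse applied to codes. -/

section CodeConverse

variable {X₁ X₂ Y : Type*} [Fintype X₁] [Fintype X₂] [Nonempty X₁] [Nonempty X₂] [Fintype Y]
  [Nonempty Y] [MeasurableSpace Y] [DiscreteMeasurableSpace Y]

/-- The output of the decoder `g` at the time `N`. -/
def decoded {M : ℕ} (N : (ℕ → Y) → ℕ∞) (g : List Y → Fin M) (y : ℕ → Y) : Fin M :=
  g (List.ofFn fun i : Fin (N y).toNat => y i)

lemma DecodesTo.eq_decoded {M : ℕ} {N : (ℕ → Y) → ℕ∞} {g : List Y → Fin M} {w : Fin M}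
    {y : ℕ → Y} (h : DecodesTo N g w y) : w = decoded N g y := by
  obtain ⟨n, hn, hg⟩ := h
  have : (N y).toNat = n := by simp [hn]
  subst this
  exact hg.symm

lemma decodesTo_decoded {M : ℕ} {N : (ℕ → Y) → ℕ∞} (g : List Y → Fin M) {y : ℕ → Y} {k : ℕ}
    (h : N y = k) : DecodesTo N g (decoded N g y) y := by
  have : (N y).toNat = k := by simp [h]
  subst this
  exact ⟨_, h, rfl⟩

lemma le_iff_of_dependsOnFirst {N : (ℕ → Y) → ℕ∞}
    (hN : ∀ i : ℕ, DependsOnFirst i {y | (i : ℕ∞) < N y}) (i : ℕ) (y y' : ℕ → Y)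
    (h : ∀ j < i, y j = y' j) : N y ≤ i ↔ N y' ≤ i := by
  have := hN i y y' h
  simp only [Set.mem_ofPred_eq] at this
  rw [← not_lt, this, not_lt]

lemma decoded_congr {M : ℕ} {N : (ℕ → Y) → ℕ∞}
    (hN : ∀ i : ℕ, DependsOnFirst i {y | (i : ℕ∞) < N y}) (g : List Y → Fin M) {i : ℕ}
    {y y' : ℕ → Y} (hy : ∀ j < i, y j = y' j) (h : N y ≤ i) : decoded N g y = decoded N g y' := by
  obtain ⟨k, -, hk'⟩ := exists_eq_of_le h
  exact DecodesTo.eq_decoded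
    (decodesTo_congr hN g (decoded N g y) hy ⟨h, decodesTo_decoded g hk'⟩).2

open Classical in
-- A cost `C` is charged at time `i` when `A` has ended but `B` has not, so its mean is `C` times a
-- difference of probabilities.
lemma sum_seqExp_sub {𝒲 X : Type*} [Fintype 𝒲] {V : X → Y → ℝ} (hV : IsStochastic V)
    (x : 𝒲 → ℕ → X) {A B : ℕ → (ℕ → Y) → Prop}
    [inst : ∀ i y, Decidable (B i y)] {n i : ℕ} (hi : i ≤ n)
    (hA : DependsOnFirst i {y | A i y}) (hB : DependsOnFirst i {y | B i y})
    (hAB : ∀ y, A i y → B i y) (C : ℝ) :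
    (∑ w, seqExp V (x w) n fun y => if A i y then 0 else if B i y then C else 0) /
      Fintype.card 𝒲 = C * (∑ w, eventMass V x B i w - ∑ w, eventMass V x A i w) := by
  obtain rfl : inst = fun _ _ => Classical.propDecidable _ := Subsingleton.elim _ _
  simp only [eventMass, ← Finset.sum_div]
  rw [← sub_div, mul_div_assoc', ← Finset.sum_sub_distrib, Finset.mul_sum]
  congr 1
  refine Finset.sum_congr rfl fun w _ => ?_
  have hA' : ∀ y y', (∀ j < i, y j = y' j) → (A i y ↔ A i y') := hA
  have hB' : ∀ y y', (∀ j < i, y j = y' j) → (B i y ↔ B i y') := hB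
  rw [seqExp_eq_of_le hV hi fun y y' h => by simp only [hA' y y' h, hB' y y' h]]
  have : (fun y => if A i y then 0 else if B i y then C else 0) = fun y =>
      (if B i y then (1 : ℝ) else 0) * C + (if A i y then (1 : ℝ) else 0) * -C := by
    funext y
    by_cases h : A i y
    · simp [h, hAB y h]
    · simp [h]
  rw [this, seqExp_add, seqExp_mul_const, seqExp_mul_const]
  ring

namespace VLCode

variable (c : VLCode X₁ X₂ Y) (W : X₁ → X₂ → PMF Y)

/-- The probability of correct decoding by the time `n`. -/
def successProb (n : ℕ) : ℝ := by
  classical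
  exact (∑ w, seqExp (chan W) (c.input w) n fun y => if c.DecodedBy n w y then 1 else 0) /
    Fintype.card (Fin c.M₁ × Fin c.M₂)

open Classical in
-- The index `ι` stands for the other user's message given to the decoder, so along a guess `s` does
-- not depend on the outputs. After `A` the reference is the capacity output law `q`. From time `N`
-- on it is the channel itself, which is allowed because the guess is then determined and which has
-- zero log ratio.
lemma converse_single {I T : Type*} [Fintype I] [Nonempty I] [Fintype T] (n : ℕ)
    (A : ℕ → (ℕ → Y) → Prop) (hA : ∀ i, DependsOnFirst i {y | A i y})
    (hAanti : ∀ i j y, i ≤ j → A j y → A i y) (S : Finset ℕ) (s : X₁ × X₂ → T)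
    (N : (ℕ → Y) → ℕ∞) (hN : ∀ i : ℕ, DependsOnFirst i {y | (i : ℕ∞) < N y})
    (hAN : ∀ (i : ℕ) y, A i y → (i : ℕ∞) < N y)
    (guess : I → (ℕ → Y) → Fin c.M₁ × Fin c.M₂)
    (hdec : ∀ w y, c.DecodedBy n w y → ∃ ι, w = guess ι y)
    (hs : ∀ ι i y y', s (c.input (guess ι y) i) = s (c.input (guess ι y') i))
    (hguess : ∀ ι (i : ℕ) y y', (∀ j < i, y j = y' j) → N y ≤ i → guess ι y = guess ι y')
    (q : T → Y → ℝ) (hq0 : ∀ t y, 0 ≤ q t y) (hq1 : ∀ t, ∑ y, q t y = 1)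
    (hqpos : ∀ x y, 0 < chan W x y → 0 < q (s x) y) (C : ℝ)
    (hq : ∀ x, ∑ y, chan W x y * (Real.log (chan W x y) - Real.log (q (s x) y)) ≤ C) :
    c.successProb W n * Real.log (Fintype.card (Fin c.M₁ × Fin c.M₂) / Fintype.card I)
        - Real.log 2 ≤
      ∑ i ∈ Finset.range n, ((if i ∈ S then
        (∑ w, eventMass (chan W) c.input A i w) * Real.log (Fintype.card (X₁ × X₂))
        else ∑ ζ, cmi (chan W) s (stepMass (eventMass (chan W) c.input A) c.input S n i ζ)) +
        C * (c.survival W N i - ∑ w, eventMass (chan W) c.input A i w)) := by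
  have hV := isStochastic_chan W
  have hN' : ∀ (i : ℕ) (y y' : ℕ → Y), (∀ j < i, y j = y' j) → (N y ≤ i ↔ N y' ≤ i) :=
    le_iff_of_dependsOnFirst hN
  refine (converse hV c.input n A (fun i => hA i) hAanti S s
    (fun w i y v => if N y ≤ i then chan W (c.input w i) v else q (s (c.input w i)) v)
    (fun w i y v => by split_ifs <;> [exact hV.nonneg _ _; exact hq0 _ _])
    (fun w i y => by split_ifs <;> [exact (hV.sum_eq_one _).le; exact (hq1 _).le])
    (fun w i y y' v h => by simp only [hN' i y y' h])
    (fun w i y v h => by split_ifs <;> [exact h; exact hqpos _ _ h])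
    (fun w y => c.DecodedBy n w y) (fun w => c.dependsOnFirst_decodedBy n w) guess hdec
    (fun ι i y y' _ _ => hs ι i y y') (fun ι i y y' v h _ => ?_)
    (fun i y => if (i : ℕ∞) < N y then C else 0) (fun w i y _ => ?_)).trans_eq ?_
  · by_cases h' : N y ≤ i
    · rw [if_pos h', if_pos ((hN' i y y' h).1 h'), hguess ι i y y' h h']
    · rw [if_neg h', if_neg fun h'' => h' ((hN' i y y' h).2 h''), hs ι i y y']
  · by_cases h : N y ≤ i
    · simp [h, not_lt.2 h]
    · simpa [h, not_le.1 h] using hq (c.input w i)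
  · refine Finset.sum_congr rfl fun i hi => ?_
    rw [sum_seqExp_sub hV c.input (B := fun i y => (i : ℕ∞) < N y) (Finset.mem_range.1 hi).le
      (hA i) (hN i) (hAN i)]
    rfl

open Classical in
-- Here nothing is given to the decoder. After the first of the two times, the reference is the
-- output law for the remaining user, given the input of the decoded one. After both times it is the
-- channel itself.
lemma converse_both (n : ℕ) (S : Finset ℕ) :
    c.successProb W n * Real.log (Fintype.card (Fin c.M₁ × Fin c.M₂)) - Real.log 2 ≤
      ∑ i ∈ Finset.range n, ((if i ∈ S then
        c.survival W (fun y => min (c.N₁ y) (c.N₂ y)) i * Real.log (Fintype.card (X₁ × X₂))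
        else ∑ ζ, cmi (chan W) noInfo (stepMass (eventMass (chan W) c.input
          fun i y => (i : ℕ∞) < min (c.N₁ y) (c.N₂ y)) c.input S n i ζ)) +
        (cap₁ W * (c.survival W c.N₁ i - c.survival W (fun y => min (c.N₁ y) (c.N₂ y)) i) +
        cap₂ W * (c.survival W c.N₂ i - c.survival W (fun y => min (c.N₁ y) (c.N₂ y)) i))) := by
  have hV := isStochastic_chan W
  obtain ⟨q₁, hq0, hq1, hqpos, hq⟩ := exists_output_law₁ W
  obtain ⟨q₂, hq0', hq1', hqpos', hq'⟩ := exists_output_law₂ W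
  have hN₁ := dependsOnFirst_lt c.stop₁
  have hN₂ := dependsOnFirst_lt c.stop₂
  have hmin := c.dependsOnFirst_min
  have key := converse hV c.input n (fun i y => (i : ℕ∞) < min (c.N₁ y) (c.N₂ y))
    (fun i => hmin i) (fun i j y hij h => lt_of_le_of_lt (Nat.cast_le.2 hij) h) S
    (noInfo : X₁ × X₂ → Unit)
    (fun w i y v => if c.N₁ y ≤ i then
        (if c.N₂ y ≤ i then chan W (c.input w i) v else q₂ (c.enc₁ w.1 i) v)
      else q₁ (c.enc₂ w.2 i) v)
    (fun w i y v => by split_ifs <;> [exact hV.nonneg _ _; exact hq0' _ _; exact hq0 _ _])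
    (fun w i y => by
      split_ifs <;> [exact (hV.sum_eq_one _).le; exact (hq1' _).le; exact (hq1 _).le])
    (fun w i y y' v h => by simp only [le_iff_of_dependsOnFirst hN₁ i y y' h, le_iff_of_dependsOnFirst hN₂ i y y' h])
    (fun w i y v h => by
      split_ifs <;> [exact h; exact hqpos' _ _ h; exact hqpos _ _ h])
    (fun w y => c.DecodedBy n w y) (fun w => c.dependsOnFirst_decodedBy n w)
    (fun (_ : Unit) y => (decoded c.N₁ c.dec₁ y, decoded c.N₂ c.dec₂ y))
    (fun w y h => ⟨(), Prod.ext h.2.2.1.eq_decoded h.2.2.2.eq_decoded⟩)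
    (fun _ _ _ _ _ _ => rfl) (fun _ i y y' v h hA => ?_)
    (fun i y => (if (i : ℕ∞) < c.N₁ y then cap₁ W else 0) +
      if (i : ℕ∞) < c.N₂ y then cap₂ W else 0) (fun w i y hA => ?_)
  · rw [Fintype.card_unit, Nat.cast_one, div_one] at key
    refine key.trans_eq (Finset.sum_congr rfl fun i hi => ?_)
    have h1 := sum_seqExp_sub hV c.input (A := fun i y => (i : ℕ∞) < min (c.N₁ y) (c.N₂ y))
      (B := fun i y => (i : ℕ∞) < c.N₁ y) (Finset.mem_range.1 hi).le (hmin i) (hN₁ i)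
      (fun y h => (lt_min_iff.1 h).1) (cap₁ W)
    have h2 := sum_seqExp_sub hV c.input (A := fun i y => (i : ℕ∞) < min (c.N₁ y) (c.N₂ y))
      (B := fun i y => (i : ℕ∞) < c.N₂ y) (Finset.mem_range.1 hi).le (hmin i) (hN₂ i)
      (fun y h => (lt_min_iff.1 h).2) (cap₂ W)
    unfold survival
    rw [← h1, ← h2, ← add_div, ← Finset.sum_add_distrib]
    congr 2
    refine Finset.sum_congr rfl fun w _ => ?_
    rw [← seqExp_add]
    congr 1
    funext y
    split_ifs <;> simp
  -- Causality of `θ` along the guess: in each branch only messages already decoded by time `i`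
  -- enter, and these are functions of the first `i` letters. Since `A i` fails, there is at least
  -- one of them.
  · dsimp only
    rw [lt_min_iff, not_and_or, not_lt, not_lt] at hA
    by_cases h1 : c.N₁ y ≤ i
    · rw [if_pos h1, if_pos ((le_iff_of_dependsOnFirst hN₁ i y y' h).1 h1), decoded_congr hN₁ c.dec₁ h h1]
      by_cases h2 : c.N₂ y ≤ i
      · rw [if_pos h2, if_pos ((le_iff_of_dependsOnFirst hN₂ i y y' h).1 h2), decoded_congr hN₂ c.dec₂ h h2]
      · rw [if_neg h2, if_neg fun h'' => h2 ((le_iff_of_dependsOnFirst hN₂ i y y' h).2 h'')]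
    · rw [if_neg h1, if_neg fun h'' => h1 ((le_iff_of_dependsOnFirst hN₁ i y y' h).2 h''),
        decoded_congr hN₂ c.dec₂ h (hA.resolve_left h1)]
  · rw [lt_min_iff, not_and_or, not_lt, not_lt] at hA
    by_cases h1 : c.N₁ y ≤ i
    · by_cases h2 : c.N₂ y ≤ i
      · simp [h1, h2, not_lt.2 h1, not_lt.2 h2]
      · simpa [input, h1, h2, not_le.1 h2, not_lt.2 h1] using hq' (c.enc₁ w.1 i, c.enc₂ w.2 i)
    · have h2 := hA.resolve_left h1
      simpa [input, h1, not_le.1 h1, not_lt.2 h2] using hq (c.enc₁ w.1 i, c.enc₂ w.2 i)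

end VLCode

end CodeConverse

/-! ### Estimates for one code and a finite horizon. -/

section CodeBounds

variable {X₁ X₂ Y : Type*} [Fintype X₁] [Fintype X₂] [Nonempty X₁] [Nonempty X₂] [Fintype Y]
  [Nonempty Y] [MeasurableSpace Y] [DiscreteMeasurableSpace Y]

lemma eventMass_succ_le {𝒲 X : Type*} [Fintype 𝒲] {V : X → Y → ℝ} (hV : IsStochastic V)
    (x : 𝒲 → ℕ → X) {A : ℕ → (ℕ → Y) → Prop} (hA : ∀ i, DependsOnFirst i {y | A i y})
    (hAanti : ∀ i j y, i ≤ j → A j y → A i y) (i : ℕ) (w : 𝒲) :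
    eventMass V x A (i + 1) w ≤ eventMass V x A i w := by
  classical
  have hA' : ∀ y y', (∀ j < i, y j = y' j) → (A i y ↔ A i y') := hA i
  unfold eventMass
  gcongr
  rw [← seqExp_eq_of_le hV (Nat.le_succ i) fun y y' h => by simp only [hA' y y' h]]
  refine seqExp_mono hV fun y => ?_
  by_cases h : A (i + 1) y
  · rw [if_pos h, if_pos (hAanti _ _ _ (Nat.le_succ i) h)]
  · rw [if_neg h]
    split_ifs <;> simp

lemma eventMass_zero {𝒲 X : Type*} [Fintype 𝒲] {V : X → Y → ℝ} (hV : IsStochastic V)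
    (x : 𝒲 → ℕ → X) {A : ℕ → (ℕ → Y) → Prop} (hA : ∀ y, A 0 y) (w : 𝒲) :
    eventMass V x A 0 w = 1 / Fintype.card 𝒲 := by
  simp only [eventMass, hA, if_true, seqExp_const hV]

lemma cmi_stepMass_of_eq_zero {𝒲 X T : Type*} [Fintype 𝒲] [Fintype X] [Nonempty X] [Fintype T]
    {V : X → Y → ℝ} (hV : IsStochastic V) (s : X → T) {α : ℕ → 𝒲 → ℝ} {i : ℕ}
    (hα : ∀ w, α i w = 0) (x : 𝒲 → ℕ → X) (S : Finset ℕ) (n : ℕ) (ζ : Fin n → X) :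
    cmi V s (stepMass α x S n i ζ) = 0 := by
  have : stepMass α x S n i ζ = fun ξ => (0 : ℝ) * (fun _ => (0 : ℝ)) ξ := by
    funext ξ
    simp [stepMass, law, hα]
  rw [this, cmi_smul hV, zero_mul]

lemma sum_stepMass {𝒲 X : Type*} [Fintype 𝒲] [Fintype X] [Nonempty X] (α : ℕ → 𝒲 → ℝ)
    (x : 𝒲 → ℕ → X) (S : Finset ℕ) (n i : ℕ) :
    ∑ ζ, ∑ ξ, stepMass α x S n i ζ ξ = ∑ w, α i w := by
  rw [← sum_law (α i) fun w => (inputKey x S n i w, x w i), Fintype.sum_prod_type]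
  rfl

/-- The information of the letters outside a wringing set, in terms of product laws. -/
lemma sum_step_le {𝒲 T : Type*} [Fintype 𝒲] [Nonempty 𝒲] [Fintype T] {V : X₁ × X₂ → Y → ℝ}
    (hV : IsStochastic V) (s : X₁ × X₂ → T) {η K δ : ℝ} (hK0 : 0 ≤ K) (hδ : 0 < δ)
    (hK : ∀ a : X₁ × X₂ → ℝ, (∀ x, 0 ≤ a x) →
      cmi V s a ≤ (∑ x, a x) * cmi V s (prodMarginals a) + η * ∑ x, a x + K * dependence a)
    (hKδ : K * δ ≤ η) (α : ℕ → 𝒲 → ℝ) (hα : ∀ i w, 0 ≤ α i w) (x : 𝒲 → ℕ → X₁ × X₂)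
    {n : ℕ} {S : Finset ℕ} [DecidablePred (· ∈ S)] (hSn : S ⊆ Finset.range n)
    (hS : ∀ i < n, i ∉ S → condDependence (α i) (inputKey x S n i) (fun w => (x w i).1)
      (fun w => (x w i).2) ≤ δ * ∑ w, α i w) (hδS : δ * ∑ i ∈ S, ∑ w, α i w ≤ 1) :
    ∑ i ∈ Finset.range n, (if i ∈ S then (∑ w, α i w) * Real.log (Fintype.card (X₁ × X₂))
      else ∑ ζ, cmi V s (stepMass α x S n i ζ)) ≤
      ∑ i ∈ Finset.range n, ∑ ζ, (∑ ξ, stepMass α x S n i ζ ξ) *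
        cmi V s (prodMarginals (stepMass α x S n i ζ)) +
      2 * η * ∑ i ∈ Finset.range n, ∑ w, α i w + Real.log (Fintype.card (X₁ × X₂)) / δ := by
  have hstep : ∀ i ζ ξ, 0 ≤ stepMass α x S n i ζ ξ := fun i ζ ξ => law_nonneg (hα i) _ _
  have hη : 0 ≤ η := le_trans (mul_nonneg hK0 hδ.le) hKδ
  have hlog : 0 ≤ Real.log (Fintype.card (X₁ × X₂)) := Real.log_natCast_nonneg _
  have hαs : ∀ i, 0 ≤ ∑ w, α i w := fun i => Finset.sum_nonneg fun w _ => hα i w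
  have hnn : ∀ i, 0 ≤ ∑ ζ, (∑ ξ, stepMass α x S n i ζ ξ) *
      cmi V s (prodMarginals (stepMass α x S n i ζ)) := fun i =>
    Finset.sum_nonneg fun ζ _ => mul_nonneg (Finset.sum_nonneg fun ξ _ => hstep _ _ _)
      (cmi_nonneg hV s fun ξ => prodMass_nonneg _ _ ξ)
  -- Outside `S` the dependence term is at most `K * δ ≤ η` per unit of mass, and together with the
  -- `η` of `hK` this gives `2 * η`. Inside `S` only the cost of revealing remains, and the revealed
  -- mass is at most `1 / δ` in total.
  have hterm : ∀ i ∈ Finset.range n,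
      (if i ∈ S then (∑ w, α i w) * Real.log (Fintype.card (X₁ × X₂))
        else ∑ ζ, cmi V s (stepMass α x S n i ζ)) ≤
      ∑ ζ, (∑ ξ, stepMass α x S n i ζ ξ) * cmi V s (prodMarginals (stepMass α x S n i ζ)) +
        2 * η * ∑ w, α i w +
        (if i ∈ S then ∑ w, α i w else 0) * Real.log (Fintype.card (X₁ × X₂)) := by
    intro i hi
    split_ifs with h
    · have := mul_nonneg hη (hαs i)
      linarith [hnn i]
    · have h1 : ∑ ζ, cmi V s (stepMass α x S n i ζ) ≤ ∑ ζ, ((∑ ξ, stepMass α x S n i ζ ξ) *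
          cmi V s (prodMarginals (stepMass α x S n i ζ)) + η * ∑ ξ, stepMass α x S n i ζ ξ +
          K * dependence (stepMass α x S n i ζ)) :=
        Finset.sum_le_sum fun ζ _ => hK _ (hstep i ζ)
      rw [Finset.sum_add_distrib, Finset.sum_add_distrib, ← Finset.mul_sum, ← Finset.mul_sum,
        sum_stepMass, sum_dependence_stepMass] at h1
      have h2 := mul_le_mul_of_nonneg_left (hS i (Finset.mem_range.1 hi) h) hK0
      have h3 := mul_le_mul_of_nonneg_right hKδ (hαs i)
      linarith
  refine (Finset.sum_le_sum hterm).trans ?_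
  rw [Finset.sum_add_distrib, Finset.sum_add_distrib, ← Finset.mul_sum, ← Finset.sum_mul,
    ← Finset.sum_filter, Finset.filter_mem_eq_inter, Finset.inter_eq_right.2 hSn]
  gcongr
  rw [div_eq_inv_mul]
  refine mul_le_mul_of_nonneg_right ?_ hlog
  rw [inv_eq_one_div, le_div_iff₀ hδ]
  linarith

namespace VLCode

variable (c : VLCode X₁ X₂ Y) (W : X₁ → X₂ → PMF Y)

open Classical in
lemma converse₁ (n : ℕ) (A : ℕ → (ℕ → Y) → Prop) (hA : ∀ i, DependsOnFirst i {y | A i y})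
    (hAanti : ∀ i j y, i ≤ j → A j y → A i y) (hAN : ∀ (i : ℕ) y, A i y → (i : ℕ∞) < c.N₁ y)
    (S : Finset ℕ) : c.successProb W n * Real.log c.M₁ - Real.log 2 ≤
      ∑ i ∈ Finset.range n, ((if i ∈ S then
        (∑ w, eventMass (chan W) c.input A i w) * Real.log (Fintype.card (X₁ × X₂))
        else ∑ ζ, cmi (chan W) Prod.snd
          (stepMass (eventMass (chan W) c.input A) c.input S n i ζ)) +
        cap₁ W * (c.survival W c.N₁ i - ∑ w, eventMass (chan W) c.input A i w)) := by
  obtain ⟨q, hq0, hq1, hqpos, hq⟩ := exists_output_law₁ W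
  have hN := dependsOnFirst_lt c.stop₁
  have key := c.converse_single W n A hA hAanti S Prod.snd c.N₁ hN hAN
    (fun (v : Fin c.M₂) y => (decoded c.N₁ c.dec₁ y, v))
    (fun w y h => ⟨w.2, Prod.ext h.2.2.1.eq_decoded rfl⟩) (fun _ _ _ _ => rfl)
    (fun v i y y' h hi => by rw [decoded_congr hN c.dec₁ h hi]) q hq0 hq1 hqpos (cap₁ W) hq
  have hcard : (Fintype.card (Fin c.M₁ × Fin c.M₂) : ℝ) / Fintype.card (Fin c.M₂) = c.M₁ := by
    have : (c.M₂ : ℝ) ≠ 0 := Nat.cast_ne_zero.2 c.M₂_pos.ne'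
    simp [this]
  rwa [hcard] at key

open Classical in
lemma converse₂ (n : ℕ) (A : ℕ → (ℕ → Y) → Prop) (hA : ∀ i, DependsOnFirst i {y | A i y})
    (hAanti : ∀ i j y, i ≤ j → A j y → A i y) (hAN : ∀ (i : ℕ) y, A i y → (i : ℕ∞) < c.N₂ y)
    (S : Finset ℕ) : c.successProb W n * Real.log c.M₂ - Real.log 2 ≤
      ∑ i ∈ Finset.range n, ((if i ∈ S then
        (∑ w, eventMass (chan W) c.input A i w) * Real.log (Fintype.card (X₁ × X₂))
        else ∑ ζ, cmi (chan W) Prod.fst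
          (stepMass (eventMass (chan W) c.input A) c.input S n i ζ)) +
        cap₂ W * (c.survival W c.N₂ i - ∑ w, eventMass (chan W) c.input A i w)) := by
  obtain ⟨q, hq0, hq1, hqpos, hq⟩ := exists_output_law₂ W
  have hN := dependsOnFirst_lt c.stop₂
  have key := c.converse_single W n A hA hAanti S Prod.fst c.N₂ hN hAN
    (fun (v : Fin c.M₁) y => (v, decoded c.N₂ c.dec₂ y))
    (fun w y h => ⟨w.1, Prod.ext rfl h.2.2.2.eq_decoded⟩) (fun _ _ _ _ => rfl)
    (fun v i y y' h hi => by rw [decoded_congr hN c.dec₂ h hi]) q hq0 hq1 hqpos (cap₂ W) hq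
  have hcard : (Fintype.card (Fin c.M₁ × Fin c.M₂) : ℝ) / Fintype.card (Fin c.M₁) = c.M₂ := by
    have : (c.M₁ : ℝ) ≠ 0 := Nat.cast_ne_zero.2 c.M₁_pos.ne'
    simp [this]
  rwa [hcard] at key

lemma sum_survival_le {N : (ℕ → Y) → ℕ∞} (hN : ∀ i : ℕ, DependsOnFirst i {y | (i : ℕ∞) < N y})
    (hfin : c.expect W (fun y => (N y : ℝ≥0∞)) ≠ ∞) (n : ℕ) :
    ∑ i ∈ Finset.range n, c.survival W N i ≤ (c.expect W fun y => (N y : ℝ≥0∞)).toReal :=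
  sum_le_hasSum _ (fun i _ => c.survival_nonneg W N i) (c.hasSum_survival W hN hfin)

lemma eventMass_false (i : ℕ) (w : Fin c.M₁ × Fin c.M₂) :
    eventMass (chan W) c.input (fun _ _ => False) i w = 0 := by
  simp [eventMass, seqExp_const (isStochastic_chan W)]

/-- With `A` never true and nothing revealed, the converse becomes the single-user bound: every
letter up to `N₁` conveys at most `cap₁ W`. -/
lemma log_M₁_le (hfin : c.meanN₁ W ≠ ∞) (n : ℕ) :
    c.successProb W n * Real.log c.M₁ ≤ Real.log 2 + cap₁ W * (c.meanN₁ W).toReal := by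
  classical
  have h := c.converse₁ W n (fun _ _ => False) (fun _ _ _ _ => Iff.rfl) (fun _ _ _ _ h => h)
    (fun _ _ h => h.elim) ∅
  simp only [Finset.notMem_empty, if_false, c.eventMass_false W, Finset.sum_const_zero, sub_zero,
    cmi_stepMass_of_eq_zero (isStochastic_chan W) Prod.snd (c.eventMass_false W _), zero_add,
    ← Finset.mul_sum] at h
  have := mul_le_mul_of_nonneg_left
    (c.sum_survival_le W (dependsOnFirst_lt c.stop₁) hfin n) (cap₁_nonneg W)
  rw [meanN₁]
  linarith

lemma log_M₂_le (hfin : c.meanN₂ W ≠ ∞) (n : ℕ) :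
    c.successProb W n * Real.log c.M₂ ≤ Real.log 2 + cap₂ W * (c.meanN₂ W).toReal := by
  classical
  have h := c.converse₂ W n (fun _ _ => False) (fun _ _ _ _ => Iff.rfl) (fun _ _ _ _ h => h)
    (fun _ _ h => h.elim) ∅
  simp only [Finset.notMem_empty, if_false, c.eventMass_false W, Finset.sum_const_zero, sub_zero,
    cmi_stepMass_of_eq_zero (isStochastic_chan W) Prod.fst (c.eventMass_false W _), zero_add,
    ← Finset.mul_sum] at h
  have := mul_le_mul_of_nonneg_left
    (c.sum_survival_le W (dependsOnFirst_lt c.stop₂) hfin n) (cap₂_nonneg W)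
  rw [meanN₂]
  linarith

lemma expect_mono {f g : (ℕ → Y) → ℝ≥0∞} (h : ∀ y, f y ≤ g y) : c.expect W f ≤ c.expect W g := by
  unfold expect
  gcongr with w₁ _ w₂ _ y
  exact h y

lemma expect_zero : c.expect W (fun _ => 0) = 0 := by
  simp [expect]

/-- Whether `N > 0` is decided before any letter is received, so `N` vanishes either everywhere or
nowhere. -/
lemma pos_of_expect_pos {N : (ℕ → Y) → ℕ∞}
    (hN : ∀ i : ℕ, DependsOnFirst i {y | (i : ℕ∞) < N y})
    (hpos : 0 < c.expect W fun y => (N y : ℝ≥0∞)) (y : ℕ → Y) : 0 < N y := by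
  by_contra h
  refine hpos.ne' ?_
  have h0 : ∀ y', N y' = 0 := fun y' => by
    have := hN 0 y y' (by simp)
    simp only [Set.mem_ofPred_eq, Nat.cast_zero] at this
    exact nonpos_iff_eq_zero.1 (not_lt.1 fun h' => h (this.2 h'))
  simp only [h0]
  simpa using c.expect_zero W

lemma meanN_le₁ : c.meanN W ≤ c.meanN₁ W :=
  c.expect_mono W fun _ => ENat.toENNReal_le.2 (min_le_left _ _)

lemma meanN_le₂ : c.meanN W ≤ c.meanN₂ W :=
  c.expect_mono W fun _ => ENat.toENNReal_le.2 (min_le_right _ _)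

end VLCode

end CodeBounds

/-! ### From a code to a point of the block region. -/

section CodeRegion

variable {X₁ X₂ Y : Type*} [Fintype X₁] [Fintype X₂] [Nonempty X₁] [Nonempty X₂] [Fintype Y]
  [Nonempty Y] [MeasurableSpace Y] [DiscreteMeasurableSpace Y]

namespace VLCode

variable (c : VLCode X₁ X₂ Y) (W : X₁ → X₂ → PMF Y)

lemma survival_min_zero (h₁ : 0 < c.meanN₁ W) (h₂ : 0 < c.meanN₂ W) (w : Fin c.M₁ × Fin c.M₂) :
    eventMass (chan W) c.input (fun i y => (i : ℕ∞) < min (c.N₁ y) (c.N₂ y)) 0 w =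
      1 / Fintype.card (Fin c.M₁ × Fin c.M₂) :=
  eventMass_zero (isStochastic_chan W) c.input (fun y => by
    simp only [Nat.cast_zero, lt_min_iff]
    exact ⟨c.pos_of_expect_pos W (dependsOnFirst_lt c.stop₁) h₁ y,
      c.pos_of_expect_pos W (dependsOnFirst_lt c.stop₂) h₂ y⟩) w

lemma survival_min_zero_eq_one (h₁ : 0 < c.meanN₁ W) (h₂ : 0 < c.meanN₂ W) :
    c.survival W (fun y => min (c.N₁ y) (c.N₂ y)) 0 = 1 := by
  simp only [survival, c.survival_min_zero W h₁ h₂, Finset.sum_const, Finset.card_univ,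
    nsmul_eq_mul]
  exact mul_one_div_cancel (Nat.cast_ne_zero.2 Fintype.card_ne_zero)

lemma one_le_meanN (hfin : c.FiniteMean W) (h₁ : 0 < c.meanN₁ W) (h₂ : 0 < c.meanN₂ W) :
    1 ≤ (c.meanN W).toReal := by
  have h := c.sum_survival_le W c.dependsOnFirst_min (ne_top_of_le_ne_top hfin.1 (c.meanN_le₁ W)) 1
  rw [Finset.sum_range_one, c.survival_min_zero_eq_one W h₁ h₂] at h
  exact h

lemma sum_survival_sub_le {N : (ℕ → Y) → ℕ∞}
    (hN : ∀ i : ℕ, DependsOnFirst i {y | (i : ℕ∞) < N y})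
    (hle : ∀ y, min (c.N₁ y) (c.N₂ y) ≤ N y) (hfin : c.expect W (fun y => (N y : ℝ≥0∞)) ≠ ∞)
    (n : ℕ) : ∑ i ∈ Finset.range n,
      (c.survival W N i - c.survival W (fun y => min (c.N₁ y) (c.N₂ y)) i) ≤
      (c.expect W fun y => (N y : ℝ≥0∞)).toReal - (c.meanN W).toReal := by
  classical
  have hmin : c.expect W (fun y => ((min (c.N₁ y) (c.N₂ y) : ℕ∞) : ℝ≥0∞)) ≠ ∞ :=
    ne_top_of_le_ne_top hfin (c.expect_mono W fun y => ENat.toENNReal_le.2 (hle y))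
  refine sum_le_hasSum _ (fun i _ => sub_nonneg.2 ?_)
    ((c.hasSum_survival W hN hfin).sub (c.hasSum_survival W c.dependsOnFirst_min hmin))
  refine Finset.sum_le_sum fun w _ => ?_
  unfold eventMass
  gcongr
  refine seqExp_mono (isStochastic_chan W) fun y => ?_
  by_cases h : (i : ℕ∞) < min (c.N₁ y) (c.N₂ y)
  · rw [if_pos h, if_pos (h.trans_le (hle y))]
  · rw [if_neg h]
    split_ifs <;> simp

/-- A code yields a point of the block-code region. -/
lemma mem_blockRegion (hfin : c.FiniteMean W) (h₁ : 0 < c.meanN₁ W) (h₂ : 0 < c.meanN₂ W)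
    {n : ℕ} (hn : 0 < n) {δ η K₁ K₂ K₁₂ : ℝ} (hδ : 0 < δ)
    (hK₁0 : 0 ≤ K₁) (hK₂0 : 0 ≤ K₂) (hK₁₂0 : 0 ≤ K₁₂)
    (hK₁ : ∀ a : X₁ × X₂ → ℝ, (∀ x, 0 ≤ a x) → cmi (chan W) Prod.snd a ≤
      (∑ x, a x) * cmi (chan W) Prod.snd (prodMarginals a) + η * ∑ x, a x + K₁ * dependence a)
    (hK₂ : ∀ a : X₁ × X₂ → ℝ, (∀ x, 0 ≤ a x) → cmi (chan W) Prod.fst a ≤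
      (∑ x, a x) * cmi (chan W) Prod.fst (prodMarginals a) + η * ∑ x, a x + K₂ * dependence a)
    (hK₁₂ : ∀ a : X₁ × X₂ → ℝ, (∀ x, 0 ≤ a x) → cmi (chan W) noInfo a ≤
      (∑ x, a x) * cmi (chan W) noInfo (prodMarginals a) + η * ∑ x, a x + K₁₂ * dependence a)
    (hK₁δ : K₁ * δ ≤ η) (hK₂δ : K₂ * δ ≤ η) (hK₁₂δ : K₁₂ * δ ≤ η) {b₁ b₂ : ℝ}
    (hb₁ : (c.meanN W).toReal * (b₁ + 2 * η) + Real.log (Fintype.card (X₁ × X₂)) / δ + Real.log 2 +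
      cap₁ W * ((c.meanN₁ W).toReal - (c.meanN W).toReal) ≤ c.successProb W n * Real.log c.M₁)
    (hb₂ : (c.meanN W).toReal * (b₂ + 2 * η) + Real.log (Fintype.card (X₁ × X₂)) / δ + Real.log 2 +
      cap₂ W * ((c.meanN₂ W).toReal - (c.meanN W).toReal) ≤ c.successProb W n * Real.log c.M₂)
    (hb₁₂ : (c.meanN W).toReal * (b₁ + b₂ + 2 * η) + Real.log (Fintype.card (X₁ × X₂)) / δ +
      Real.log 2 + cap₁ W * ((c.meanN₁ W).toReal - (c.meanN W).toReal) +
      cap₂ W * ((c.meanN₂ W).toReal - (c.meanN W).toReal) ≤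
      c.successProb W n * (Real.log c.M₁ + Real.log c.M₂)) :
    (b₁, b₂) ∈ blockRegion W := by
  classical
  have hV := isStochastic_chan W
  set A : ℕ → (ℕ → Y) → Prop := fun i y => (i : ℕ∞) < min (c.N₁ y) (c.N₂ y) with hA
  set α : ℕ → Fin c.M₁ × Fin c.M₂ → ℝ := eventMass (chan W) c.input A with hα
  have hAdep : ∀ i, DependsOnFirst i {y | A i y} := c.dependsOnFirst_min
  have hAanti : ∀ i j y, i ≤ j → A j y → A i y := fun i j y hij h =>
    lt_of_le_of_lt (Nat.cast_le.2 hij) h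
  have hα0 : ∀ i w, 0 ≤ α i w := eventMass_nonneg hV _ _
  set E := (c.meanN W).toReal with hE
  set p : ℕ → ℝ := fun i => ∑ w, α i w with hp
  set T := ∑ i ∈ Finset.range n, p i with hT
  have hη : 0 ≤ η := le_trans (mul_nonneg hK₁0 hδ.le) hK₁δ
  have hTE : T ≤ E := c.sum_survival_le W c.dependsOnFirst_min
    (ne_top_of_le_ne_top hfin.1 (c.meanN_le₁ W)) n
  have hT0 : 0 < T := by
    refine lt_of_lt_of_le one_pos ?_
    rw [← c.survival_min_zero_eq_one W h₁ h₂]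
    exact Finset.single_le_sum (f := p) (fun i _ => Finset.sum_nonneg fun w _ => hα0 i w)
      (Finset.mem_range.2 hn)
  -- Both times are positive, so at time zero the surviving mass is the full uniform product law, as
  -- wringing requires.
  obtain ⟨S, hS, hSn, hδS⟩ := exists_wringing_set c.enc₁ c.enc₂ α hα0
    (fun i w => eventMass_succ_le hV c.input hAdep hAanti i w)
    (fun w => (c.survival_min_zero W h₁ h₂ w).trans (by
      simp only [unif, Fintype.card_prod, Nat.cast_mul]
      rw [one_div_mul_one_div])) (δ := δ) n
  have hS' : ∀ i < n, i ∉ S → condDependence (α i) (inputKey c.input S n i)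
      (fun w => (c.input w i).1) (fun w => (c.input w i).2) ≤ δ * p i := by
    -- Wringing works with a pair of keys, the converse with a key of pairs. They separate the
    -- messages in the same way.
    intro i hi hiS
    refine le_trans (le_of_eq ?_) (hS i hi hiS)
    refine condDependence_congr (α i) (fun w w' => ?_) _ _
    simp only [Prod.mk.injEq, funext_iff, inputKey, input]
    constructor
    · intro h
      refine ⟨fun j => ?_, fun j => ?_⟩ <;> have := h j <;> split_ifs at this ⊢ <;> simp_all
    · rintro ⟨h, h'⟩ j
      have h1 := h j
      have h2 := h' j
      split_ifs at h1 h2 ⊢ <;> simp_all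
  have hstep : ∀ i ζ ξ, 0 ≤ stepMass α c.input S n i ζ ξ := fun i ζ ξ => law_nonneg (hα0 i) _ _
  -- The time-sharing variable is the time together with the revealed letters, weighted by its share
  -- of the mass before `N`.
  set l : Fin n × (Fin n → X₁ × X₂) → ℝ := fun i =>
    (∑ ξ, stepMass α c.input S n i.1 i.2 ξ) / T with hl
  have hl0 : ∀ i, 0 ≤ l i := fun i =>
    div_nonneg (Finset.sum_nonneg fun ξ _ => hstep _ _ _) hT0.le
  have hlsum : ∑ i, l i = 1 := by
    rw [Fintype.sum_prod_type]
    simp only [hl, ← Finset.sum_div, sum_stepMass]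
    rw [Fin.sum_univ_eq_sum_range (fun i => ∑ w, α i w) n]
    exact div_self hT0.ne'
  have havg : ∀ f : ℕ → (Fin n → X₁ × X₂) → ℝ,
      ∑ i ∈ Finset.range n, ∑ ζ, (∑ ξ, stepMass α c.input S n i ζ ξ) * f i ζ =
      T * ∑ i, l i * f i.1 i.2 := by
    intro f
    rw [Finset.mul_sum, Fintype.sum_prod_type, ← Fin.sum_univ_eq_sum_range (fun i => ∑ ζ, (∑ ξ,
      stepMass α c.input S n i ζ ξ) * f i ζ) n]
    refine Finset.sum_congr rfl fun i _ => Finset.sum_congr rfl fun ζ _ => ?_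
    simp only [hl]
    field_simp
  have hE0 : 0 < E := hT0.trans_le hTE
  -- The horizon `n` makes `T` smaller than `E`. This is harmless because `T` multiplies nonnegative
  -- quantities on the right.
  have hfinish : ∀ {b I : ℝ}, 0 ≤ I → E * (b + 2 * η) ≤ T * I + 2 * η * T → b ≤ I := by
    intro b I hI h
    have h3 := mul_le_mul_of_nonneg_right hTE hI
    have h4 := mul_le_mul_of_nonneg_left hTE hη
    exact le_of_mul_le_mul_left (by linarith) hE0
  have hd₁ := mul_le_mul_of_nonneg_left (c.sum_survival_sub_le W (dependsOnFirst_lt c.stop₁)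
    (fun _ => min_le_left _ _) hfin.1 n) (cap₁_nonneg W)
  have hd₂ := mul_le_mul_of_nonneg_left (c.sum_survival_sub_le W (dependsOnFirst_lt c.stop₂)
    (fun _ => min_le_right _ _) hfin.2 n) (cap₂_nonneg W)
  rw [Finset.mul_sum] at hd₁ hd₂
  refine mem_blockRegion_of_average W hl0 hlsum
    (fun i => normalize fun x₁ => ∑ x₂, stepMass α c.input S n i.1 i.2 (x₁, x₂))
    (fun i => normalize fun x₂ => ∑ x₁, stepMass α c.input S n i.1 i.2 (x₁, x₂)) ?_ ?_ ?_
  · refine hfinish (Finset.sum_nonneg fun i _ => mul_nonneg (hl0 i)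
      (cmi_nonneg hV _ fun ξ => prodMass_nonneg _ _ ξ)) ?_
    have h := c.converse₁ W n A hAdep hAanti (fun i y h => (lt_min_iff.1 h).1) S
    rw [Finset.sum_add_distrib] at h
    have h' := sum_step_le hV Prod.snd hK₁0 hδ hK₁ hK₁δ α hα0 c.input hSn hS' hδS
    rw [havg fun i ζ => cmi (chan W) Prod.snd (prodMarginals (stepMass α c.input S n i ζ))] at h'
    have hd : ∑ i ∈ Finset.range n, cap₁ W * (c.survival W c.N₁ i - ∑ w, eventMass (chan W) c.input A i w)
      ≤ cap₁ W * ((c.meanN₁ W).toReal - E) := hd₁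
    have h'' := h.trans (add_le_add h' hd)
    simp only [prodMarginals] at h''
    linarith
  · refine hfinish (Finset.sum_nonneg fun i _ => mul_nonneg (hl0 i)
      (cmi_nonneg hV _ fun ξ => prodMass_nonneg _ _ ξ)) ?_
    have h := c.converse₂ W n A hAdep hAanti (fun i y h => (lt_min_iff.1 h).2) S
    rw [Finset.sum_add_distrib] at h
    have h' := sum_step_le hV Prod.fst hK₂0 hδ hK₂ hK₂δ α hα0 c.input hSn hS' hδS
    rw [havg fun i ζ => cmi (chan W) Prod.fst (prodMarginals (stepMass α c.input S n i ζ))] at h'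
    have hd : ∑ i ∈ Finset.range n, cap₂ W * (c.survival W c.N₂ i - ∑ w, eventMass (chan W) c.input A i w)
      ≤ cap₂ W * ((c.meanN₂ W).toReal - E) := hd₂
    have h'' := h.trans (add_le_add h' hd)
    simp only [prodMarginals] at h''
    linarith
  · refine hfinish (Finset.sum_nonneg fun i _ => mul_nonneg (hl0 i)
      (mi_nonneg hV fun ξ => prodMass_nonneg _ _ ξ)) ?_
    have h := c.converse_both W n S
    rw [Finset.sum_add_distrib, Finset.sum_add_distrib] at h
    have h' := sum_step_le hV noInfo hK₁₂0 hδ hK₁₂ hK₁₂δ α hα0 c.input hSn hS' hδS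
    rw [havg fun i ζ => cmi (chan W) noInfo (prodMarginals (stepMass α c.input S n i ζ))] at h'
    have h'' := h.trans (add_le_add h' (add_le_add hd₁ hd₂))
    simp only [prodMarginals, cmi_noInfo] at h''
    have hlog : Real.log (Fintype.card (Fin c.M₁ × Fin c.M₂)) =
        Real.log c.M₁ + Real.log c.M₂ := by
      rw [Fintype.card_prod, Fintype.card_fin, Fintype.card_fin, Nat.cast_mul, Real.log_mul
        (Nat.cast_ne_zero.2 c.M₁_pos.ne') (Nat.cast_ne_zero.2 c.M₂_pos.ne')]
    rw [hlog] at h''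
    have hE₁ : (c.expect W fun y => (c.N₁ y : ℝ≥0∞)).toReal = (c.meanN₁ W).toReal := rfl
    have hE₂ : (c.expect W fun y => (c.N₂ y : ℝ≥0∞)).toReal = (c.meanN₂ W).toReal := rfl
    rw [hE₁, hE₂] at h''
    linarith

end VLCode

end CodeRegion

/-! ### Letting the decoding times grow. -/

section Asymptotics

variable {X₁ X₂ Y : Type*} [Fintype X₁] [Fintype X₂] [Nonempty X₁] [Nonempty X₂] [Fintype Y]
  [Nonempty Y] [MeasurableSpace Y] [DiscreteMeasurableSpace Y]

lemma VLCode.exists_successProb_ge (c : VLCode X₁ X₂ Y) (W : X₁ → X₂ → PMF Y)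
    (hfin : c.FiniteMean W) {ε : ℝ} (hε : (c.errorProb W).toReal < ε) :
    ∃ n, 0 < n ∧ 1 - ε ≤ c.successProb W n := by
  have h1 := (c.hasSum_survival W (dependsOnFirst_lt c.stop₁) hfin.1).summable.tendsto_atTop_zero
  have h2 := (c.hasSum_survival W (dependsOnFirst_lt c.stop₂) hfin.2).summable.tendsto_atTop_zero
  have h := (h1.add h2).eventually_lt_const
    (show 0 + 0 < ε - (c.errorProb W).toReal by linarith)
  obtain ⟨n, hn, hn0⟩ := (h.and (Filter.eventually_gt_atTop 0)).exists
  have hs := c.decodedBy_ge W (n := n)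
  exact ⟨n, hn0, le_trans (by linarith) hs⟩

/-- Since `R - C ≤ 0`, the ratio bound gives `E * ((R - C) / r) ≤ (R - C) * F`, hence `E * (C + (R -
C) / r) + C * (F - E) ≤ R * F ≤ ℓ`. Of the slack `τ * E`, one quarter pays for `B`, one quarter for
the loss `ε * ℓ`, and half is kept for later. -/
lemma scaled_rate_le {E F G ℓ R C r τ ε K B : ℝ} (hr : 0 < r) (hRC : R ≤ C)
    (hrF : r * F ≤ E) (hG : 1 - ε ≤ G) (hℓ0 : 0 ≤ ℓ) (hRℓ : R * F ≤ ℓ) (hℓ : ℓ ≤ K * F)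
    (hε0 : 0 ≤ ε) (hε : ε * (K * F) ≤ τ / 4 * E) (hB : B ≤ τ / 4 * E) :
    E * (C + (R - C) / r - τ) + τ / 2 * E + B + C * (F - E) ≤ G * ℓ := by
  have h1 : E * ((R - C) / r) ≤ (R - C) * F := by
    rw [mul_div_assoc', div_le_iff₀ hr]
    have := mul_le_mul_of_nonneg_left hrF (sub_nonneg.2 hRC)
    linarith
  have h2 := mul_le_mul_of_nonneg_right hG hℓ0
  have h3 := mul_le_mul_of_nonneg_left hℓ hε0
  linarith

/-- An a priori bound of the logarithm by a multiple of the mean time. It makes the loss `ε * ℓ`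
from imperfect decoding proportional to `F`. -/
lemma log_le_of_half_le {G ℓ C F : ℝ} (hG : 1 / 2 ≤ G) (hℓ : 0 ≤ ℓ) (hF : 1 ≤ F)
    (h : G * ℓ ≤ Real.log 2 + C * F) : ℓ ≤ 2 * (Real.log 2 + C) * F := by
  have h1 := mul_le_mul_of_nonneg_right hG hℓ
  have h2 := mul_le_mul_of_nonneg_left hF (Real.log_nonneg one_le_two)
  linarith

variable (W : X₁ → X₂ → PMF Y) {r₁ r₂ R₁ R₂ : ℝ}

/-- The point in question is the preimage of `(R₁, R₂)` under the affine map of the theorem. The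
order of choice matters: `η` from `τ`, then the constants of `exists_cmi_le`, then `δ`, and only
then the code, whose length must outweigh `B`. -/
lemma mem_blockRegion_of_growing (hr₁ : 0 < r₁) (hr₂ : 0 < r₂) (hR₁ : R₁ ≤ cap₁ W)
    (hR₂ : R₂ ≤ cap₂ W) (h : ∀ ε : ℝ, 0 < ε → ∀ L : ℝ, ∃ c : VLCode X₁ X₂ Y,
      c.Meets W r₁ r₂ R₁ R₂ ∧ (c.errorProb W).toReal < ε ∧ L ≤ (c.meanN W).toReal) :
    (cap₁ W + (R₁ - cap₁ W) / r₁, cap₂ W + (R₂ - cap₂ W) / r₂) ∈ blockRegion W := by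
  have hV := isStochastic_chan W
  have hc₁ := cap₁_nonneg W
  have hc₂ := cap₂_nonneg W
  have hlog2 : 0 ≤ Real.log 2 := Real.log_nonneg one_le_two
  refine mem_blockRegion_of_forall_sub W fun τ hτ => ?_
  have hη : 0 < τ / 8 := by linarith
  obtain ⟨K₁, hK₁0, hK₁⟩ := exists_cmi_le hV Prod.snd hη
  obtain ⟨K₂, hK₂0, hK₂⟩ := exists_cmi_le hV Prod.fst hη
  obtain ⟨K₁₂, hK₁₂0, hK₁₂⟩ := exists_cmi_le hV noInfo hη
  have hK0 : 0 < K₁ + K₂ + K₁₂ + 1 := by linarith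
  set δ := τ / 8 / (K₁ + K₂ + K₁₂ + 1) with hδ
  have hδ0 : 0 < δ := div_pos hη hK0
  have hKδ : ∀ {K}, K ≤ K₁ + K₂ + K₁₂ + 1 → K * δ ≤ τ / 8 := fun {K} hK => by
    refine (mul_le_mul_of_nonneg_right hK hδ0.le).trans_eq ?_
    rw [hδ]
    field_simp
  set K := 2 * (Real.log 2 + cap₁ W + cap₂ W) with hK
  have hK' : 0 ≤ K := by positivity
  set ρ := min r₁ r₂ with hρ
  have hρ0 : 0 < ρ := lt_min hr₁ hr₂
  -- The value `1 / 2` is for the a priori bound. The other value gives `ε * K ≤ τ / 4 * ρ`, and `ρ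
  -- * F ≤ E` for both users turns the decoding loss into at most `τ / 4 * E`.
  set ε := min (1 / 2) (τ / 4 * ρ / (K + 1)) with hε
  have hε0 : 0 < ε := lt_min (by norm_num) (by positivity)
  set B := Real.log (Fintype.card (X₁ × X₂)) / δ + Real.log 2 with hB
  have hB0 : 0 ≤ B := add_nonneg (div_nonneg (Real.log_natCast_nonneg _) hδ0.le) hlog2
  obtain ⟨c, ⟨hfin, hm₁, hm₂, hR₁', hR₂', hr₁', hr₂'⟩, hPe, hL⟩ := h ε hε0 (B / (τ / 4))
  obtain ⟨n, hn, hG⟩ := c.exists_successProb_ge W hfin hPe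
  have hE := c.one_le_meanN W hfin hm₁ hm₂
  have hE₁ := ENNReal.toReal_mono hfin.1 (c.meanN_le₁ W)
  have hE₂ := ENNReal.toReal_mono hfin.2 (c.meanN_le₂ W)
  have hl₁ := c.log_M₁_le W hfin.1 n
  have hl₂ := c.log_M₂_le W hfin.2 n
  have hbound := c.mem_blockRegion W hfin hm₁ hm₂ hn hδ0 hK₁0 hK₂0 hK₁₂0 hK₁ hK₂ hK₁₂
    (hKδ (by linarith)) (hKδ (by linarith)) (hKδ (by linarith))
    (b₁ := cap₁ W + (R₁ - cap₁ W) / r₁ - τ) (b₂ := cap₂ W + (R₂ - cap₂ W) / r₂ - τ)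
  set E := (c.meanN W).toReal
  set F₁ := (c.meanN₁ W).toReal
  set F₂ := (c.meanN₂ W).toReal
  have hF₁ : 0 < F₁ := by linarith
  have hF₂ : 0 < F₂ := by linarith
  rw [le_div_iff₀ hF₁] at hR₁' hr₁'
  rw [le_div_iff₀ hF₂] at hR₂' hr₂'
  have hM₁ : 0 ≤ Real.log c.M₁ := Real.log_natCast_nonneg _
  have hM₂ : 0 ≤ Real.log c.M₂ := Real.log_natCast_nonneg _
  have hhalf : 1 / 2 ≤ c.successProb W n := by
    have : ε ≤ 1 / 2 := min_le_left _ _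
    linarith
  have hK₁F : Real.log c.M₁ ≤ K * F₁ :=
    (log_le_of_half_le hhalf hM₁ (hE.trans hE₁) hl₁).trans
      (mul_le_mul_of_nonneg_right (by linarith) hF₁.le)
  have hK₂F : Real.log c.M₂ ≤ K * F₂ :=
    (log_le_of_half_le hhalf hM₂ (hE.trans hE₂) hl₂).trans
      (mul_le_mul_of_nonneg_right (by linarith) hF₂.le)
  have hεK : ε * K ≤ τ / 4 * ρ := by
    have : ε * (K + 1) ≤ τ / 4 * ρ := (le_div_iff₀ (by linarith)).1 (min_le_right _ _)
    linarith
  have hεF : ∀ {r F : ℝ}, ρ ≤ r → 0 < F → r * F ≤ E → ε * (K * F) ≤ τ / 4 * E := by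
    intro r F hρr hF hrF
    have h1 := mul_le_mul_of_nonneg_right hεK hF.le
    have h2 := mul_le_mul_of_nonneg_right hρr hF.le
    have h3 := mul_le_mul_of_nonneg_left (h2.trans hrF) (show 0 ≤ τ / 4 by linarith)
    linarith
  have hBE : B ≤ τ / 4 * E := by
    rw [div_le_iff₀ (by linarith)] at hL
    linarith
  have n₁ := scaled_rate_le hr₁ hR₁ hr₁' hG hM₁ hR₁' hK₁F hε0.le
    (hεF (min_le_left _ _) hF₁ hr₁') hBE
  have n₂ := scaled_rate_le hr₂ hR₂ hr₂' hG hM₂ hR₂' hK₂F hε0.le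
    (hεF (min_le_right _ _) hF₂ hr₂') hBE
  have hτE : 0 ≤ τ * E := by positivity
  exact hbound (by linarith) (by linarith) (by linarith)

/-- Half of `τ` absorbs the loss `ε * ℓ`, with `ℓ` bounded a priori by `K * F`. The other half
absorbs `log 2`, which is small against a large `F`. -/
lemma le_of_successProb_bounds {R C : ℝ} (hC : 0 ≤ C)
    (h : ∀ ε : ℝ, 0 < ε → ∀ L : ℝ, ∃ G ℓ F : ℝ, 1 - ε ≤ G ∧ 0 ≤ ℓ ∧ 1 ≤ F ∧ L ≤ F ∧
      R * F ≤ ℓ ∧ G * ℓ ≤ Real.log 2 + C * F) : R ≤ C := by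
  have hlog2 : 0 ≤ Real.log 2 := Real.log_nonneg one_le_two
  set K := 2 * (Real.log 2 + C) with hK
  have hK' : 0 ≤ K := by positivity
  refine le_of_forall_pos_le_add fun τ hτ => ?_
  set ε := min (1 / 2) (τ / 2 / (K + 1)) with hε
  have hε0 : 0 < ε := lt_min (by norm_num) (by positivity)
  obtain ⟨G, ℓ, F, hG, hℓ, hF, hL, hR, hl⟩ := h ε hε0 (Real.log 2 / (τ / 2))
  have hhalf : 1 / 2 ≤ G := by
    have : ε ≤ 1 / 2 := min_le_left _ _
    linarith
  have hKF := log_le_of_half_le hhalf hℓ hF hl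
  have hεK : ε * K ≤ τ / 2 := by
    have : ε * (K + 1) ≤ τ / 2 := (le_div_iff₀ (by linarith)).1 (min_le_right _ _)
    linarith
  rw [div_le_iff₀ (by linarith)] at hL
  have h1 := mul_le_mul_of_nonneg_right hG hℓ
  have h2 := mul_le_mul_of_nonneg_left hKF hε0.le
  have h3 := mul_le_mul_of_nonneg_right hεK (zero_le_one.trans hF)
  exact le_of_mul_le_mul_right (by linarith) (zero_lt_one.trans_le hF)

lemma rate₁_le_cap₁ (h : ∀ ε : ℝ, 0 < ε → ∀ L : ℝ, ∃ c : VLCode X₁ X₂ Y,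
      c.Meets W r₁ r₂ R₁ R₂ ∧ (c.errorProb W).toReal < ε ∧ L ≤ (c.meanN₁ W).toReal) :
    R₁ ≤ cap₁ W := by
  refine le_of_successProb_bounds (cap₁_nonneg W) fun ε hε L => ?_
  obtain ⟨c, ⟨hfin, hm₁, hm₂, hR, -⟩, hPe, hL⟩ := h ε hε L
  obtain ⟨n, -, hG⟩ := c.exists_successProb_ge W hfin hPe
  exact ⟨_, _, _, hG, Real.log_natCast_nonneg _,
    (c.one_le_meanN W hfin hm₁ hm₂).trans (ENNReal.toReal_mono hfin.1 (c.meanN_le₁ W)), hL,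
    (le_div_iff₀ (ENNReal.toReal_pos hm₁.ne' hfin.1)).1 hR, c.log_M₁_le W hfin.1 n⟩

lemma rate₂_le_cap₂ (h : ∀ ε : ℝ, 0 < ε → ∀ L : ℝ, ∃ c : VLCode X₁ X₂ Y,
      c.Meets W r₁ r₂ R₁ R₂ ∧ (c.errorProb W).toReal < ε ∧ L ≤ (c.meanN₂ W).toReal) :
    R₂ ≤ cap₂ W := by
  refine le_of_successProb_bounds (cap₂_nonneg W) fun ε hε L => ?_
  obtain ⟨c, ⟨hfin, hm₁, hm₂, -, hR, -⟩, hPe, hL⟩ := h ε hε L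
  obtain ⟨n, -, hG⟩ := c.exists_successProb_ge W hfin hPe
  exact ⟨_, _, _, hG, Real.log_natCast_nonneg _,
    (c.one_le_meanN W hfin hm₁ hm₂).trans (ENNReal.toReal_mono hfin.2 (c.meanN_le₂ W)), hL,
    (le_div_iff₀ (ENNReal.toReal_pos hm₂.ne' hfin.2)).1 hR, c.log_M₂_le W hfin.2 n⟩

end Asymptotics

/-! ### Small error probability needs long decoding times. -/

section ZeroError

variable {X₁ X₂ Y : Type*} [Fintype X₁] [Fintype X₂] [Nonempty X₁] [Nonempty X₂] [Fintype Y]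
  [Nonempty Y] [MeasurableSpace Y] [DiscreteMeasurableSpace Y]

lemma exists_perm_apply_ne {M : ℕ} (h : 2 ≤ M) : ∃ σ : Equiv.Perm (Fin M), ∀ w, σ w ≠ w := by
  obtain ⟨m, rfl⟩ := Nat.exists_eq_add_of_le' h
  exact ⟨Equiv.addRight 1, fun w => by simp⟩

/-- The outputs that are possible do not depend on the first input letter. -/
def CommonSupport₁ (W : X₁ → X₂ → PMF Y) : Prop :=
  ∀ a b x₂ y, W a x₂ y ≠ 0 → W b x₂ y ≠ 0

/-- The constant is the least positive transition probability; the value `1` in place of zero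
entries takes them out of the minimum. -/
lemma CommonSupport₁.exists_mul_le {W : X₁ → X₂ → PMF Y} (h : CommonSupport₁ W) :
    ∃ δ : ℝ, 0 < δ ∧ ∀ a b x₂ y, δ * chan W (a, x₂) y ≤ chan W (b, x₂) y := by
  classical
  obtain ⟨⟨x, y⟩, hxy⟩ := Finite.exists_min fun p : (X₁ × X₂) × Y =>
    if chan W p.1 p.2 = 0 then 1 else chan W p.1 p.2
  have hV := isStochastic_chan W
  refine ⟨if chan W x y = 0 then 1 else chan W x y, ?_, fun a b x₂ y' => ?_⟩
  · split_ifs with h0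
    · exact one_pos
    · exact (hV.nonneg x y).lt_of_ne' h0
  · by_cases ha : chan W (a, x₂) y' = 0
    · rw [ha, mul_zero]
      exact hV.nonneg _ _
    · have hb : chan W (b, x₂) y' ≠ 0 := by
        simp only [chan, ne_eq, ENNReal.toReal_eq_zero_iff, PMF.apply_ne_top, or_false] at ha ⊢
        exact h a b x₂ y' ha
      have h1 := hxy ((b, x₂), y')
      simp only [if_neg hb] at h1
      refine le_trans (mul_le_of_le_one_right ?_ ?_) h1
      · split_ifs <;> [exact zero_le_one; exact hV.nonneg _ _]
      · rw [← hV.sum_eq_one (a, x₂)]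
        exact Finset.single_le_sum (fun y _ => hV.nonneg _ y) (Finset.mem_univ y')

lemma seqExp_ge {X : Type*} {V : X → Y → ℝ} (hV : IsStochastic V) {x x' : ℕ → X} {δ : ℝ}
    (hδ : 0 ≤ δ) (h : ∀ i y, δ * V (x i) y ≤ V (x' i) y) (n : ℕ) {G : (ℕ → Y) → ℝ}
    (hG : ∀ y, 0 ≤ G y) : δ ^ n * seqExp V x n G ≤ seqExp V x' n G := by
  unfold seqExp
  rw [Finset.mul_sum]
  refine Finset.sum_le_sum fun y _ => ?_
  rw [← mul_assoc]
  refine mul_le_mul_of_nonneg_right ?_ (hG _)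
  calc δ ^ n * ∏ i ∈ Finset.range n, V (x i) (ext y i)
      = ∏ i ∈ Finset.range n, δ * V (x i) (ext y i) := by
        rw [Finset.prod_mul_distrib, Finset.prod_const, Finset.card_range]
    _ ≤ _ := Finset.prod_le_prod (fun i _ => mul_nonneg hδ (hV.nonneg _ _)) fun i _ => h _ _

namespace VLCode

variable (c : VLCode X₁ X₂ Y) (W : X₁ → X₂ → PMF Y)

lemma succ_mul_survival_le {N : (ℕ → Y) → ℕ∞}
    (hN : ∀ i : ℕ, DependsOnFirst i {y | (i : ℕ∞) < N y})
    (hfin : c.expect W (fun y => (N y : ℝ≥0∞)) ≠ ∞) (n : ℕ) :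
    (n + 1) * c.survival W N n ≤ (c.expect W fun y => (N y : ℝ≥0∞)).toReal := by
  refine le_trans ?_ (c.sum_survival_le W hN hfin (n + 1))
  have hanti : Antitone (c.survival W N) := antitone_nat_of_succ_le fun i =>
    Finset.sum_le_sum fun w _ => eventMass_succ_le (isStochastic_chan W) c.input
      (A := fun i y => (i : ℕ∞) < N y) hN
      (fun i j y hij h => lt_of_le_of_lt (Nat.cast_le.2 hij) h) i w
  have := Finset.card_nsmul_le_sum (Finset.range (n + 1)) (c.survival W N) (c.survival W N n)
    fun i hi => hanti (Nat.lt_succ_iff.1 (Finset.mem_range.1 hi))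
  simpa using this

/-- Let `σ` permute the first user's messages without fixed point. Outputs on which `w₁` is decoded
by time `n` are errors when `σ w₁` is sent, and their probability then is at least `δ ^ n` times
that under `w₁`. -/
lemma errorProb_ge (hM : 2 ≤ c.M₁) {δ : ℝ} (hδ0 : 0 ≤ δ)
    (hδ : ∀ a b x₂ y, δ * chan W (a, x₂) y ≤ chan W (b, x₂) y) (n : ℕ) :
    δ ^ n * (1 - (c.errorProb W).toReal - c.survival W c.N₁ n) ≤ (c.errorProb W).toReal := by
  classical
  have hV := isStochastic_chan W
  have hN := dependsOnFirst_lt c.stop₁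
  obtain ⟨σ, hσ⟩ := exists_perm_apply_ne hM
  set M : ℝ := (Fintype.card (Fin c.M₁ × Fin c.M₂) : ℝ) with hMdef
  have hM0 : 0 < M := Nat.cast_pos.2 Fintype.card_pos
  set bad : Fin c.M₁ × Fin c.M₂ → Set (ℕ → Y) := fun w =>
    {y | ¬ (DecodesTo c.N₁ c.dec₁ w.1 y ∧ DecodesTo c.N₂ c.dec₂ w.2 y)} with hbad
  set D : Fin c.M₁ → Set (ℕ → Y) := fun w₁ => {y | c.N₁ y ≤ n ∧ DecodesTo c.N₁ c.dec₁ w₁ y} with hD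
  have hDdep : ∀ w₁, DependsOnFirst n (D w₁) := fun w₁ y y' h =>
    ⟨decodesTo_congr hN c.dec₁ w₁ h, decodesTo_congr hN c.dec₁ w₁ fun j hj => (h j hj).symm⟩
  set μ : Fin c.M₁ × Fin c.M₂ → Measure (ℕ → Y) := fun w => c.outputLaw W w.1 w.2 with hμ
  have hPe : M * (c.errorProb W).toReal = ∑ w, (μ w).real (bad w) := by
    rw [c.errorProb_toReal W, mul_div_cancel₀ _ hM0.ne']
  have hsurv : M * c.survival W c.N₁ n = ∑ w, (μ w).real {y | (n : ℕ∞) < c.N₁ y} := by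
    have : M = c.M₁ * c.M₂ := by simp [hMdef]
    rw [c.survival_eq W (hN n), ← this, mul_div_cancel₀ _ hM0.ne']
  have hshift : ∀ w : Fin c.M₁ × Fin c.M₂, δ ^ n * (μ w).real (D w.1) ≤
      (μ (σ w.1, w.2)).real (bad (σ w.1, w.2)) := by
    intro w
    refine le_trans ?_ (measureReal_mono (s₁ := D w.1) fun y hy h => hσ w.1 ?_)
    · rw [c.outputLaw_real W w (hDdep _), c.outputLaw_real W (σ w.1, w.2) (hDdep _)]
      exact seqExp_ge hV hδ0 (fun i y => hδ _ _ _ _) n fun y => by split_ifs <;> simp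
    · exact h.1.eq_decoded.trans hy.2.eq_decoded.symm
  have hD1 : ∀ w : Fin c.M₁ × Fin c.M₂, 1 - (μ w).real (bad w) -
      (μ w).real {y | (n : ℕ∞) < c.N₁ y} ≤ (μ w).real (D w.1) := by
    intro w
    have hcompl := probReal_add_probReal_compl (μ := μ w) (hDdep w.1).measurableSet
    have hsub : (D w.1)ᶜ ⊆ bad w ∪ {y | (n : ℕ∞) < c.N₁ y} := by
      intro y hy
      by_contra h
      simp only [hbad, Set.mem_union, Set.mem_ofPred_eq, not_or, not_not, not_lt] at h
      exact hy ⟨h.2, h.1.1⟩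
    have hle := (measureReal_mono (μ := μ w) hsub).trans (measureReal_union_le _ _)
    linarith
  have hperm : ∑ w : Fin c.M₁ × Fin c.M₂, (μ (σ w.1, w.2)).real (bad (σ w.1, w.2)) =
      ∑ w, (μ w).real (bad w) :=
    (Equiv.prodCongr σ (Equiv.refl _)).sum_comp fun w => (μ w).real (bad w)
  refine le_of_mul_le_mul_left ?_ hM0
  rw [hPe, ← hperm]
  calc M * (δ ^ n * (1 - (c.errorProb W).toReal - c.survival W c.N₁ n))
      = δ ^ n * (M - M * (c.errorProb W).toReal - M * c.survival W c.N₁ n) := by ring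
    _ = δ ^ n * ∑ w, (1 - (μ w).real (bad w) - (μ w).real {y | (n : ℕ∞) < c.N₁ y}) := by
        rw [hPe, hsurv, Finset.sum_sub_distrib, Finset.sum_sub_distrib]
        simp [hMdef]
    _ ≤ δ ^ n * ∑ w : Fin c.M₁ × Fin c.M₂, (μ w).real (D w.1) := by
        gcongr with w
        exact hD1 w
    _ ≤ _ := by
        rw [Finset.mul_sum]
        exact Finset.sum_le_sum fun w _ => hshift w

end VLCode

/-- If the mean were below `L`, then for `n ≥ 4 * L` Markov's inequality would bound the probability
of `N₁ > n` by `1 / 4`, and `errorProb_ge` would make the error at least `δ ^ n / 4`. -/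
lemma CommonSupport₁.exists_errorProb_bound {W : X₁ → X₂ → PMF Y} (h : CommonSupport₁ W) (L : ℝ) :
    ∃ ε : ℝ, 0 < ε ∧ ∀ c : VLCode X₁ X₂ Y, c.meanN₁ W ≠ ∞ → (c.errorProb W).toReal < ε →
      c.M₁ ≠ 1 → L ≤ (c.meanN₁ W).toReal := by
  obtain ⟨δ, hδ0, hδ⟩ := h.exists_mul_le
  obtain ⟨n, hn⟩ := exists_nat_ge (4 * L)
  have hδn : 0 < δ ^ n := pow_pos hδ0 n
  refine ⟨min (1 / 4) (δ ^ n / 4), lt_min (by norm_num) (by positivity), fun c hfin hPe hM => ?_⟩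
  by_contra! hL
  have h1 := c.succ_mul_survival_le W (dependsOnFirst_lt c.stop₁) hfin n
  have h2 := c.errorProb_ge W (by have := c.M₁_pos; omega) hδ0.le hδ n
  have h1' : (n + 1) * c.survival W c.N₁ n < L := lt_of_le_of_lt h1 hL
  have h3 : c.survival W c.N₁ n ≤ 1 / 4 := by
    have hn1 : (0 : ℝ) < n + 1 := by positivity
    refine le_of_mul_le_mul_left ?_ hn1
    linarith
  have h4 := hPe.trans_le (min_le_left _ _)
  have h5 := hPe.trans_le (min_le_right _ _)
  have h6 := mul_le_mul_of_nonneg_left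
    (show 1 / 4 ≤ 1 - (c.errorProb W).toReal - c.survival W c.N₁ n by linarith) hδn.le
  linarith

end ZeroError

/-! ### The first occurrence of an output letter. -/

section FirstOccurrence

variable {Y : Type*}

open Classical in
/-- The number of letters received when the letter `v` occurs for the first time. -/
def firstTime (v : Y) (y : ℕ → Y) : ℕ∞ :=
  if h : ∃ i, y i = v then ((Nat.find h + 1 : ℕ) : ℕ∞) else ⊤

lemma lt_firstTime_iff {v : Y} {y : ℕ → Y} {n : ℕ} : (n : ℕ∞) < firstTime v y ↔ ∀ j < n, y j ≠ v := by
  classical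
  unfold firstTime
  split_ifs with h
  · rw [Nat.cast_lt, Nat.lt_succ_iff, Nat.le_find_iff]
  · simp only [ENat.natCast_lt_top, true_iff]
    exact fun j _ hj => h ⟨j, hj⟩

lemma exists_of_firstTime_ne_top {v : Y} {y : ℕ → Y} (h : firstTime v y ≠ ⊤) :
    ∃ i : ℕ, firstTime v y = (i + 1 : ℕ) ∧ y i = v := by
  classical
  unfold firstTime at *
  split_ifs at * with h'
  · exact ⟨_, rfl, Nat.find_spec h'⟩
  · exact absurd rfl h

variable [MeasurableSpace Y] [DiscreteMeasurableSpace Y]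

lemma isStoppingTime_firstTime (v : Y) : IsStoppingTime (outputFiltration Y) (firstTime v) := by
  intro n
  have : {y : ℕ → Y | firstTime v y ≤ n} = ⋃ i ∈ Finset.range n, (fun y : ℕ → Y => y i) ⁻¹' {v} := by
    ext y
    have := (lt_firstTime_iff (v := v) (y := y) (n := n)).not
    simp only [not_lt, not_forall, not_not, exists_prop] at this
    simpa using this
  have key : MeasurableSet[outputFiltration Y n]
      (⋃ i ∈ Finset.range n, (fun y : ℕ → Y => y i) ⁻¹' {v}) := by
    refine Finset.measurableSet_biUnion _ fun i hi => ?_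
    have hle : MeasurableSpace.comap (fun y : ℕ → Y => y i) inferInstance ≤ outputFiltration Y n :=
      le_iSup₂_of_le (f := fun i (_ : i ∈ Finset.range n) =>
        MeasurableSpace.comap (fun y : ℕ → Y => y i) inferInstance) i hi le_rfl
    exact hle _ ⟨{v}, MeasurableSet.of_discrete, rfl⟩
  rw [← this] at key
  exact key

end FirstOccurrence

/-! ### A zero-error code when the supports differ. -/

section AlternatingCode

variable {X₁ X₂ Y : Type*} [Fintype X₁] [Fintype X₂] [Nonempty X₁] [Nonempty X₂] [Fintype Y]
  [Nonempty Y] [MeasurableSpace Y] [DiscreteMeasurableSpace Y]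

open Classical in
/-- The code that sends one bit by the order in which two letters of the first user alternate,
decided by the parity of the time at which the output `v` occurs first. -/
def alternatingCode (a b : X₁) (x₂ : X₂) (v : Y) : VLCode X₁ X₂ Y where
  M₁ := 2
  M₂ := 1
  M₁_pos := two_pos
  M₂_pos := one_pos
  enc₁ w i := if Even i ↔ w = 0 then a else b
  enc₂ _ _ := x₂
  N₁ := firstTime v
  N₂ _ := 0
  stop₁ := isStoppingTime_firstTime v
  stop₂ n := by simp
  -- Letters are numbered from zero, so a first occurrence at an even index leaves a list of odd
  -- length.
  dec₁ l := if Odd l.length then 0 else 1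
  dec₂ _ := 0

/-- A single factor may be one, but two successive factors gain `r ^ 2`. The division by `r` allows
for an unpaired factor. -/
lemma prod_range_le_of_pair_le {g : ℕ → ℝ} {r : ℝ} (hr0 : 0 < r) (hr1 : r ≤ 1) (hg0 : ∀ i, 0 ≤ g i)
    (hg1 : ∀ i, g i ≤ 1) (hg : ∀ i, g i * g (i + 1) ≤ r ^ 2) (n : ℕ) :
    ∏ i ∈ Finset.range n, g i ≤ r ^ n / r := by
  induction n using Nat.twoStepInduction with
  | zero => simpa using (one_le_inv₀ hr0).2 hr1
  | one => simpa [hr0.ne'] using hg1 0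
  | more n ih _ =>
    rw [Finset.prod_range_succ, Finset.prod_range_succ, mul_assoc, pow_add, mul_div_right_comm]
    exact mul_le_mul ih (hg n) (mul_nonneg (hg0 _) (hg0 _)) (by positivity)

variable {W : X₁ → X₂ → PMF Y} {a b : X₁} {x₂ : X₂} {v : Y}

lemma outputLaw_firstTime (c : VLCode X₁ X₂ Y) (w : Fin c.M₁ × Fin c.M₂) (n : ℕ) :
    (c.outputLaw W w.1 w.2).real {y | (n : ℕ∞) < firstTime v y} =
      ∏ i ∈ Finset.range n, (1 - chan W (c.input w i) v) := by
  have : {y : ℕ → Y | (n : ℕ∞) < firstTime v y} = Set.pi (Finset.range n) fun _ => {v}ᶜ := by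
    ext y
    simp [lt_firstTime_iff, Set.mem_pi]
  rw [this, measureReal_def, VLCode.outputLaw,
    Measure.infinitePi_pi _ (fun _ _ => MeasurableSet.of_discrete), ENNReal.toReal_prod]
  refine Finset.prod_congr rfl fun i _ => ?_
  rw [← measureReal_def, probReal_compl_eq_one_sub MeasurableSet.of_discrete, measureReal_def,
    PMF.toMeasure_apply_singleton _ _ MeasurableSet.of_discrete]
  rfl

lemma exists_alternatingCode_le (ha : W a x₂ v ≠ 0) : ∃ r : ℝ, 0 < r ∧ r < 1 ∧
    ∀ (w : Fin (alternatingCode a b x₂ v).M₁ × Fin (alternatingCode a b x₂ v).M₂) (n : ℕ),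
    ((alternatingCode a b x₂ v).outputLaw W w.1 w.2).real {y | (n : ℕ∞) < firstTime v y} ≤
      r ^ n / r := by
  have hV := isStochastic_chan W
  have hle : ∀ x, chan W x v ≤ 1 := fun x => by
    rw [← hV.sum_eq_one x]
    exact Finset.single_le_sum (fun y _ => hV.nonneg x y) (Finset.mem_univ v)
  have hp : 0 < chan W (a, x₂) v := ENNReal.toReal_pos ha (PMF.apply_ne_top _ _)
  -- The maximum with `1 / 2` keeps the base of the geometric bound positive even if `v` is certain
  -- under `a`.
  set t := max (1 - chan W (a, x₂) v) (1 / 2) with ht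
  have ht0 : 0 < t := lt_max_of_lt_right (by norm_num)
  have ht1 : t < 1 := max_lt (by linarith) (by norm_num)
  have hr1 : √t < 1 := by rw [Real.sqrt_lt' one_pos]; linarith
  refine ⟨√t, Real.sqrt_pos.2 ht0, hr1, fun w n => ?_⟩
  rw [outputLaw_firstTime]
  set x := (alternatingCode a b x₂ v).input w with hx
  have hx' : ∀ i, x i = (a, x₂) ∨ x (i + 1) = (a, x₂) := by
    intro i
    simp only [hx, VLCode.input, alternatingCode, Nat.even_add_one]
    by_cases h1 : Even i <;> by_cases h2 : @Eq (Fin 2) w.1 0 <;> simp [h1, h2]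
  have h0 : ∀ i, 0 ≤ 1 - chan W (x i) v := fun i => sub_nonneg.2 (hle _)
  have h1 : ∀ i, 1 - chan W (x i) v ≤ 1 := fun i => by linarith [hV.nonneg (x i) v]
  refine prod_range_le_of_pair_le (Real.sqrt_pos.2 ht0) hr1.le h0 h1 (fun i => ?_) n
  rw [Real.sq_sqrt ht0.le]
  refine le_trans ?_ (le_max_left _ _)
  rcases hx' i with h | h
  · rw [← h]
    exact mul_le_of_le_one_right (h0 _) (h1 _)
  · rw [← h]
    exact mul_le_of_le_one_left (h0 _) (h1 _)

lemma alternatingCode_finiteMean (ha : W a x₂ v ≠ 0) :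
    (alternatingCode a b x₂ v).FiniteMean W := by
  obtain ⟨r, hr0, hr1, hr⟩ := exists_alternatingCode_le (b := b) ha
  set c := alternatingCode a b x₂ v with hc
  refine ⟨?_, ?_⟩
  · rw [VLCode.meanN₁, c.expect_eq_tsum W (dependsOnFirst_lt c.stop₁)]
    refine Summable.tsum_ofReal_ne_top (Summable.of_nonneg_of_le (c.survival_nonneg W c.N₁)
      (fun n => ?_) ((summable_geometric_of_lt_one hr0.le hr1).div_const r))
    rw [c.survival_eq W (dependsOnFirst_lt c.stop₁ n), div_le_iff₀
      (mul_pos (Nat.cast_pos.2 c.M₁_pos) (Nat.cast_pos.2 c.M₂_pos))]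
    refine (Finset.sum_le_card_nsmul _ _ (r ^ n / r) fun w _ => hr w n).trans_eq ?_
    rw [Finset.card_univ, Fintype.card_prod, Fintype.card_fin, Fintype.card_fin, nsmul_eq_mul,
      mul_comm, Nat.cast_mul]
  · have : c.meanN₂ W = c.expect W fun _ => 0 := by simp [VLCode.meanN₂, hc, alternatingCode]
    rw [this, c.expect_zero]
    exact ENNReal.zero_ne_top

/-- Almost surely `v` occurs, and never at a time when `b` is sent. So the parity of its first
occurrence tells at which times `a` is sent, and thereby the message. -/
lemma alternatingCode_errorProb (ha : W a x₂ v ≠ 0) (hb : W b x₂ v = 0) :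
    (alternatingCode a b x₂ v).errorProb W = 0 := by
  obtain ⟨r, hr0, hr1, hr⟩ := exists_alternatingCode_le (b := b) ha
  set c := alternatingCode a b x₂ v with hc
  rw [VLCode.errorProb, ENNReal.div_eq_zero_iff]
  refine Or.inl (Finset.sum_eq_zero fun w₁ _ => Finset.sum_eq_zero fun w₂ _ => ?_)
  have htop : c.outputLaw W w₁ w₂ {y | firstTime v y = ⊤} = 0 := by
    rw [← measureReal_eq_zero_iff]
    refine le_antisymm ?_ measureReal_nonneg
    have hlim := (tendsto_pow_atTop_nhds_zero_of_lt_one hr0.le hr1).div_const r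
    rw [zero_div] at hlim
    refine ge_of_tendsto' hlim fun n => (measureReal_mono fun y hy => ?_).trans (hr (w₁, w₂) n)
    rw [Set.mem_ofPred_eq] at hy ⊢
    rw [hy]
    exact ENat.natCast_lt_top n
  have hnull : ∀ i, c.enc₁ w₁ i = b → c.outputLaw W w₁ w₂ {y | y i = v} = 0 := by
    intro i hi
    have : {y : ℕ → Y | y i = v} = Set.pi ({i} : Finset ℕ) fun _ => {v} := by
      ext y
      simp
    rw [this, VLCode.outputLaw, Measure.infinitePi_pi _ (fun _ _ => MeasurableSet.of_discrete),
      Finset.prod_singleton, PMF.toMeasure_apply_singleton _ _ MeasurableSet.of_discrete, hi]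
    exact hb
  refine measure_mono_null (t := {y | firstTime v y = ⊤} ∪
    ⋃ i, ⋃ (_ : c.enc₁ w₁ i = b), {y | y i = v}) (fun y hy => ?_)
    (measure_union_null htop (measure_iUnion_null fun i => measure_iUnion_null fun hi => hnull i hi))
  by_contra h
  simp only [Set.mem_union, Set.mem_iUnion, Set.mem_ofPred_eq, exists_prop, not_or, not_exists,
    not_and] at h
  obtain ⟨i, hi, hyi⟩ := exists_of_firstTime_ne_top h.1
  refine hy ⟨⟨i + 1, hi, ?_⟩, 0, rfl, Subsingleton.elim (α := Fin 1) _ _⟩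
  have hab : Even i ↔ @Eq (Fin 2) w₁ 0 := by
    by_contra h'
    exact h.2 i (if_neg h') hyi
  change (if Odd (List.ofFn fun j : Fin (i + 1) => y j).length then (0 : Fin 2) else 1) = w₁
  rw [List.length_ofFn]
  by_cases hev : Even i
  · rw [if_pos hev.add_one]
    exact (hab.1 hev).symm
  · rw [if_neg (by rwa [Nat.odd_add_one, Nat.not_odd_iff_even])]
    exact (Fin.eq_one_of_ne_zero w₁ fun h => hev (hab.2 h)).symm

lemma ZeroErrorCapacityZero.commonSupport₁ (h : ZeroErrorCapacityZero W) : CommonSupport₁ W := by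
  intro a b x₂ v ha hb
  have := (h (alternatingCode a b x₂ v) (alternatingCode_finiteMean ha)
    (alternatingCode_errorProb ha hb)).1
  simp [alternatingCode] at this

end AlternatingCode

/-! ### Interchanging the users. -/

section Swap

variable {X₁ X₂ Y : Type*} [Fintype X₁] [Fintype X₂] [Nonempty X₁] [Nonempty X₂] [Fintype Y]
  [Nonempty Y] [MeasurableSpace Y] [DiscreteMeasurableSpace Y]

/-- The code with the two users interchanged. -/
def VLCode.swap (c : VLCode X₁ X₂ Y) : VLCode X₂ X₁ Y where
  M₁ := c.M₂
  M₂ := c.M₁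
  M₁_pos := c.M₂_pos
  M₂_pos := c.M₁_pos
  enc₁ := c.enc₂
  enc₂ := c.enc₁
  N₁ := c.N₂
  N₂ := c.N₁
  stop₁ := c.stop₂
  stop₂ := c.stop₁
  dec₁ := c.dec₂
  dec₂ := c.dec₁

lemma VLCode.expect_swap (c : VLCode X₁ X₂ Y) (W : X₁ → X₂ → PMF Y) (f : (ℕ → Y) → ℝ≥0∞) :
    c.swap.expect (fun x₂ x₁ => W x₁ x₂) f = c.expect W f := by
  unfold expect
  rw [Finset.sum_comm, mul_comm]
  rfl

lemma VLCode.errorProb_swap (c : VLCode X₁ X₂ Y) (W : X₁ → X₂ → PMF Y) :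
    c.swap.errorProb (fun x₂ x₁ => W x₁ x₂) = c.errorProb W := by
  unfold errorProb
  rw [Finset.sum_comm, mul_comm]
  congr 1
  refine Finset.sum_congr rfl fun w₁ _ => Finset.sum_congr rfl fun w₂ _ => ?_
  refine congrArg (c.outputLaw W w₁ w₂) (Set.ext fun y => ?_)
  exact not_congr and_comm

lemma ZeroErrorCapacityZero.swap {W : X₁ → X₂ → PMF Y} (h : ZeroErrorCapacityZero W) :
    ZeroErrorCapacityZero fun x₂ x₁ => W x₁ x₂ := by
  intro c hfin hPe
  have h₁ : c.swap.meanN₁ W = c.meanN₂ fun x₂ x₁ => W x₁ x₂ :=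
    c.expect_swap (fun x₂ x₁ => W x₁ x₂) _
  have h₂ : c.swap.meanN₂ W = c.meanN₁ fun x₂ x₁ => W x₁ x₂ :=
    c.expect_swap (fun x₂ x₁ => W x₁ x₂) _
  have h₃ : c.swap.errorProb W = c.errorProb fun x₂ x₁ => W x₁ x₂ :=
    c.errorProb_swap fun x₂ x₁ => W x₁ x₂
  exact (h c.swap ⟨h₁.trans_ne hfin.2, h₂.trans_ne hfin.1⟩ (h₃.trans hPe)).symm

/-- If the zero-error capacity is zero, codes with small error probability that transmit information
have long decoding times. -/
lemma ZeroErrorCapacityZero.exists_errorProb_bound {W : X₁ → X₂ → PMF Y}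
    (h : ZeroErrorCapacityZero W) (L : ℝ) : ∃ ε : ℝ, 0 < ε ∧ ∀ c : VLCode X₁ X₂ Y,
      c.FiniteMean W → (c.errorProb W).toReal < ε →
      (c.M₁ ≠ 1 → L ≤ (c.meanN₁ W).toReal) ∧ (c.M₂ ≠ 1 → L ≤ (c.meanN₂ W).toReal) := by
  obtain ⟨ε₁, hε₁, h₁⟩ := h.commonSupport₁.exists_errorProb_bound L
  obtain ⟨ε₂, hε₂, h₂⟩ := h.swap.commonSupport₁.exists_errorProb_bound L
  refine ⟨min ε₁ ε₂, lt_min hε₁ hε₂, fun c hfin hPe => ⟨h₁ c hfin.1 (hPe.trans_le (min_le_left _ _)),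
    fun hM => ?_⟩⟩
  have hm : c.swap.meanN₁ (fun x₂ x₁ => W x₁ x₂) = c.meanN₂ W := c.expect_swap W _
  have := h₂ c.swap (hm.trans_ne hfin.2)
    (by rw [c.errorProb_swap]; exact hPe.trans_le (min_le_right _ _)) hM
  rwa [hm] at this

end Swap

/-! ### The outer bound. -/

section OuterBound

variable {X₁ X₂ Y : Type*} [Fintype X₁] [Fintype X₂] [Nonempty X₁] [Nonempty X₂] [Fintype Y]

/-- The affine map matches the inequalities one by one for the same distribution. In the third one
`s * r₁ = r₂` gives both coordinates the common factor `r₂`. -/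
lemma mem_outerRegion_iff (W : X₁ → X₂ → PMF Y) {r₁ r₂ s a₁ a₂ : ℝ} (hr₁ : 0 < r₁) (hr₂ : 0 < r₂)
    (hrs : r₂ = s * r₁) :
    (r₁ * a₁ + (1 - r₁) * cap₁ W, r₂ * a₂ + (1 - r₂) * cap₂ W) ∈ outerRegion W r₁ r₂ s ↔
      (a₁, a₂) ∈ blockRegion W := by
  have h : s * (r₁ * a₁) = r₂ * a₁ := by rw [hrs]; ring
  refine exists_congr fun pQ => exists_congr fun p₁ => exists_congr fun p₂ =>
    and_congr ?_ (and_congr ?_ ?_)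
  · exact (add_le_add_iff_right _).trans (mul_le_mul_iff_right₀ hr₁)
  · exact (add_le_add_iff_right _).trans (mul_le_mul_iff_right₀ hr₂)
  · rw [← mul_le_mul_iff_right₀ (b := (a₁, a₂).1 + (a₁, a₂).2) hr₂]
    dsimp only
    constructor <;> intro h' <;> linarith

lemma mem_outerRegion_iff_sub_div (W : X₁ → X₂ → PMF Y) {r₁ r₂ s R₁ R₂ : ℝ} (hr₁ : 0 < r₁)
    (hr₂ : 0 < r₂) (hrs : r₂ = s * r₁) : (R₁, R₂) ∈ outerRegion W r₁ r₂ s ↔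
      (cap₁ W + (R₁ - cap₁ W) / r₁, cap₂ W + (R₂ - cap₂ W) / r₂) ∈ blockRegion W := by
  have h₁ : r₁ * (cap₁ W + (R₁ - cap₁ W) / r₁) + (1 - r₁) * cap₁ W = R₁ := by field_simp; ring
  have h₂ : r₂ * (cap₂ W + (R₂ - cap₂ W) / r₂) + (1 - r₂) * cap₂ W = R₂ := by field_simp; ring
  rw [← mem_outerRegion_iff W hr₁ hr₂ hrs, h₁, h₂]

lemma outerRegion_eq_image (W : X₁ → X₂ → PMF Y) {r₁ r₂ s : ℝ} (hr₁ : 0 < r₁) (hr₂ : 0 < r₂)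
    (hrs : r₂ = s * r₁) : outerRegion W r₁ r₂ s =
      (fun R : ℝ × ℝ => (r₁ * R.1 + (1 - r₁) * cap₁ W, r₂ * R.2 + (1 - r₂) * cap₂ W)) ''
        blockRegion W := by
  ext ⟨R₁, R₂⟩
  constructor
  · intro h
    refine ⟨_, (mem_outerRegion_iff_sub_div W hr₁ hr₂ hrs).1 h, ?_⟩
    ext <;> dsimp only <;> field_simp <;> ring
  · rintro ⟨⟨a₁, a₂⟩, ha, h⟩
    rw [← h]
    exact (mem_outerRegion_iff W hr₁ hr₂ hrs).2 ha

lemma mem_outerRegion_of_nonpos (W : X₁ → X₂ → PMF Y) {r₁ r₂ s R₁ R₂ : ℝ} (hr₁ : 0 ≤ r₁)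
    (hr₁' : r₁ ≤ 1) (hr₂ : 0 ≤ r₂) (hr₂' : r₂ ≤ 1) (hs : 0 ≤ s) (hR₁ : R₁ ≤ 0) (hR₂ : R₂ ≤ 0) :
    (R₁, R₂) ∈ outerRegion W r₁ r₂ s := by
  have hV := isStochastic_chan W
  obtain ⟨p, -⟩ := (exists_cap₁_eq W).1
  set pQ : stdSimplex ℝ (Fin 2) := ⟨Pi.single 0 1, single_mem_stdSimplex ℝ 0⟩
  have hQ : ∀ q, 0 ≤ pQ q := pQ.2.1
  have h₁ : 0 ≤ info₁ W pQ (fun _ => p.1) fun _ => p.2 := by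
    rw [info₁_eq]
    exact Finset.sum_nonneg fun q _ => mul_nonneg (hQ q) (cmi_nonneg hV _ (prodMass_nonneg _ _))
  have h₂ : 0 ≤ info₂ W pQ (fun _ => p.1) fun _ => p.2 := by
    rw [info₂_eq]
    exact Finset.sum_nonneg fun q _ => mul_nonneg (hQ q) (cmi_nonneg hV _ (prodMass_nonneg _ _))
  have h₁₂ : 0 ≤ info₁₂ W pQ (fun _ => p.1) fun _ => p.2 := by
    rw [info₁₂_eq]
    exact Finset.sum_nonneg fun q _ => mul_nonneg (hQ q) (mi_nonneg hV (prodMass_nonneg _ _))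
  have hc₁ := mul_nonneg (sub_nonneg.2 hr₁') (cap₁_nonneg W)
  have hc₂ := mul_nonneg (sub_nonneg.2 hr₂') (cap₂_nonneg W)
  refine ⟨pQ, fun _ => p.1, fun _ => p.2, ?_, ?_, ?_⟩
  · exact hR₁.trans (add_nonneg (mul_nonneg hr₁ h₁) hc₁)
  · exact hR₂.trans (add_nonneg (mul_nonneg hr₂ h₂) hc₂)
  · dsimp only
    have := mul_nonneg hs hc₁
    have := mul_nonneg hr₂ h₁₂
    have := mul_nonneg hs (neg_nonneg.2 hR₁)
    linarith

/-- With `s * r₁ = 0` the last two inequalities follow from the single-user bounds for any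
distribution. An input that attains `cap₁ W` turns the first one into `R₁ ≤ cap₁ W`. -/
lemma mem_outerRegion_of_le_cap (W : X₁ → X₂ → PMF Y) {r₁ s R₁ R₂ : ℝ} (hs : 0 ≤ s)
    (hrs : 0 = s * r₁) (hR₁ : R₁ ≤ cap₁ W) (hR₂ : R₂ ≤ cap₂ W) :
    (R₁, R₂) ∈ outerRegion W r₁ 0 s := by
  obtain ⟨p, hp⟩ := (exists_cap₁_eq W).1
  set pQ : stdSimplex ℝ (Fin 2) := ⟨Pi.single 0 1, single_mem_stdSimplex ℝ 0⟩ with hpQ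
  have h₁ : info₁ W pQ (fun _ => p.1) (fun _ => p.2) = cap₁ W := by
    rw [info₁_eq, ← Finset.sum_mul, hp, show ∑ q, pQ q = 1 from pQ.2.2, one_mul]
  refine ⟨pQ, fun _ => p.1, fun _ => p.2, ?_, ?_, ?_⟩
  · rw [h₁]
    linarith
  · dsimp only
    linarith
  · dsimp only
    have h2 := mul_le_mul_of_nonneg_left hR₁ hs
    have h3 : s * (1 - r₁) * cap₁ W = s * cap₁ W := by
      rw [mul_sub, ← hrs]
      ring
    rw [h3]
    linarith

variable [Nonempty Y] [MeasurableSpace Y] [DiscreteMeasurableSpace Y]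

lemma VLCode.Meets.M₁_ne_one {c : VLCode X₁ X₂ Y} {W : X₁ → X₂ → PMF Y} {r₁ r₂ R₁ R₂ : ℝ}
    (h : c.Meets W r₁ r₂ R₁ R₂) (hR : 0 < R₁) : c.M₁ ≠ 1 := fun hM => by
  have := h.2.2.2.1
  rw [hM, Nat.cast_one, Real.log_one, zero_div] at this
  linarith

lemma VLCode.Meets.M₂_ne_one {c : VLCode X₁ X₂ Y} {W : X₁ → X₂ → PMF Y} {r₁ r₂ R₁ R₂ : ℝ}
    (h : c.Meets W r₁ r₂ R₁ R₂) (hR : 0 < R₂) : c.M₂ ≠ 1 := fun hM => by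
  have := h.2.2.2.2.1
  rw [hM, Nat.cast_one, Real.log_one, zero_div] at this
  linarith

/-- Under either hypothesis of the outer bound, there are reliable codes for which every user with a
positive rate has a long decoding time. -/
lemma exists_long_code {W : X₁ → X₂ → PMF Y} {r₁ r₂ R₁ R₂ : ℝ}
    (h : (R₁, R₂) ∈ growingRateRegion W r₁ r₂ ∨
      (ZeroErrorCapacityZero W ∧ (R₁, R₂) ∈ rateRegion W r₁ r₂)) {ε : ℝ} (hε : 0 < ε) (L : ℝ) :
    ∃ c : VLCode X₁ X₂ Y, c.Meets W r₁ r₂ R₁ R₂ ∧ (c.errorProb W).toReal < ε ∧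
      (0 < R₁ → L ≤ (c.meanN₁ W).toReal) ∧ (0 < R₂ → L ≤ (c.meanN₂ W).toReal) := by
  rcases h with h | ⟨hz, h⟩
  · obtain ⟨n, hn⟩ := exists_nat_ge L
    obtain ⟨c, hc, hPe, h₁, h₂⟩ := h (ENNReal.ofReal ε) (ENNReal.ofReal_pos.2 hε) n
    refine ⟨c, hc, ENNReal.toReal_lt_of_lt_ofReal hPe, fun _ => hn.trans ?_, fun _ => hn.trans ?_⟩
    · simpa using ENNReal.toReal_mono hc.1.1 h₁
    · simpa using ENNReal.toReal_mono hc.1.2 h₂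
  · obtain ⟨ε', hε', hb⟩ := hz.exists_errorProb_bound L
    obtain ⟨c, hc, hPe⟩ := h (ENNReal.ofReal (min ε ε')) (ENNReal.ofReal_pos.2 (lt_min hε hε'))
    have hPe' := ENNReal.toReal_lt_of_lt_ofReal hPe
    obtain ⟨h₁, h₂⟩ := hb c hc.1 (hPe'.trans_le (min_le_right _ _))
    exact ⟨c, hc, hPe'.trans_le (min_le_left _ _), fun hR => h₁ (hc.M₁_ne_one hR),
      fun hR => h₂ (hc.M₂_ne_one hR)⟩

/-- If `r₂ = 0`, which includes `r₁ = 0`, the single-user bounds suffice, and two nonpositive rates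
need no code at all. Otherwise some user has a positive rate and hence a long mean time, and `E[N] ≥
r_j E[N_j]` makes `E[N]` long too. -/
lemma mem_outerRegion {W : X₁ → X₂ → PMF Y} {r₁ r₂ s R₁ R₂ : ℝ}
    (hr₁ : 0 ≤ r₁) (hr₁' : r₁ ≤ 1) (hr₂ : 0 ≤ r₂) (hr₂' : r₂ ≤ 1) (hs : 0 ≤ s) (hrs : r₂ = s * r₁)
    (h : (R₁, R₂) ∈ growingRateRegion W r₁ r₂ ∨
      (ZeroErrorCapacityZero W ∧ (R₁, R₂) ∈ rateRegion W r₁ r₂)) :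
    (R₁, R₂) ∈ outerRegion W r₁ r₂ s := by
  have hR₁ : R₁ ≤ cap₁ W := by
    rcases le_or_gt R₁ 0 with h0 | h0
    · exact h0.trans (cap₁_nonneg W)
    · refine rate₁_le_cap₁ W (r₁ := r₁) (r₂ := r₂) (R₂ := R₂) fun ε hε L => ?_
      obtain ⟨c, hc, hPe, h₁, -⟩ := exists_long_code h hε L
      exact ⟨c, hc, hPe, h₁ h0⟩
  have hR₂ : R₂ ≤ cap₂ W := by
    rcases le_or_gt R₂ 0 with h0 | h0
    · exact h0.trans (cap₂_nonneg W)
    · refine rate₂_le_cap₂ W (r₁ := r₁) (r₂ := r₂) (R₁ := R₁) fun ε hε L => ?_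
      obtain ⟨c, hc, hPe, -, h₂⟩ := exists_long_code h hε L
      exact ⟨c, hc, hPe, h₂ h0⟩
  rcases hr₂.eq_or_lt with h0 | hr₂0
  · subst h0
    exact mem_outerRegion_of_le_cap W hs hrs hR₁ hR₂
  have hr₁0 : 0 < r₁ := hr₁.lt_of_ne' fun h' => by simp [h', hrs] at hr₂0
  by_cases hneg : R₁ ≤ 0 ∧ R₂ ≤ 0
  · exact mem_outerRegion_of_nonpos W hr₁ hr₁' hr₂ hr₂' hs hneg.1 hneg.2
  refine (mem_outerRegion_iff_sub_div W hr₁0 hr₂0 hrs).2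
    (mem_blockRegion_of_growing W hr₁0 hr₂0 hR₁ hR₂ fun ε hε L => ?_)
  -- Either user may be the one with the positive rate, so the length is asked for with both ratios.
  obtain ⟨c, hc, hPe, h₁, h₂⟩ := exists_long_code h hε (max (L / r₁) (L / r₂))
  refine ⟨c, hc, hPe, ?_⟩
  obtain ⟨hfin, hm₁, hm₂, -, -, hr₁c, hr₂c⟩ := hc
  rw [le_div_iff₀ (ENNReal.toReal_pos hm₁.ne' hfin.1)] at hr₁c
  rw [le_div_iff₀ (ENNReal.toReal_pos hm₂.ne' hfin.2)] at hr₂c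
  rw [not_and_or, not_le, not_le] at hneg
  rcases hneg with hpos | hpos
  · have := (le_max_left _ _).trans (h₁ hpos)
    rw [div_le_iff₀ hr₁0] at this
    linarith
  · have := (le_max_right _ _).trans (h₂ hpos)
    rw [div_le_iff₀ hr₂0] at this
    linarith

end OuterBound

end MAC

end

theorem theorem1 {X₁ X₂ Y : Type*} [Fintype X₁] [Fintype X₂] [Fintype Y]
    [Nonempty X₁] [Nonempty X₂] [MeasurableSpace Y] [DiscreteMeasurableSpace Y]
    (W : X₁ → X₂ → PMF Y) (r₁ r₂ s : ℝ)
    (hr₁ : 0 ≤ r₁) (hr₁' : r₁ ≤ 1) (hr₂ : 0 ≤ r₂) (hr₂' : r₂ ≤ 1)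
    (hs : 0 ≤ s) (hrs : r₂ = s * r₁) :
    (∀ R₁ R₂ : ℝ,
      ((R₁, R₂) ∈ MAC.growingRateRegion W r₁ r₂ ∨
        (MAC.ZeroErrorCapacityZero W ∧ (R₁, R₂) ∈ MAC.rateRegion W r₁ r₂)) →
      ∃ (pQ : stdSimplex ℝ (Fin 2)) (p₁ : Fin 2 → stdSimplex ℝ X₁)
        (p₂ : Fin 2 → stdSimplex ℝ X₂),
        R₁ ≤ r₁ * MAC.info₁ W pQ p₁ p₂ + (1 - r₁) * MAC.cap₁ W ∧
        R₂ ≤ r₂ * MAC.info₂ W pQ p₁ p₂ + (1 - r₂) * MAC.cap₂ W ∧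
        s * R₁ + R₂ ≤ r₂ * MAC.info₁₂ W pQ p₁ p₂
          + s * (1 - r₁) * MAC.cap₁ W + (1 - r₂) * MAC.cap₂ W) ∧
    (0 < r₁ → 0 < r₂ →
      MAC.outerRegion W r₁ r₂ s =
        (fun R : ℝ × ℝ => (r₁ * R.1 + (1 - r₁) * MAC.cap₁ W,
          r₂ * R.2 + (1 - r₂) * MAC.cap₂ W)) '' MAC.blockRegion W) := by
  have : Nonempty Y := (W (Classical.arbitrary X₁) (Classical.arbitrary X₂)).support_nonempty.nonempty
  exact ⟨fun _ _ h => MAC.mem_outerRegion hr₁ hr₁' hr₂ hr₂' hs hrs h,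
    fun h₁ h₂ => MAC.outerRegion_eq_image W h₁ h₂ hrs⟩
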